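/- **Lemma 4.5.** Let $\varepsilon,\sigma,\gamma,\alpha,\chi>0$, let $y\in\mathbb R^2$, and let $\mathbf C_y:\mathbb R^2\to\mathbb R^2$ be bounded, uniformly continuous and of class $C^1$, with bounded and uniformly continuous partial derivatives $\partial_{x_1}\mathbf C_y,\partial_{x_2}\mathbf C_y$. Let $A$ be the infinitesimal generator of the heat semigroup on $L^1(\mathbb R^2)$ given by convolution with $K(t,x)=\frac{1}{4\pi\varepsilon^2t}e^{-|x|^2/(4\varepsilon^2t)}$, $t>0$ (so $Av=\varepsilon^2\Delta v$ for $v\in C^2_c(\mathbb R^2)$), and let $B_y$ be the operator in $L^1(\mathbb R^2)$ whose graph is the closure of the graph of $v\mapsto-\nabla\cdot(v\,\mathbf C_y)$, $v\in C^1_c(\mathbb R^2)$. Let $g(x)=\frac{1}{2\pi\sigma^2}e^{-|x|^2/(2\sigma^2)}$, and let $X=\mathbb R\times L^1(\mathbb R^2)\times L^1(\mathbb R^2)$ with the norm $\|(u,v,w)\|=|u|+\|v\|_{L^1}+\|w\|_{L^1}$. Define $$\mathcal A_y(u,v,w)=\bigl(-\gamma u,\ (A+B_y)v-\alpha v,\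 \alpha v-\chi w\bigr),\qquad \mathcal C_y(u,v,w)=\Bigl(\chi\int_{\mathbb R^2}w(x)\,dx,\ \gamma\,u\,g(\cdot-y),\ 0\Bigr),$$ where $\mathcal A_y$ has the domain $\mathbb R\times (D(A)\cap D(B_y))\times L^1(\mathbb R^2)$ and $\mathcal C_y$ is defined on all of $X$. Then $\mathcal A_y+\mathcal C_y$ is the infinitesimal generator of a strongly continuous semigroup $\{T_{\mathcal A_y+\mathcal C_y}(t)\}_{t\ge0}$ of bounded linear operators on $X$, the limit defining its essential growth rate exists in $[-\infty,+\infty]$, and $$\omega_{\rm ess}(\mathcal A_y+\mathcal C_y):=\lim_{t\to\infty}\frac{\ln\|T_{\mathcal A_y+\mathcal C_y}(t)\|_{\rm ess}}{t}\ \le\ -\min(\gamma,\alpha,\chi),\qquad \ln 0:=-\infty.$$ Here, for a bounded linear operator $T$ on $X$, $\|T\|_{\rm ess}$ is the infimum of the $r>0$ such that the image under $T$ of the closed unit ball of $X$ can be covered by finitely many balls of radius at most $r$. -/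

import Mathlib

open MeasureTheory Filter Topology
open scoped NNReal ENNReal

noncomputable section

/-- The plane `ℝ²` with its Euclidean norm. -/
abbrev Plane : Type := EuclideanSpace ℝ (Fin 2)

/-- The Banach space `L¹(ℝ²)` of (classes of) real-valued Lebesgue integrable functions. -/
abbrev PlaneL1 : Type := Lp ℝ 1 (volume : Measure Plane)

/-- The Banach space `X = ℝ × L¹(ℝ²) × L¹(ℝ²)`, with the norm
`‖(u, v, w)‖ = |u| + ‖v‖ + ‖w‖`. -/
abbrev StateSpace : Type := WithLp 1 (ℝ × WithLp 1 (PlaneL1 × PlaneL1))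

namespace StateSpace

/-- The triple `(u, v, w)` as an element of the state space. -/
def mk (u : ℝ) (v w : PlaneL1) : StateSpace := WithLp.toLp 1 (u, WithLp.toLp 1 (v, w))

/-- The first component `u` of `(u, v, w)`. -/
def home (x : StateSpace) : ℝ := x.fst

/-- The second component `v` of `(u, v, w)`. -/
def travel (x : StateSpace) : PlaneL1 := x.snd.fst

/-- The third component `w` of `(u, v, w)`. -/
def work (x : StateSpace) : PlaneL1 := x.snd.snd

end StateSpace

/-! ### The velocity field -/

/-- The partial derivative `∂F/∂xᵢ` at `x` of a map `F` on the plane. -/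
def partialD {V : Type*} [NormedAddCommGroup V] [NormedSpace ℝ V]
    (i : Fin 2) (F : Plane → V) (x : Plane) : V :=
  fderiv ℝ F x (EuclideanSpace.single i 1)

/-- The divergence `∂F₁/∂x₁ + ∂F₂/∂x₂` at `x` of a vector field `F`. -/
def divergence (F : Plane → Plane) (x : Plane) : ℝ :=
  ∑ i : Fin 2, partialD i F x i

/-- The velocity field is bounded, uniformly continuous and of class `C¹`, and its two partial
derivatives are bounded and uniformly continuous. -/
structure IsAdmissibleVelocity (C : Plane → Plane) : Prop where
  bounded : ∃ M : ℝ, ∀ x, ‖C x‖ ≤ M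
  uniformContinuous : UniformContinuous C
  contDiff : ContDiff ℝ 1 C
  partial_bounded : ∀ i : Fin 2, ∃ M : ℝ, ∀ x, ‖partialD i C x‖ ≤ M
  partial_uniformContinuous : ∀ i : Fin 2, UniformContinuous (partialD i C)

/-! ### Semigroups and generators -/

/-- A strongly continuous semigroup of bounded linear operators on `Z`. -/
structure IsC0Semigroup {Z : Type*} [NormedAddCommGroup Z] [NormedSpace ℝ Z]
    (T : ℝ≥0 → Z →L[ℝ] Z) : Prop where
  map_zero : T 0 = ContinuousLinearMap.id ℝ Z
  map_add : ∀ s t : ℝ≥0, T (s + t) = (T s).comp (T t)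
  strongly_continuous : ∀ z : Z, Continuous fun t : ℝ≥0 => T t z

/-- The graph of the infinitesimal generator of a family `T(t)`, `t ≥ 0`: the pairs `(z, z')` with
`(T(t) z - z) / t → z'` in norm as `t ↓ 0`. -/
def generatorGraph {Z : Type*} [NormedAddCommGroup Z] [NormedSpace ℝ Z]
    (T : ℝ≥0 → Z → Z) : Set (Z × Z) :=
  {p | Tendsto (fun t : ℝ≥0 => (t : ℝ)⁻¹ • (T t p.1 - p.1)) (𝓝[>] 0) (𝓝 p.2)}

/-! ### The diffusion operator -/

theorem integrable_gaussian_plane (c s : ℝ) (hs : 0 < s) :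
    Integrable (fun x : Plane => c * Real.exp (-‖x‖ ^ 2 / s)) volume := by
  have h := GaussianFourier.integrable_cexp_neg_mul_sq_norm_add (V := Plane)
    (b := ((1 / s : ℝ) : ℂ)) (by simpa using hs) 0 0
  refine (h.re.const_mul c).congr (ae_of_all _ fun x => ?_)
  have : (-((1 / s : ℝ) : ℂ) * (‖x‖ : ℂ) ^ 2 + 0 * (inner ℝ (0 : Plane) x : ℂ))
      = ((-‖x‖ ^ 2 / s : ℝ) : ℂ) := by
    push_cast; ring
  simp only [this]
  rw [← Complex.ofReal_exp]
  exact congrArg (c * ·) (Complex.ofReal_re _)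

/-- The heat kernel `K(t, x) = exp(-|x|² / (4 ε² t)) / (4 π ε² t)` of `∂ₜ = ε² Δ` in the plane. -/
def heatKernel (ε : ℝ) (t : ℝ≥0) (x : Plane) : ℝ :=
  1 / (4 * Real.pi * ε ^ 2 * t) * Real.exp (-‖x‖ ^ 2 / (4 * ε ^ 2 * t))

theorem integrable_heatKernel (ε : ℝ) (t : ℝ≥0) : Integrable (heatKernel ε t) volume := by
  rcases (show (0 : ℝ) ≤ 4 * ε ^ 2 * t by positivity).eq_or_lt with h | h
  · have h0 : heatKernel ε t = fun _ => 0 := by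
      funext x
      have : 4 * Real.pi * ε ^ 2 * t = 0 := by
        linear_combination (-Real.pi) * h
      simp [heatKernel, this]
    rw [h0]
    exact integrable_zero _ _ _
  · exact integrable_gaussian_plane _ _ h

theorem integrable_heatConv (ε : ℝ) (t : ℝ≥0) (v : PlaneL1) :
    Integrable (fun x : Plane => ∫ z, heatKernel ε t (x - z) * v z) volume := by
  have h := (L1.integrable_coeFn v).integrable_convolution (ContinuousLinearMap.mul ℝ ℝ)
    (integrable_heatKernel ε t)
  refine h.congr (ae_of_all _ fun x => ?_)
  simp [convolution, mul_comm]

/-- The heat semigroup on `L¹(ℝ²)`: the identity at `t = 0`, and convolution with the heat kernel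
for `t > 0`. -/
def heatSemigroup (ε : ℝ) (t : ℝ≥0) (v : PlaneL1) : PlaneL1 :=
  if t = 0 then v else (integrable_heatConv ε t v).toL1 _

/-- The graph of the realization `A` of `ε² Δ` in `L¹(ℝ²)`: the generator of the heat semigroup. -/
def diffusionGraph (ε : ℝ) : Set (PlaneL1 × PlaneL1) :=
  generatorGraph (heatSemigroup ε)

/-! ### The convection operator -/

/-- The graph of the realization `B` of `v ↦ -∇·(v C)` in `L¹(ℝ²)`: the closure in
`L¹(ℝ²) × L¹(ℝ²)` of the graph of this differential operator on the compactly supported `C¹`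
functions. -/
def convectionGraph (C : Plane → Plane) : Set (PlaneL1 × PlaneL1) :=
  closure {p | ∃ φ : Plane → ℝ, ContDiff ℝ 1 φ ∧ HasCompactSupport φ ∧
    p.1 =ᵐ[volume] φ ∧ p.2 =ᵐ[volume] fun x => -divergence (fun z => φ z • C z) x}

/-! ### The return-to-home operator -/

/-- The centred Gaussian density `g` on the plane with standard deviation `σ`. -/
def homeDensity (σ : ℝ) (x : Plane) : ℝ :=
  1 / (2 * Real.pi * σ ^ 2) * Real.exp (-‖x‖ ^ 2 / (2 * σ ^ 2))

theorem integrable_homeDensity_sub (σ : ℝ) (y : Plane) :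
    Integrable (fun x => homeDensity σ (x - y)) volume := by
  refine Integrable.comp_sub_right (f := homeDensity σ) ?_ y
  rcases (show (0 : ℝ) ≤ 2 * σ ^ 2 by positivity).eq_or_lt with h | h
  · have h0 : homeDensity σ = fun _ => 0 := by
      funext x
      have : 2 * Real.pi * σ ^ 2 = 0 := by
        linear_combination (-Real.pi) * h
      simp [homeDensity, this]
    rw [h0]
    exact integrable_zero _ _ _
  · exact integrable_gaussian_plane _ _ h

/-- The translate `x ↦ g(x - y)` as an element of `L¹(ℝ²)`. -/
def homeDensityL1 (σ : ℝ) (y : Plane) : PlaneL1 :=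
  (integrable_homeDensity_sub σ y).toL1 _

/-- The graph of the operator `𝒜 (u, v, w) = (-γ u, (A + B) v - α v, α v - χ w)`.
Here `v` ranges over the common domain of `A` and `B`, on which `(A + B) v = A v + B v`. -/
def uncoupledGraph (ε γ α χ : ℝ) (C : Plane → Plane) : Set (StateSpace × StateSpace) :=
  {p | ∃ a b : PlaneL1, (p.1.travel, a) ∈ diffusionGraph ε ∧ (p.1.travel, b) ∈ convectionGraph C ∧
    p.2 = StateSpace.mk (-γ * p.1.home) (a + b - α • p.1.travel)
      (α • p.1.travel - χ • p.1.work)}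

/-- The coupling operator `𝒞 (u, v, w) = (χ ∫ w, γ u g(· - y), 0)`. -/
def coupling (σ γ χ : ℝ) (y : Plane) (x : StateSpace) : StateSpace :=
  StateSpace.mk (χ * ∫ z, x.work z) ((γ * x.home) • homeDensityL1 σ y) 0

/-- The graph of the operator `𝒜 + 𝒞`, whose domain is that of `𝒜`. -/
def returnHomeGraph (ε σ γ α χ : ℝ) (C : Plane → Plane) (y : Plane) :
    Set (StateSpace × StateSpace) :=
  {p | ∃ z : StateSpace, (p.1, z) ∈ uncoupledGraph ε γ α χ C ∧ p.2 = z + coupling σ γ χ y p.1}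

/-- `T` is a strongly continuous semigroup on `X` whose infinitesimal generator is `𝒜 + 𝒞`. -/
def IsReturnHomeSemigroup (ε σ γ α χ : ℝ) (C : Plane → Plane) (y : Plane)
    (T : ℝ≥0 → StateSpace →L[ℝ] StateSpace) : Prop :=
  IsC0Semigroup T ∧ generatorGraph (fun t => ⇑(T t)) = returnHomeGraph ε σ γ α χ C y

/-! ### The essential growth rate -/

/-- The (ball) Kuratowski measure of non-compactness of a bounded set `S`. -/
def noncompactness {Z : Type*} [PseudoMetricSpace Z] (S : Set Z) : ℝ :=
  sInf {r : ℝ | 0 < r ∧ ∃ F : Finset Z, S ⊆ ⋃ c ∈ F, Metric.closedBall c r}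

/-- The essential semi-norm of a bounded linear operator. -/
def essSeminorm {Z : Type*} [NormedAddCommGroup Z] [NormedSpace ℝ Z] (L : Z →L[ℝ] Z) : ℝ :=
  noncompactness (L '' Metric.closedBall 0 1)

/-- `ω ∈ [-∞, +∞]` is the essential growth rate of `T`, that is, the limit of
`t⁻¹ log ‖T(t)‖_ess` as `t → ∞`, with `log 0 = -∞`. -/
def IsEssGrowthRate {Z : Type*} [NormedAddCommGroup Z] [NormedSpace ℝ Z]
    (T : ℝ≥0 → Z →L[ℝ] Z) (ω : EReal) : Prop :=
  Tendsto (fun t : ℝ≥0 => ENNReal.log (ENNReal.ofReal (essSeminorm (T t))) / ((t : ℝ) : EReal))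
    atTop (𝓝 ω)

end

noncomputable section

/-! ### Contractive exponentials -/

section HilleYosida

variable {Z : Type*} [NormedAddCommGroup Z] [NormedSpace ℝ Z]

/-! The coupling `𝒞` has rank at most two, hence is compact, and a compact perturbation does not
affect essential growth. Let `T` be generated by `𝒜 + 𝒞` and `U` by `𝒜`. The variation of constants
formula (`IsC0Semigroup.duhamel`) writes `T(t) - U(t)` as `∫₀ᵗ U(t-s) 𝒞 T(s) ds`. This maps the unit
ball into a totally bounded set, namely a multiple of the closed convex hull of a compact set.
Therefore `‖T(t)‖_ess ≤ ‖U(t)‖` (`essSeminorm_le_of_compact_perturbation`), and it remains to bound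
the growth of `U`.

That bound rests on the dissipativity of `A + B` in `L¹`, which prevents transport from adding any
growth. The heat semigroup is contractive. The closed convection operator is dissipative by testing
with a regularized sign and integrating a divergence (`mul_integral_norm_le_of_hasCompactSupport`).
The reaction terms `-γ u`, `-α v`, `-χ w` then give the decay rate `min(γ, α, χ)`, up to the
production term `α v` in the third component. Conjugation by `(u, v, w) ↦ (u, v, κ w)` shrinks this
term to `κ α v`. Hence `‖U(t)‖ ≤ M_κ exp((-min + κ α) t)` for every `κ > 0`
(`exists_uncoupled_semigroup`). The constant `M_κ` disappears in the limit `t⁻¹ log`, and `κ` is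
arbitrary.

For generation, the gradient of the heat kernel costs a factor `t^{-1/2}`, so `B (l - A)⁻¹` is
bounded by a Laplace transform that tends to zero as `l → ∞`. A Neumann series inverts `l - A - B`
on the whole space (`sumGraph_hasResolvent`), and the Hille-Yosida theorem applies, also after
bounded perturbations (`exists_semigroup_transport`). Unbounded operators are handled as graphs,
that is, as linear relations, so that identities of domains are part of the set equalities.

The essential semi-norm is submultiplicative (`essSeminorm_comp_le`), so the limit defining the
growth rate exists by Fekete's lemma (`exists_tendsto_log_div`). -/

/-- `J` is the resolvent `(l - Γ)⁻¹` of the linear relation `Γ`. -/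
def HasResolvent (Γ : Set (Z × Z)) (l : ℝ) (J : Z →L[ℝ] Z) : Prop :=
  ∀ p : Z × Z, p ∈ Γ ↔ J (l • p.1 - p.2) = p.1

theorem HasResolvent.mem {Γ : Set (Z × Z)} {l : ℝ} {J : Z →L[ℝ] Z} (h : HasResolvent Γ l J)
    (y : Z) : (J y, l • J y - y) ∈ Γ := by
  rw [h]; simp

/-- Both forms of the resolvent identity, `J = K + (m - l) K J` and `K = J + (l - m) J K`, are
compared and `m - l` is cancelled. For `l = m` the two resolvents agree. Commutation makes the
Yosida approximations commute. -/
theorem HasResolvent.apply_comm {Γ : Set (Z × Z)} {l m : ℝ} {J K : Z →L[ℝ] Z}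
    (hJ : HasResolvent Γ l J) (hK : HasResolvent Γ m K) (y : Z) : J (K y) = K (J y) := by
  rcases eq_or_ne l m with rfl | hlm
  · have h : ∀ z, J z = K z := fun z => by
      have := (hK _).1 (hJ.mem z)
      simpa using this.symm
    rw [h, h]
  have h1 : J y = K y + (m - l) • K (J y) := by
    have := (hK _).1 (hJ.mem y)
    rw [← map_smul, ← map_add]
    refine this.symm.trans (congrArg K ?_)
    simp only [sub_smul]; abel
  have h2 : K y = J y + (l - m) • J (K y) := by
    have := (hJ _).1 (hK.mem y)
    rw [← map_smul, ← map_add]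
    refine this.symm.trans (congrArg J ?_)
    simp only [sub_smul]; abel
  have h3 : (m - l) • (J (K y) - K (J y)) = 0 := by
    rw [smul_sub, sub_eq_zero]
    have : (m - l) • K (J y) = J y - K y := by rw [eq_sub_iff_add_eq, add_comm]; exact h1.symm
    rw [this]
    conv_rhs => rw [h2]
    simp only [sub_smul]; abel
  rcases smul_eq_zero.1 h3 with h | h
  · exact absurd (sub_eq_zero.1 h).symm hlm
  · exact sub_eq_zero.1 h

open NormedSpace in
theorem norm_exp_clm_le (P : Z →L[ℝ] Z) : ‖exp P‖ ≤ Real.exp ‖P‖ := by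
  have hs := NormedSpace.norm_expSeries_summable' (𝕂 := ℝ) P
  rw [exp_eq_tsum ℝ, Real.exp_eq_exp_ℝ, exp_eq_tsum ℝ]
  refine (norm_tsum_le_tsum_norm hs).trans ?_
  refine hs.tsum_le_tsum (fun n => ?_) (NormedSpace.expSeries_summable' (𝕂 := ℝ) ‖P‖)
  rw [norm_smul, smul_eq_mul, Real.norm_of_nonneg (by positivity)]
  gcongr
  -- The identity has norm at most one, not necessarily equal to one, because `Z` may be trivial.
  -- The zeroth power is therefore treated apart.
  rcases n.eq_zero_or_pos with rfl | hn
  · rw [pow_zero, pow_zero]; exact ContinuousLinearMap.norm_id_le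
  · exact norm_pow_le' P hn

variable [CompleteSpace Z]

open NormedSpace in
-- The exponential factors as `e^{-r} exp(r P)`, and `‖exp(r P)‖ ≤ e^r`. With `P = l J` this shows
-- that Yosida approximations generate contractions.
theorem norm_exp_smul_sub_one_le (P : Z →L[ℝ] Z) (hP : ‖P‖ ≤ 1) {r : ℝ} (hr : 0 ≤ r) :
    ‖exp (r • (P - 1))‖ ≤ 1 := by
  let _ : NormedAlgebra ℚ (Z →L[ℝ] Z) := NormedAlgebra.restrictScalars ℚ ℝ _
  have h1 : r • (P - 1) = r • P + algebraMap ℝ (Z →L[ℝ] Z) (-r) := by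
    rw [Algebra.algebraMap_eq_smul_one, smul_sub, neg_smul, sub_eq_add_neg]
  rw [h1, exp_add_of_commute ((Algebra.commutes (-r) (r • P)).symm), ← algebraMap_exp_comm,
    ← Real.exp_eq_exp_ℝ, Algebra.algebraMap_eq_smul_one, mul_smul_comm, mul_one, norm_smul,
    Real.norm_of_nonneg (Real.exp_pos _).le]
  calc Real.exp (-r) * ‖exp (r • P)‖ ≤ Real.exp (-r) * Real.exp ‖r • P‖ := by
        gcongr; exact norm_exp_clm_le _
    _ ≤ Real.exp (-r) * Real.exp r := by
        gcongr
        rw [norm_smul, Real.norm_of_nonneg hr]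
        nlinarith
    _ = 1 := by rw [← Real.exp_add]; simp

/-- Two commuting bounded operators generating contractions: the difference of the exponentials. -/
theorem norm_exp_smul_apply_sub_le {A B : Z →L[ℝ] Z} (hAB : Commute A B)
    (hA : ∀ t : ℝ, 0 ≤ t → ‖NormedSpace.exp (t • A)‖ ≤ 1)
    (hB : ∀ t : ℝ, 0 ≤ t → ‖NormedSpace.exp (t • B)‖ ≤ 1) {t : ℝ} (ht : 0 ≤ t) (x : Z) :
    ‖NormedSpace.exp (t • A) x - NormedSpace.exp (t • B) x‖ ≤ t * ‖A x - B x‖ := by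
  let _ : NormedAlgebra ℚ (Z →L[ℝ] Z) := NormedAlgebra.restrictScalars ℚ ℝ _
  -- Interpolation between the two exponentials: since `A` commutes with `exp((t - s) B)`, the
  -- derivative is a product of two contractions applied to `A x - B x`.
  set f : ℝ → Z := fun s => (NormedSpace.exp (s • A) * NormedSpace.exp ((t - s) • B)) x with hf
  have hd : ∀ s, HasDerivAt f
      ((NormedSpace.exp (s • A) * NormedSpace.exp ((t - s) • B)) (A x - B x)) s := by
    intro s
    have h1 := hasDerivAt_exp_smul_const (𝕂 := ℝ) A s
    have h2 : HasDerivAt (fun s : ℝ => NormedSpace.exp ((t - s) • B))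
        (-(NormedSpace.exp ((t - s) • B) * B)) s := by
      have := (hasDerivAt_exp_smul_const (𝕂 := ℝ) B (t - s)).scomp s
        ((hasDerivAt_id s).const_sub t)
      simpa using! this
    have h3 := (h1.mul h2).clm_apply (hasDerivAt_const s x)
    refine h3.congr_deriv ?_
    have hc : Commute A (NormedSpace.exp ((t - s) • B)) := (hAB.smul_right _).exp_right
    rw [mul_assoc, hc.eq]
    simp [← sub_eq_add_neg]
  have := norm_image_sub_le_of_norm_deriv_right_le_segment (f := f) (a := 0) (b := t)
    (C := ‖A x - B x‖) (fun s _ => (hd s).continuousAt.continuousWithinAt)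
    (fun s _ => (hd s).hasDerivWithinAt) (fun s hs => ?_) t ⟨ht, le_rfl⟩
  · simpa [hf, mul_comm] using this
  · rw [mul_apply_eq_comp]
    refine (ContinuousLinearMap.le_of_opNorm_le _ (hA s hs.1) _).trans ?_
    rw [one_mul]
    refine (ContinuousLinearMap.le_of_opNorm_le _ (hB (t - s) (by linarith [hs.2])) _).trans ?_
    rw [one_mul]

theorem norm_exp_smul_apply_sub_self_le {A : Z →L[ℝ] Z}
    (hA : ∀ t : ℝ, 0 ≤ t → ‖NormedSpace.exp (t • A)‖ ≤ 1) {t : ℝ} (ht : 0 ≤ t) (x : Z) :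
    ‖NormedSpace.exp (t • A) x - x‖ ≤ t * ‖A x‖ := by
  have := norm_exp_smul_apply_sub_le (B := 0) (Commute.zero_right A) hA
    (fun t _ => by simpa using! ContinuousLinearMap.norm_id_le) ht x
  simpa using this

/-- The remainder has derivative `exp(s A) A x - A x`, so the mean value inequality applies. The
estimate survives the limit of the Yosida approximations and thereby identifies the generator. -/
theorem norm_exp_smul_apply_sub_deriv_le {A : Z →L[ℝ] Z} {t c : ℝ} (ht : 0 ≤ t) (x : Z)
    (hc : ∀ s ∈ Set.Ico 0 t, ‖NormedSpace.exp (s • A) (A x) - A x‖ ≤ c) :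
    ‖NormedSpace.exp (t • A) x - x - t • A x‖ ≤ t * c := by
  let _ : NormedAlgebra ℚ (Z →L[ℝ] Z) := NormedAlgebra.restrictScalars ℚ ℝ _
  set f : ℝ → Z := fun s => NormedSpace.exp (s • A) x - s • A x with hf
  have hd : ∀ s, HasDerivAt f (NormedSpace.exp (s • A) (A x) - A x) s := by
    intro s
    have h1 := (hasDerivAt_exp_smul_const (𝕂 := ℝ) A s).clm_apply (hasDerivAt_const s x)
    have h2 := (hasDerivAt_id s).smul_const (A x)
    refine (h1.sub h2).congr_deriv ?_
    simp
  have := norm_image_sub_le_of_norm_deriv_right_le_segment (f := f) (a := 0) (b := t)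
    (C := c) (fun s _ => (hd s).continuousAt.continuousWithinAt)
    (fun s _ => (hd s).hasDerivWithinAt) hc t ⟨ht, le_rfl⟩
  simp only [hf, zero_smul, NormedSpace.exp_zero, one_apply_eq_self, sub_zero] at this
  rw [mul_comm]
  convert this using 2
  abel

end HilleYosida

/-! ### Limits of bounded operators on dense sets, generators, and the Hille-Yosida theorem. -/

section Generation

variable {Z : Type*} [NormedAddCommGroup Z] [NormedSpace ℝ Z]

theorem tendsto_clm_of_dense {ι : Type*} {l : Filter ι} {F : ι → Z →L[ℝ] Z} {D : Set Z}
    (hD : Dense D) {M : ℝ} (hF : ∀ᶠ i in l, ‖F i‖ ≤ M) (G : Z →L[ℝ] Z)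
    (h : ∀ x ∈ D, Tendsto (fun i => F i x) l (𝓝 (G x))) (x : Z) :
    Tendsto (fun i => F i x) l (𝓝 (G x)) := by
  rw [Metric.tendsto_nhds]
  intro ε hε
  have hc : 0 < ε / (2 * (|M| + ‖G‖ + 1)) := by positivity
  obtain ⟨x', hx', hd⟩ := hD.exists_dist_lt x hc
  rw [dist_eq_norm, lt_div_iff₀ (by positivity)] at hd
  filter_upwards [hF, Metric.tendsto_nhds.1 (h x' hx') (ε / 2) (half_pos hε)] with i h1 h2
  rw [dist_eq_norm] at h2 ⊢
  have e : F i x - G x = F i (x - x') + (F i x' - G x') - G (x - x') := by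
    simp only [map_sub]; abel
  rw [e]
  have b1 := ContinuousLinearMap.le_of_opNorm_le _ (h1.trans (le_abs_self M)) (x - x')
  have b2 := G.le_opNorm (x - x')
  have := norm_sub_le (F i (x - x') + (F i x' - G x')) (G (x - x'))
  have := norm_add_le (F i (x - x')) (F i x' - G x')
  nlinarith [norm_nonneg (x - x'), abs_nonneg M, norm_nonneg G]

theorem cauchySeq_clm_of_dense {F : ℕ → Z →L[ℝ] Z} {D : Set Z}
    (hD : Dense D) (hF : ∀ i, ‖F i‖ ≤ 1) (h : ∀ x ∈ D, CauchySeq fun i => F i x) (x : Z) :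
    CauchySeq fun i => F i x := by
  rw [Metric.cauchySeq_iff]
  intro ε hε
  obtain ⟨x', hx', hd⟩ := hD.exists_dist_lt x (show 0 < ε / 4 by positivity)
  rw [dist_eq_norm] at hd
  obtain ⟨N, hN⟩ := Metric.cauchySeq_iff.1 (h x' hx') (ε / 2) (half_pos hε)
  refine ⟨N, fun m hm n hn => ?_⟩
  have h2 := hN m hm n hn
  rw [dist_eq_norm] at h2 ⊢
  have e : F m x - F n x = F m (x - x') + (F m x' - F n x') - F n (x - x') := by
    simp only [map_sub]; abel
  rw [e]
  have b1 := ContinuousLinearMap.le_of_opNorm_le _ (hF m) (x - x')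
  have b2 := ContinuousLinearMap.le_of_opNorm_le _ (hF n) (x - x')
  have := norm_sub_le (F m (x - x') + (F m x' - F n x')) (F n (x - x'))
  have := norm_add_le (F m (x - x')) (F m x' - F n x')
  linarith

theorem continuous_clm_of_dense {T : ℝ≥0 → Z →L[ℝ] Z} {D : Set Z} (hD : Dense D)
    (hT : ∀ t, ‖T t‖ ≤ 1) (h : ∀ x ∈ D, Continuous fun t => T t x) (x : Z) :
    Continuous fun t => T t x := by
  rw [continuous_iff_continuousAt]
  exact fun t => tendsto_clm_of_dense hD (Eventually.of_forall hT) (T t)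
    (fun x hx => (h x hx).continuousAt) x

/-! ### Elementary properties of generators -/

theorem generatorGraph_add {T : ℝ≥0 → Z →L[ℝ] Z} {p q : Z × Z}
    (hp : p ∈ generatorGraph fun t => ⇑(T t)) (hq : q ∈ generatorGraph fun t => ⇑(T t)) :
    p + q ∈ generatorGraph fun t => ⇑(T t) := by
  refine (Tendsto.add hp hq).congr fun t => ?_
  rw [← smul_add]
  simp only [Prod.fst_add, map_add]
  congr 1
  abel

theorem generatorGraph_smul {T : ℝ≥0 → Z →L[ℝ] Z} {p : Z × Z} (c : ℝ)
    (hp : p ∈ generatorGraph fun t => ⇑(T t)) :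
    c • p ∈ generatorGraph fun t => ⇑(T t) := by
  refine (Tendsto.const_smul hp c).congr fun t => ?_
  simp only [Prod.smul_fst, map_smul]
  rw [smul_comm, smul_sub]

/-- The generator of a semigroup as a linear relation. -/
def generatorSubmodule (T : ℝ≥0 → Z →L[ℝ] Z) : Submodule ℝ (Z × Z) where
  carrier := generatorGraph fun t => ⇑(T t)
  add_mem' := generatorGraph_add
  zero_mem' := by simp [generatorGraph]
  smul_mem' c _ hp := generatorGraph_smul c hp

theorem tendsto_coe_nhdsGT_zero :
    Tendsto (fun t : ℝ≥0 => (t : ℝ)) (𝓝[>] 0) (𝓝[>] 0) := by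
  refine tendsto_nhdsWithin_iff.2 ⟨?_, ?_⟩
  · exact (NNReal.continuous_coe.tendsto 0).mono_left nhdsWithin_le_nhds
  · filter_upwards [self_mem_nhdsWithin] with t ht
    exact ht

theorem mem_generatorGraph_of_forall_le {T : ℝ≥0 → Z → Z} {x z : Z}
    (h : ∀ ε > 0, ∃ δ > (0 : ℝ), ∀ t : ℝ≥0, 0 < t → (t : ℝ) < δ →
      ‖T t x - x - (t : ℝ) • z‖ ≤ t * ε) : (x, z) ∈ generatorGraph T := by
  refine Metric.tendsto_nhds.2 fun ε hε => ?_
  obtain ⟨δ, hδ, H⟩ := h (ε / 2) (half_pos hε)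
  have h1 : ∀ᶠ t : ℝ≥0 in 𝓝[>] 0, (t : ℝ) < δ :=
    (tendsto_coe_nhdsGT_zero.mono_right nhdsWithin_le_nhds).eventually_lt_const hδ
  filter_upwards [self_mem_nhdsWithin, h1] with t ht htd
  have ht' : (0 : ℝ) < t := ht
  have := H t ht htd
  rw [dist_eq_norm]
  have e : (t : ℝ)⁻¹ • (T t x - x) - z = (t : ℝ)⁻¹ • (T t x - x - (t : ℝ) • z) := by
    rw [smul_sub _ (T t x - x), inv_smul_smul₀ ht'.ne']
  change ‖(t : ℝ)⁻¹ • (T t x - x) - z‖ < ε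
  rw [e, norm_smul, norm_inv, Real.norm_of_nonneg ht'.le, inv_mul_lt_iff₀ ht']
  nlinarith

/-- If `a` is the value at `v` of the generator of a contraction semigroup and `b` is dissipative
at `v`, then `a + b` is dissipative at `v`. -/
theorem dissipative_add {T : ℝ≥0 → Z →L[ℝ] Z} (hT : ∀ t, ‖T t‖ ≤ 1) {v a b : Z}
    (ha : (v, a) ∈ generatorGraph fun t => ⇑(T t))
    (hb : ∀ l > (0 : ℝ), l * ‖v‖ ≤ ‖l • v - b‖) {l : ℝ} (hl : 0 < l) :
    l * ‖v‖ ≤ ‖l • v - a - b‖ := by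
  have ha' : Tendsto (fun t : ℝ≥0 => (t : ℝ)⁻¹ • (T t v - v)) (𝓝[>] 0) (𝓝 a) := ha
  have h1 : Tendsto (fun t : ℝ≥0 => ‖l • v - (t : ℝ)⁻¹ • (T t v - v) - b‖) (𝓝[>] 0)
      (𝓝 ‖l • v - a - b‖) := ((ha'.const_sub _).sub_const _).norm
  refine ge_of_tendsto h1 ?_
  filter_upwards [self_mem_nhdsWithin] with t ht
  have ht' : (0 : ℝ) < t := ht
  -- The difference quotient raises the parameter from `l` to `l + 1/t`. Dissipativity of `b` at
  -- that parameter gains `‖v‖ / t`, which covers what the contraction `T t` can take away.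
  have e : l • v - (t : ℝ)⁻¹ • (T t v - v) - b
      = ((l + (t : ℝ)⁻¹) • v - b) - (t : ℝ)⁻¹ • T t v := by
    rw [add_smul, smul_sub]; abel
  rw [e]
  have h2 := hb (l + (t : ℝ)⁻¹) (by positivity)
  have h3 := norm_sub_norm_le ((l + (t : ℝ)⁻¹) • v - b) ((t : ℝ)⁻¹ • T t v)
  have h4 : ‖(t : ℝ)⁻¹ • T t v‖ ≤ (t : ℝ)⁻¹ * ‖v‖ := by
    rw [norm_smul, norm_inv, Real.norm_of_nonneg ht'.le]
    gcongr
    simpa using (T t).le_of_opNorm_le (hT t) v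
  linarith

theorem dissipative_generator {T : ℝ≥0 → Z →L[ℝ] Z} (hT : ∀ t, ‖T t‖ ≤ 1) {v a : Z}
    (ha : (v, a) ∈ generatorGraph fun t => ⇑(T t)) {l : ℝ} (hl : 0 < l) :
    l * ‖v‖ ≤ ‖l • v - a‖ := by
  have := dissipative_add hT ha (b := 0)
    (fun l hl => by rw [sub_zero, norm_smul, Real.norm_of_nonneg hl.le]) hl
  simpa using this

/-- A linear dissipative relation is the relation of the resolvent `J` as soon as `l - Γ` is
inverted on the right by `J`. -/
theorem hasResolvent_of_dissipative {Γ : Submodule ℝ (Z × Z)} {l : ℝ} {J : Z →L[ℝ] Z} {c : ℝ}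
    (hc : 0 < c) (hd : ∀ p ∈ Γ, c * ‖p.1‖ ≤ ‖l • p.1 - p.2‖)
    (hJ : ∀ y, (J y, l • J y - y) ∈ Γ) : HasResolvent (Γ : Set (Z × Z)) l J := by
  intro p
  constructor
  · intro hp
    -- The pair produced by `J` and the given pair have the same image under `l - Γ`; dissipativity
    -- applied to their difference gives uniqueness.
    have h1 := hd _ (Γ.sub_mem (hJ (l • p.1 - p.2)) hp)
    have h2 : l • ((J (l • p.1 - p.2), l • J (l • p.1 - p.2) - (l • p.1 - p.2)) - p).1 -
        ((J (l • p.1 - p.2), l • J (l • p.1 - p.2) - (l • p.1 - p.2)) - p).2 = 0 := by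
      simp only [Prod.fst_sub, Prod.snd_sub, smul_sub]; abel
    rw [h2, norm_zero] at h1
    have h3 := norm_le_zero_iff.1 (nonpos_of_mul_nonpos_right h1 hc)
    exact sub_eq_zero.1 h3
  · intro h
    have := hJ (l • p.1 - p.2)
    rw [h] at this
    simpa using this

/-- A dissipative linear relation containing `Γ` has the same resolvent `J`, and the resolvent
determines the relation. One inclusion is thus enough to identify a generator. -/
theorem HasResolvent.generator_eq {Γ : Set (Z × Z)} {l : ℝ} {J : Z →L[ℝ] Z}
    (hJ : HasResolvent Γ l J) (hl : 0 < l) {T : ℝ≥0 → Z →L[ℝ] Z} (hT : ∀ t, ‖T t‖ ≤ 1)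
    (h : Γ ⊆ generatorGraph fun t => ⇑(T t)) : generatorGraph (fun t => ⇑(T t)) = Γ := by
  have h1 : HasResolvent (generatorSubmodule T : Set (Z × Z)) l J :=
    hasResolvent_of_dissipative hl (fun p hp => dissipative_generator hT hp hl)
      fun y => h (hJ.mem y)
  ext p
  exact (h1 p).trans (hJ p).symm

/-! ### The Hille-Yosida theorem -/

variable [CompleteSpace Z]

/-- The Yosida approximations `A n = L (L J(L) - 1)`, with `L = L n → ∞`, are bounded, commute and
generate contractions. On `Γ` they satisfy `A n p.1 = L J(L) p.2`, which tends to `p.2` because `L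
J(L) → 1` strongly. Their exponentials are therefore Cauchy on the dense domain, and the limits form
the semigroup. -/
theorem hille_yosida_contraction {Γ : Set (Z × Z)} {J : ℝ → Z →L[ℝ] Z} {l₀ : ℝ}
    (hJ : ∀ l > l₀, HasResolvent Γ l (J l)) (hn : ∀ l > l₀, 0 < l → ‖l • J l‖ ≤ 1)
    (hD : Dense (Prod.fst '' Γ)) :
    ∃ T : ℝ≥0 → Z →L[ℝ] Z, IsC0Semigroup T ∧ generatorGraph (fun t => ⇑(T t)) = Γ ∧
      ∀ t, ‖T t‖ ≤ 1 := by
  -- The shift keeps every term, including the one at `n = 0`, positive and above `l₀`.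
  set L : ℕ → ℝ := fun n => n + (max l₀ 0 + 1) with hL
  have hLpos : ∀ n, 0 < L n := fun n => by positivity
  have hLgt : ∀ n, l₀ < L n := fun n => by
    have := le_max_left l₀ 0
    have : (0 : ℝ) ≤ n := n.cast_nonneg
    simp only [hL]; linarith
  have hLtop : Tendsto L atTop atTop :=
    tendsto_atTop_add_const_right _ _ tendsto_natCast_atTop_atTop
  set A : ℕ → Z →L[ℝ] Z := fun n => L n • (L n • J (L n) - 1) with hA
  have hcomm : ∀ m n, Commute (A m) (A n) := by
    intro m n
    have h1 : Commute (J (L m)) (J (L n)) :=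
      ContinuousLinearMap.ext fun y => (hJ _ (hLgt m)).apply_comm (hJ _ (hLgt n)) y
    have h2 : Commute (L m • J (L m) - 1) (L n • J (L n) - 1) :=
      ((((h1.smul_left _).smul_right _).sub_left (Commute.one_left _))).sub_right
        (Commute.one_right _)
    exact (h2.smul_left _).smul_right _
  have hE : ∀ n, ∀ t : ℝ, 0 ≤ t → ‖NormedSpace.exp (t • A n)‖ ≤ 1 := by
    intro n t ht
    rw [hA, smul_smul]
    exact norm_exp_smul_sub_one_le _ (hn _ (hLgt n) (hLpos n)) (mul_nonneg ht (hLpos n).le)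
  have hAΓ : ∀ p ∈ Γ, ∀ n, A n p.1 = L n • J (L n) p.2 := by
    intro p hp n
    have h1 : J (L n) (L n • p.1 - p.2) = p.1 := (hJ _ (hLgt n) p).1 hp
    have h2 : L n • J (L n) p.1 - p.1 = J (L n) p.2 := by
      rw [map_sub, map_smul] at h1
      rw [sub_eq_iff_eq_add, add_comm, ← sub_eq_iff_eq_add]; exact h1
    simp [hA, h2]
  have hid : ∀ z, Tendsto (fun n => L n • J (L n) z) atTop (𝓝 z) := by
    refine tendsto_clm_of_dense (F := fun n => L n • J (L n)) hD (M := 1)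
      (Eventually.of_forall fun n => hn _ (hLgt n) (hLpos n)) (ContinuousLinearMap.id ℝ Z) ?_
    rintro _ ⟨p, hp, rfl⟩
    have h3 : ∀ n, L n • J (L n) p.1 = p.1 + J (L n) p.2 := by
      intro n
      have h1 : J (L n) (L n • p.1 - p.2) = p.1 := (hJ _ (hLgt n) p).1 hp
      rw [map_sub, map_smul, sub_eq_iff_eq_add] at h1
      exact h1
    have h4 : Tendsto (fun n => J (L n) p.2) atTop (𝓝 0) := by
      have h5 : Tendsto (fun n => (L n)⁻¹ * ‖p.2‖) atTop (𝓝 0) := by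
        simpa using (tendsto_inv_atTop_zero.comp hLtop).mul_const ‖p.2‖
      refine squeeze_zero_norm (fun n => ?_) h5
      have h6 := (L n • J (L n)).le_of_opNorm_le (hn _ (hLgt n) (hLpos n)) p.2
      rw [smul_apply, norm_smul, Real.norm_of_nonneg (hLpos n).le] at h6
      rw [le_inv_mul_iff₀ (hLpos n)]
      linarith
    simpa [h3] using h4.const_add p.1
  have hAlim : ∀ p ∈ Γ, Tendsto (fun n => A n p.1) atTop (𝓝 p.2) := by
    intro p hp
    simpa only [hAΓ p hp] using hid p.2
  have hcau : ∀ (t : ℝ≥0) (x : Z), CauchySeq fun n => NormedSpace.exp ((t : ℝ) • A n) x := by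
    intro t x
    refine cauchySeq_clm_of_dense hD (fun n => hE n t t.2) ?_ x
    rintro _ ⟨p, hp, rfl⟩
    have h1 := (hAlim p hp).cauchySeq
    rw [Metric.cauchySeq_iff] at h1 ⊢
    intro ε hε
    obtain ⟨N, hN⟩ := h1 (ε / (t + 1)) (by positivity)
    refine ⟨N, fun m hm n hn => ?_⟩
    have h2 := hN m hm n hn
    rw [dist_eq_norm, lt_div_iff₀ (by positivity)] at h2
    rw [dist_eq_norm]
    have h3 := norm_exp_smul_apply_sub_le (hcomm m n) (hE m) (hE n) t.2 p.1
    simp only [NNReal.val_eq_coe] at h3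
    nlinarith [norm_nonneg (A m p.1 - A n p.1)]
  choose T₀ hT₀ using fun (t : ℝ≥0) (x : Z) => cauchySeq_tendsto_of_complete (hcau t x)
  set T : ℝ≥0 → Z →L[ℝ] Z := fun t => continuousLinearMapOfTendsto
    (fun n => NormedSpace.exp ((t : ℝ) • A n)) (tendsto_pi_nhds.2 (hT₀ t)) with hTdef
  have hT : ∀ (t : ℝ≥0) (x : Z),
      Tendsto (fun n => NormedSpace.exp ((t : ℝ) • A n) x) atTop (𝓝 (T t x)) :=
    fun t x => hT₀ t x
  have hTn : ∀ t, ‖T t‖ ≤ 1 := fun t => by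
    refine ContinuousLinearMap.opNorm_le_bound _ zero_le_one fun x => ?_
    exact le_of_tendsto (hT t x).norm
      (Eventually.of_forall fun n => ContinuousLinearMap.le_of_opNorm_le _ (hE n t t.2) x)
  have hadd : ∀ s t : ℝ≥0, T (s + t) = (T s).comp (T t) := by
    let _ : NormedAlgebra ℚ (Z →L[ℝ] Z) := NormedAlgebra.restrictScalars ℚ ℝ _
    intro s t
    ext x
    refine tendsto_nhds_unique (hT (s + t) x) ?_
    have h1 : ∀ n, NormedSpace.exp (((s + t : ℝ≥0) : ℝ) • A n) x
        = NormedSpace.exp ((s : ℝ) • A n) (T t x)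
          + NormedSpace.exp ((s : ℝ) • A n) (NormedSpace.exp ((t : ℝ) • A n) x - T t x) := by
      intro n
      rw [NNReal.coe_add, add_smul, NormedSpace.exp_add_of_commute
        (((Commute.refl (A n)).smul_left _).smul_right _), mul_apply_eq_comp, map_sub]
      abel
    simp only [h1]
    have h2 : Tendsto (fun n => NormedSpace.exp ((s : ℝ) • A n)
        (NormedSpace.exp ((t : ℝ) • A n) x - T t x)) atTop (𝓝 0) := by
      refine squeeze_zero_norm (fun n => ?_)
        (tendsto_iff_norm_sub_tendsto_zero.1 (hT t x))
      simpa using ContinuousLinearMap.le_of_opNorm_le _ (hE n s s.2)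
        (NormedSpace.exp ((t : ℝ) • A n) x - T t x)
    simpa using (hT s (T t x)).add h2
  have hzero : T 0 = ContinuousLinearMap.id ℝ Z := by
    ext x
    refine tendsto_nhds_unique (hT 0 x) ?_
    simp
  have hinc : ∀ p ∈ Γ, ∀ t : ℝ≥0, ‖T t p.1 - p.1‖ ≤ t * ‖p.2‖ := by
    intro p hp t
    exact le_of_tendsto_of_tendsto ((hT t p.1).sub_const _).norm
      ((hAlim p hp).norm.const_mul (t : ℝ))
      (Eventually.of_forall fun n => norm_exp_smul_apply_sub_self_le (hE n) t.2 p.1)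
  have hstrong : ∀ x, Continuous fun t => T t x := by
    refine continuous_clm_of_dense hD hTn ?_
    rintro _ ⟨p, hp, rfl⟩
    have hle : ∀ s t : ℝ≥0, s ≤ t → ‖T t p.1 - T s p.1‖ ≤ ‖p.2‖ * dist t s := by
      intro s t hst
      obtain ⟨r, rfl⟩ := exists_add_of_le hst
      rw [hadd, ContinuousLinearMap.comp_apply, ← map_sub]
      refine ((T s).le_of_opNorm_le (hTn s) _).trans ?_
      rw [one_mul, NNReal.dist_eq, NNReal.coe_add, add_sub_cancel_left,
        abs_of_nonneg r.coe_nonneg, mul_comm]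
      exact hinc p hp r
    refine (LipschitzWith.of_dist_le_mul (K := ‖p.2‖₊) fun t s => ?_).continuous
    rw [dist_eq_norm, coe_nnnorm]
    rcases le_total s t with h | h
    · exact hle s t h
    · rw [norm_sub_rev, dist_comm]; exact hle t s h
  have hsub : Γ ⊆ generatorGraph fun t => ⇑(T t) := by
    intro p hp
    refine mem_generatorGraph_of_forall_le (z := p.2) fun ε hε => ?_
    -- The value `p.2` need not lie in the domain, so it is replaced by a nearby `q.1` that does.
    -- The orbit of `q.1` is Lipschitz in time with constant `‖A n q.1‖`, which converges to
    -- `‖q.2‖`.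
    obtain ⟨_, ⟨q, hq, rfl⟩, hdist⟩ := hD.exists_dist_lt p.2 (show 0 < ε / 4 by positivity)
    rw [dist_eq_norm] at hdist
    refine ⟨ε / (2 * (‖q.2‖ + 1)), by positivity, fun t _ htd => ?_⟩
    rw [lt_div_iff₀ (by positivity)] at htd
    have key : ∀ n, ‖NormedSpace.exp ((t : ℝ) • A n) p.1 - p.1 - (t : ℝ) • A n p.1‖
        ≤ t * (t * ‖A n q.1‖ + 2 * ‖A n p.1 - q.1‖) := by
      intro n
      refine norm_exp_smul_apply_sub_deriv_le t.2 _ fun s hs => ?_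
      have e : NormedSpace.exp (s • A n) (A n p.1) - A n p.1
          = NormedSpace.exp (s • A n) (A n p.1 - q.1) + (NormedSpace.exp (s • A n) q.1 - q.1)
            - (A n p.1 - q.1) := by
        rw [map_sub]; abel
      rw [e]
      have b1 := ContinuousLinearMap.le_of_opNorm_le _ (hE n s hs.1) (A n p.1 - q.1)
      have b2 := norm_exp_smul_apply_sub_self_le (hE n) hs.1 q.1
      have b3 := norm_sub_le (NormedSpace.exp (s • A n) (A n p.1 - q.1) +
        (NormedSpace.exp (s • A n) q.1 - q.1)) (A n p.1 - q.1)
      have b4 := norm_add_le (NormedSpace.exp (s • A n) (A n p.1 - q.1))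
        (NormedSpace.exp (s • A n) q.1 - q.1)
      have b5 : s * ‖A n q.1‖ ≤ t * ‖A n q.1‖ :=
        mul_le_mul_of_nonneg_right hs.2.le (norm_nonneg _)
      linarith
    have hlim : ‖T t p.1 - p.1 - (t : ℝ) • p.2‖ ≤ t * (t * ‖q.2‖ + 2 * ‖p.2 - q.1‖) :=
      le_of_tendsto_of_tendsto
        ((((hT t p.1).sub_const _).sub ((hAlim p hp).const_smul (t : ℝ))).norm)
        ((((hAlim q hq).norm.const_mul (t : ℝ)).add
          (((hAlim p hp).sub_const q.1).norm.const_mul 2)).const_mul (t : ℝ))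
        (Eventually.of_forall key)
    refine hlim.trans (mul_le_mul_of_nonneg_left ?_ t.2)
    nlinarith [t.2, norm_nonneg q.2]
  exact ⟨T, ⟨hzero, hadd, hstrong⟩, (hJ _ (hLgt 0)).generator_eq (hLpos 0) hTn hsub, hTn⟩

end Generation

/-! ### Exponential rescaling and bounded perturbations -/

section Rescaling

variable {Z : Type*} [NormedAddCommGroup Z] [NormedSpace ℝ Z]

theorem IsC0Semigroup.exp_smul {T : ℝ≥0 → Z →L[ℝ] Z} (hT : IsC0Semigroup T) (ω : ℝ) :
    IsC0Semigroup fun t : ℝ≥0 => Real.exp (ω * t) • T t where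
  map_zero := by simp [hT.map_zero]
  map_add s t := by
    rw [hT.map_add, NNReal.coe_add, mul_add, Real.exp_add]
    ext x
    simp [smul_smul, mul_comm]
  strongly_continuous z := by
    have := hT.strongly_continuous z
    simp only [smul_apply]
    fun_prop

theorem generatorGraph_exp_smul {T : ℝ≥0 → Z →L[ℝ] Z} (ω : ℝ) {p : Z × Z}
    (hp : p ∈ generatorGraph fun t => ⇑(T t)) :
    (p.1, p.2 + ω • p.1) ∈ generatorGraph fun t : ℝ≥0 => ⇑(Real.exp (ω * t) • T t) := by
  have h0 : HasDerivAt (fun t : ℝ => Real.exp (ω * t)) ω 0 := by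
    simpa using ((hasDerivAt_id (0 : ℝ)).const_mul ω).exp
  have h1 := h0.tendsto_slope_zero_right.comp tendsto_coe_nhdsGT_zero
  have h2 : Tendsto (fun t : ℝ≥0 => Real.exp (ω * t)) (𝓝[>] 0) (𝓝 1) := by
    have := (h0.continuousAt.tendsto.mono_left nhdsWithin_le_nhds).comp tendsto_coe_nhdsGT_zero
    simpa [Function.comp_def] using this
  have h3 := (h2.smul hp).add (h1.smul_const p.1)
  rw [one_smul] at h3
  refine h3.congr fun t => ?_
  simp only [Function.comp_apply, zero_add, mul_zero, Real.exp_zero, smul_apply, smul_eq_mul]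
  rw [smul_comm, mul_smul, ← smul_add, sub_smul, one_smul, smul_sub]
  congr 1
  abel

theorem generatorGraph_exp_smul_iff {T : ℝ≥0 → Z →L[ℝ] Z} (ω : ℝ) (p : Z × Z) :
    p ∈ generatorGraph (fun t : ℝ≥0 => ⇑(Real.exp (ω * t) • T t)) ↔
      (p.1, p.2 - ω • p.1) ∈ generatorGraph fun t => ⇑(T t) := by
  constructor
  · intro h
    have := generatorGraph_exp_smul (-ω) h
    simpa [smul_smul, ← Real.exp_add, sub_eq_add_neg] using this
  · intro h
    simpa using generatorGraph_exp_smul ω h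

variable [CompleteSpace Z]

/-- The Hille-Yosida theorem for a relation `Γ` such that `Γ - ω` is dissipative. -/
theorem hille_yosida {Γ : Set (Z × Z)} {ω l₀ : ℝ}
    (hJ : ∀ l > l₀, ∃ J, HasResolvent Γ l J)
    (hd : ∀ p ∈ Γ, ∀ l > ω, (l - ω) * ‖p.1‖ ≤ ‖l • p.1 - p.2‖)
    (hD : Dense (Prod.fst '' Γ)) :
    ∃ T : ℝ≥0 → Z →L[ℝ] Z, IsC0Semigroup T ∧ generatorGraph (fun t => ⇑(T t)) = Γ ∧
      ∀ t : ℝ≥0, ‖T t‖ ≤ Real.exp (ω * t) := by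
  choose! J hJ using hJ
  -- Subtracting `ω` from the operator makes it dissipative and shifts the resolvent parameter by
  -- `ω`; the semigroup is rescaled back at the end.
  have hJ' : ∀ l > l₀ - ω,
      HasResolvent {p : Z × Z | (p.1, p.2 + ω • p.1) ∈ Γ} l (J (l + ω)) := by
    intro l hl p
    rw [Set.mem_ofPred_eq, hJ (l + ω) (by linarith), add_smul]
    simp
  obtain ⟨T, hT, hgen, hn⟩ := hille_yosida_contraction hJ' (fun l hl hl0 => by
    refine ContinuousLinearMap.opNorm_le_bound _ zero_le_one fun y => ?_
    have := hd _ ((hJ (l + ω) (by linarith)).mem y) (l + ω) (by linarith)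
    simp only [add_sub_cancel_right, sub_sub_cancel] at this
    rwa [smul_apply, norm_smul, Real.norm_of_nonneg hl0.le, one_mul]) (by
    convert hD using 1
    ext x
    constructor
    · rintro ⟨p, hp, rfl⟩; exact ⟨_, hp, rfl⟩
    · rintro ⟨p, hp, rfl⟩; exact ⟨(p.1, p.2 - ω • p.1), by simpa using hp, rfl⟩)
  refine ⟨_, hT.exp_smul ω, ?_, fun t => ?_⟩
  · ext p
    rw [generatorGraph_exp_smul_iff, hgen]
    simp
  · rw [norm_smul, Real.norm_of_nonneg (Real.exp_pos _).le]
    have := hn t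
    have := Real.exp_pos (ω * t)
    nlinarith

/-- On the pair parametrized by `y`, the operator `l - Γ'` returns `(1 - N) y`, so its inverse is `J
(1 - N)⁻¹`, given by a Neumann series. In the applications `N` is the perturbation composed with
`J`. -/
theorem HasResolvent.perturb {Γ' : Set (Z × Z)} {l : ℝ} {J N : Z →L[ℝ] Z} (hN : ‖N‖ < 1)
    (h : ∀ p, p ∈ Γ' ↔ ∃ y, p = (J y, l • J y - y + N y)) : ∃ J', HasResolvent Γ' l J' := by
  set U := Units.oneSub N hN with hU
  have hUv : (U : Z →L[ℝ] Z) = 1 - N := rfl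
  refine ⟨J.comp (↑U⁻¹ : Z →L[ℝ] Z), fun p => ?_⟩
  rw [h]
  have e1 : ∀ y, (↑U⁻¹ : Z →L[ℝ] Z) (y - N y) = y := fun y => by
    have : ((↑U⁻¹ : Z →L[ℝ] Z) * (U : Z →L[ℝ] Z)) y = y := by rw [Units.inv_mul]; rfl
    exact this
  have e2 : ∀ y, (↑U⁻¹ : Z →L[ℝ] Z) y - N ((↑U⁻¹ : Z →L[ℝ] Z) y) = y := fun y => by
    have : ((U : Z →L[ℝ] Z) * (↑U⁻¹ : Z →L[ℝ] Z)) y = y := by rw [Units.mul_inv]; rfl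
    exact this
  constructor
  · rintro ⟨y, rfl⟩
    have : l • J y - (l • J y - y + N y) = y - N y := by abel
    simp only [ContinuousLinearMap.comp_apply, this, e1]
  · intro hp
    rw [ContinuousLinearMap.comp_apply] at hp
    refine ⟨(↑U⁻¹ : Z →L[ℝ] Z) (l • p.1 - p.2), Prod.ext hp.symm ?_⟩
    simp only [hp]
    rw [sub_add, e2]; abel

/-- A bounded perturbation `R`, with logarithmic norm at most `ω`, of a dissipative relation with
resolvents generates a semigroup of growth at most `ω`. -/
theorem exists_semigroup_add_bounded {Γ : Set (Z × Z)} {l₀ : ℝ}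
    (hJ : ∀ l > l₀, ∃ J, HasResolvent Γ l J)
    (hd : ∀ p ∈ Γ, ∀ l > (0 : ℝ), l * ‖p.1‖ ≤ ‖l • p.1 - p.2‖)
    (hD : Dense (Prod.fst '' Γ)) (R : Z →L[ℝ] Z) {ω h : ℝ} (hh : 0 < h)
    (hR : ∀ x, ‖x + h • R x‖ ≤ (1 + h * ω) * ‖x‖) :
    ∃ T : ℝ≥0 → Z →L[ℝ] Z, IsC0Semigroup T ∧
      generatorGraph (fun t => ⇑(T t)) = {p | (p.1, p.2 - R p.1) ∈ Γ} ∧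
      ∀ t : ℝ≥0, ‖T t‖ ≤ Real.exp (ω * t) := by
  refine hille_yosida (l₀ := max l₀ ‖R‖) ?_ ?_ ?_
  · intro l hl
    have hl0 : 0 < l := (norm_nonneg R).trans_lt ((le_max_right _ _).trans_lt hl)
    obtain ⟨J, hJ⟩ := hJ l ((le_max_left _ _).trans_lt hl)
    have hJn : ‖J‖ ≤ l⁻¹ := by
      refine ContinuousLinearMap.opNorm_le_bound _ (by positivity) fun y => ?_
      have := hd _ (hJ.mem y) l hl0
      simp only [sub_sub_cancel] at this
      rwa [le_inv_mul_iff₀ hl0]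
    refine HasResolvent.perturb (J := J) (N := R.comp J) ?_ fun p => ?_
    · refine (R.opNorm_comp_le J).trans_lt ?_
      calc ‖R‖ * ‖J‖ ≤ ‖R‖ * l⁻¹ := by gcongr
        _ < 1 := by
          rw [mul_inv_lt_iff₀ hl0, one_mul]
          exact (le_max_right _ _).trans_lt hl
    · rw [Set.mem_ofPred_eq, hJ]
      constructor
      · intro hp
        refine ⟨_, Prod.ext hp.symm ?_⟩
        simp only [ContinuousLinearMap.comp_apply] at hp ⊢
        rw [hp]; abel
      · rintro ⟨y, rfl⟩
        simp
  · intro p hp l hl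
    rw [Set.mem_ofPred_eq] at hp
    -- Negative `l` also occur, whereas `Γ` is dissipative only at positive parameters. If `l ≤
    -- -1/h` and `p.1 ≠ 0`, then `hR` forces `1 + h ω ≥ 0`, which contradicts `l > ω`.
    rcases le_or_gt (l + h⁻¹) 0 with h1 | h1
    · rcases eq_or_ne ‖p.1‖ 0 with h0 | h0
      · rw [h0, mul_zero]; positivity
      have h3 : 0 ≤ 1 + h * ω :=
        nonneg_of_mul_nonneg_left ((norm_nonneg _).trans (hR p.1)) (by positivity)
      have : h * (l + h⁻¹) = h * l + 1 := by field_simp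
      nlinarith
    -- Raising the parameter by `1/h` turns `R p.1` into `h⁻¹ (p.1 + h R p.1)`, the quantity
    -- controlled by `hR`.
    have h2 := hd _ hp (l + h⁻¹) h1
    simp only at h2
    have e : (l + h⁻¹) • p.1 - (p.2 - R p.1) = (l • p.1 - p.2) + h⁻¹ • (p.1 + h • R p.1) := by
      rw [smul_add, inv_smul_smul₀ hh.ne', add_smul]; abel
    rw [e] at h2
    have h3 := norm_add_le (l • p.1 - p.2) (h⁻¹ • (p.1 + h • R p.1))
    have h4 : ‖h⁻¹ • (p.1 + h • R p.1)‖ ≤ (h⁻¹ + ω) * ‖p.1‖ := by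
      rw [norm_smul, norm_inv, Real.norm_of_nonneg hh.le, inv_mul_le_iff₀ hh, ← mul_assoc,
        mul_add, mul_inv_cancel₀ hh.ne']
      exact hR p.1
    linarith
  · convert hD using 1
    ext x
    constructor
    · rintro ⟨p, hp, rfl⟩; exact ⟨_, hp, rfl⟩
    · rintro ⟨p, hp, rfl⟩; exact ⟨(p.1, p.2 + R p.1), by simpa using hp, rfl⟩

end Rescaling

/-! ### The resolvent of a contraction semigroup -/

section Laplace

variable {Z : Type*} [NormedAddCommGroup Z] [NormedSpace ℝ Z]

/-- The Laplace transform `∫₀^∞ e^{-lt} T(t) y dt`. -/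
def laplace (T : ℝ≥0 → Z →L[ℝ] Z) (l : ℝ) (y : Z) : Z :=
  ∫ t in Set.Ioi (0 : ℝ), Real.exp (-(l * t)) • T t.toNNReal y

theorem IsC0Semigroup.continuous_laplace_integrand {T : ℝ≥0 → Z →L[ℝ] Z} (hT : IsC0Semigroup T)
    (l : ℝ) (y : Z) : Continuous fun t : ℝ => Real.exp (-(l * t)) • T t.toNNReal y :=
  Continuous.smul (by fun_prop) ((hT.strongly_continuous y).comp continuous_real_toNNReal)

theorem integrableOn_exp_neg_mul {l : ℝ} (hl : 0 < l) :
    IntegrableOn (fun t : ℝ => Real.exp (-(l * t))) (Set.Ioi 0) := by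
  simpa only [neg_mul] using exp_neg_integrableOn_Ioi 0 hl

theorem IsC0Semigroup.integrableOn_laplace {T : ℝ≥0 → Z →L[ℝ] Z} (hT : IsC0Semigroup T)
    (hn : ∀ t, ‖T t‖ ≤ 1) {l : ℝ} (hl : 0 < l) (y : Z) :
    IntegrableOn (fun t : ℝ => Real.exp (-(l * t)) • T t.toNNReal y) (Set.Ioi 0) := by
  refine ((integrableOn_exp_neg_mul hl).mul_const ‖y‖).mono'
    (hT.continuous_laplace_integrand l y).aestronglyMeasurable.restrict (ae_of_all _ fun t => ?_)
  rw [norm_smul, Real.norm_of_nonneg (Real.exp_pos _).le]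
  gcongr
  simpa using (T t.toNNReal).le_of_opNorm_le (hn _) y

/-- A densely defined dissipative linear relation is single-valued. -/
theorem eq_zero_of_dissipative_of_dense {B : Submodule ℝ (Z × Z)}
    (hd : ∀ p ∈ B, ∀ l > (0 : ℝ), l * ‖p.1‖ ≤ ‖l • p.1 - p.2‖)
    (hD : Dense (Prod.fst '' (B : Set (Z × Z)))) {b : Z} (hb : (0, b) ∈ B) : b = 0 := by
  -- Dissipativity is applied to `p + λ (0, b)` at the parameter `λ = n + 1`; division by `λ` and `λ
  -- → ∞` give the claim. A point `p.1` within `‖b‖ / 2` of `b` then yields a contradiction.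
  have key : ∀ p ∈ B, ‖p.1‖ ≤ ‖p.1 - b‖ := by
    intro p hp
    have h1 : Tendsto (fun n : ℕ => ‖p.1 - b - (n + 1 : ℝ)⁻¹ • p.2‖) atTop (𝓝 ‖p.1 - b - 0‖) := by
      have : Tendsto (fun n : ℕ => (n + 1 : ℝ)⁻¹ • p.2) atTop (𝓝 0) := by
        simpa [one_div] using
          (tendsto_one_div_add_atTop_nhds_zero_nat (𝕜 := ℝ)).smul_const p.2
      exact (this.const_sub _).norm
    rw [sub_zero] at h1
    refine ge_of_tendsto h1 (Eventually.of_forall fun n => ?_)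
    have hn : (0 : ℝ) < n + 1 := by positivity
    have h2 := hd _ (B.add_mem hp (B.smul_mem (n + 1 : ℝ) hb)) (n + 1) hn
    simp only [Prod.fst_add, Prod.smul_mk, smul_zero, add_zero, Prod.snd_add] at h2
    have e : ((n : ℝ) + 1) • p.1 - (p.2 + ((n : ℝ) + 1) • b)
        = ((n : ℝ) + 1) • (p.1 - b - (n + 1 : ℝ)⁻¹ • p.2) := by
      rw [smul_sub, smul_inv_smul₀ hn.ne', smul_sub]; abel
    rw [e, norm_smul, Real.norm_of_nonneg hn.le] at h2
    exact le_of_mul_le_mul_left h2 hn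
  by_contra hb0
  obtain ⟨_, ⟨p, hp, rfl⟩, hdist⟩ := hD.exists_dist_lt b (half_pos (norm_pos_iff.2 hb0))
  have h1 := key p hp
  rw [dist_eq_norm, norm_sub_rev] at hdist
  have h2 := norm_sub_norm_le b (b - p.1)
  rw [sub_sub_cancel] at h2
  rw [norm_sub_rev] at hdist
  rw [norm_sub_rev] at h1
  have := norm_sub_rev b p.1
  linarith

theorem exists_clm_eq_laplace {T : ℝ≥0 → Z →L[ℝ] Z} (hT : IsC0Semigroup T)
    (hn : ∀ t, ‖T t‖ ≤ 1) {l : ℝ} (hl : 0 < l) :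
    ∃ J : Z →L[ℝ] Z, ∀ y, J y = laplace T l y := by
  refine ⟨LinearMap.mkContinuous
    { toFun := laplace T l
      map_add' := fun x y => ?_
      map_smul' := fun c x => ?_ } (∫ t in Set.Ioi (0 : ℝ), Real.exp (-(l * t))) fun x => ?_,
      fun y => rfl⟩
  · simp only [laplace, map_add, smul_add]
    exact integral_add (hT.integrableOn_laplace hn hl x) (hT.integrableOn_laplace hn hl y)
  · simp only [laplace, map_smul, RingHom.id_apply]
    rw [← integral_smul]
    exact integral_congr_ae (ae_of_all _ fun t => smul_comm _ _ _)
  · simp only [laplace, LinearMap.coe_mk, AddHom.coe_mk]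
    rw [← integral_mul_const]
    refine norm_integral_le_of_norm_le ((integrableOn_exp_neg_mul hl).mul_const ‖x‖)
      (ae_of_all _ fun t => ?_)
    rw [norm_smul, Real.norm_of_nonneg (Real.exp_pos _).le]
    gcongr
    simpa using (T t.toNNReal).le_of_opNorm_le (hn _) x

variable [CompleteSpace Z]

theorem IsC0Semigroup.apply_laplace {T : ℝ≥0 → Z →L[ℝ] Z} (hT : IsC0Semigroup T)
    (hn : ∀ t, ‖T t‖ ≤ 1) {l : ℝ} (hl : 0 < l) (y : Z) (h : ℝ≥0) :
    T h (laplace T l y) = laplace T l (T h y) := by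
  rw [laplace, ← ContinuousLinearMap.integral_comp_comm _ (hT.integrableOn_laplace hn hl y),
    laplace]
  refine integral_congr_ae (ae_of_all _ fun t => ?_)
  simp only [map_smul]
  rw [← ContinuousLinearMap.comp_apply, ← hT.map_add, add_comm, hT.map_add,
    ContinuousLinearMap.comp_apply]

/-- Translating the variable by `h` turns the transform of `T h y` into `e^{l h}` times the tail
integral over `(h, ∞)`. Differentiation at `h = 0` then gives the resolvent equation. -/
theorem IsC0Semigroup.apply_laplace_eq {T : ℝ≥0 → Z →L[ℝ] Z} (hT : IsC0Semigroup T)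
    (hn : ∀ t, ‖T t‖ ≤ 1) {l : ℝ} (hl : 0 < l) (y : Z) (h : ℝ≥0) :
    T h (laplace T l y) = Real.exp (l * h) •
      (laplace T l y - ∫ t in (0 : ℝ)..h, Real.exp (-(l * t)) • T t.toNNReal y) := by
  have hint := hT.integrableOn_laplace hn hl y
  have h1 := intervalIntegral.integral_interval_add_Ioi hint
    (hint.mono_set (Set.Ioi_subset_Ioi h.coe_nonneg))
  have h2 : laplace T l y - ∫ t in (0 : ℝ)..h, Real.exp (-(l * t)) • T t.toNNReal y
      = ∫ t in Set.Ioi (h : ℝ), Real.exp (-(l * t)) • T t.toNNReal y := by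
    rw [laplace, ← h1, add_sub_cancel_left]
  have h3 := (measurePreserving_add_right volume (h : ℝ)).setIntegral_preimage_emb
    (measurableEmbedding_addRight (h : ℝ)) (fun t => Real.exp (-(l * t)) • T t.toNNReal y)
    (Set.Ioi (h : ℝ))
  rw [h2, ← h3, ← integral_smul, hT.apply_laplace hn hl, laplace]
  have h4 : (fun x : ℝ => x + h) ⁻¹' Set.Ioi (h : ℝ) = Set.Ioi 0 := by
    ext x; simp
  rw [h4]
  refine setIntegral_congr_fun measurableSet_Ioi fun t ht => ?_
  have ht' : (0 : ℝ) ≤ t := le_of_lt ht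
  rw [smul_smul, ← Real.exp_add, Real.toNNReal_add ht' h.coe_nonneg, Real.toNNReal_coe, hT.map_add,
    ContinuousLinearMap.comp_apply]
  congr 2
  ring

theorem IsC0Semigroup.hasDerivAt_integral_laplace {T : ℝ≥0 → Z →L[ℝ] Z} (hT : IsC0Semigroup T)
    (l : ℝ) (y : Z) :
    HasDerivAt (fun h => ∫ t in (0 : ℝ)..h, Real.exp (-(l * t)) • T t.toNNReal y) y 0 := by
  have hc := hT.continuous_laplace_integrand l y
  have := intervalIntegral.integral_hasDerivAt_right (hc.intervalIntegrable 0 0)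
    (hc.stronglyMeasurableAtFilter _ _) hc.continuousAt
  simpa [hT.map_zero] using this

/-- The Laplace transform of a contraction semigroup is the resolvent of its generator. -/
theorem IsC0Semigroup.laplace_mem_generator {T : ℝ≥0 → Z →L[ℝ] Z} (hT : IsC0Semigroup T)
    (hn : ∀ t, ‖T t‖ ≤ 1) {l : ℝ} (hl : 0 < l) (y : Z) :
    (laplace T l y, l • laplace T l y - y) ∈ generatorGraph fun t => ⇑(T t) := by
  have h0 : HasDerivAt (fun h : ℝ => Real.exp (l * h)) l 0 := by
    simpa using ((hasDerivAt_id (0 : ℝ)).const_mul l).exp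
  have h1 := (h0.smul ((hT.hasDerivAt_integral_laplace l y).const_sub
    (laplace T l y))).tendsto_slope_zero_right.comp tendsto_coe_nhdsGT_zero
  simp only [mul_zero, Real.exp_zero, one_smul, intervalIntegral.integral_same, sub_zero] at h1
  rw [neg_add_eq_sub] at h1
  refine h1.congr fun t => ?_
  simp only [Function.comp_apply, zero_add]
  rw [hT.apply_laplace_eq hn hl]
  simp

theorem IsC0Semigroup.hasResolvent {T : ℝ≥0 → Z →L[ℝ] Z} (hT : IsC0Semigroup T)
    (hn : ∀ t, ‖T t‖ ≤ 1) {l : ℝ} (hl : 0 < l) {J : Z →L[ℝ] Z} (hJ : ∀ y, J y = laplace T l y) :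
    HasResolvent (generatorGraph fun t => ⇑(T t)) l J :=
  hasResolvent_of_dissipative (Γ := generatorSubmodule T) hl
    (fun _ hp => dissipative_generator hn hp hl)
    fun y => by rw [hJ]; exact hT.laplace_mem_generator hn hl y

/-- The mean `h⁻¹ ∫₀ʰ e^{-l t} T(t) y dt` tends to `y`, and it is the Laplace transform of `h⁻¹ (y -
e^{-l h} T(h) y)`. -/
theorem IsC0Semigroup.dense_range_laplace {T : ℝ≥0 → Z →L[ℝ] Z} (hT : IsC0Semigroup T)
    (hn : ∀ t, ‖T t‖ ≤ 1) {l : ℝ} (hl : 0 < l) : Dense (Set.range (laplace T l)) := by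
  intro y
  obtain ⟨J, hJ⟩ := exists_clm_eq_laplace hT hn hl
  have h1 := (hT.hasDerivAt_integral_laplace l y).tendsto_slope_zero_right.comp
    tendsto_coe_nhdsGT_zero
  refine mem_closure_of_tendsto h1 (Eventually.of_forall fun h => ?_)
  refine ⟨(h : ℝ)⁻¹ • (y - Real.exp (-(l * h)) • T h y), ?_⟩
  have h2 := hT.apply_laplace_eq hn hl y h
  rw [hT.apply_laplace hn hl] at h2
  simp only [Function.comp_apply, zero_add, intervalIntegral.integral_same, sub_zero]
  rw [← hJ, map_smul, map_sub, map_smul, hJ, hJ, h2, smul_smul, ← Real.exp_add]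
  simp

end Laplace

/-! ### Relatively bounded dissipative perturbations -/

section RelativelyBounded

variable {Z : Type*} [NormedAddCommGroup Z] [NormedSpace ℝ Z] [CompleteSpace Z]

/-- The integrand vanishes in the quotient by the closed subspace, and the quotient map commutes
with the integral. Applied to a closed graph, this moves a closed operator under an integral. -/
theorem integral_mem_of_isClosed {α : Type*} [MeasurableSpace α] {μ : Measure α}
    {B : Submodule ℝ Z} (hB : IsClosed (B : Set Z)) {f : α → Z} (hf : Integrable f μ)
    (h : ∀ᵐ t ∂μ, f t ∈ B) : ∫ t, f t ∂μ ∈ B := by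
  have : IsClosed (B : Set Z) := hB
  have h1 := B.mkQL.integral_comp_comm hf
  have h2 : ∫ t, B.mkQL (f t) ∂μ = 0 := by
    refine integral_eq_zero_of_ae ?_
    filter_upwards [h] with t ht
    exact (Submodule.Quotient.mk_eq_zero B).2 ht
  rw [h2] at h1
  exact (Submodule.Quotient.mk_eq_zero B).1 h1.symm

theorem integrableOn_exp_neg_mul_rpow {l : ℝ} (hl : 0 < l) :
    IntegrableOn (fun t : ℝ => t ^ ((1 / 2 : ℝ) - 1) * Real.exp (-(l * t))) (Set.Ioi 0) := by
  have := integrableOn_rpow_mul_exp_neg_mul_rpow (p := 1) (s := (1 / 2 : ℝ) - 1) (by norm_num)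
    one_pos hl
  simpa only [Real.rpow_one, neg_mul] using this

/-- If `B T(t)` is bounded by `M t^{-1/2} + M'`, then `B (l - A)⁻¹` is bounded by the Laplace
transform of that function. -/
theorem exists_laplace_mem {T : ℝ≥0 → Z →L[ℝ] Z} (hT : IsC0Semigroup T) (hn : ∀ t, ‖T t‖ ≤ 1)
    {B : Submodule ℝ (Z × Z)} (hB : IsClosed (B : Set (Z × Z)))
    (hB0 : ∀ b, ((0 : Z), b) ∈ B → b = 0) {M M' : ℝ}
    (hK : ∀ (t : ℝ≥0) (v : Z), 0 < t →
      ∃ k, (T t v, k) ∈ B ∧ ‖k‖ ≤ (M * (t : ℝ) ^ ((1 / 2 : ℝ) - 1) + M') * ‖v‖)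
    {l : ℝ} (hl : 0 < l) (y : Z) :
    ∃ b, (laplace T l y, b) ∈ B ∧
      ‖b‖ ≤ (M * ((1 / l) ^ (1 / 2 : ℝ) * Real.Gamma (1 / 2)) + M' * l⁻¹) * ‖y‖ := by
  choose! K hKB hKn using hK
  have huniq : ∀ v b b', (v, b) ∈ B → (v, b') ∈ B → b = b' := by
    intro v b b' h h'
    have := B.sub_mem h h'
    simp only [Prod.mk_sub_mk, sub_self] at this
    exact sub_eq_zero.1 (hB0 _ this)
  -- The values `K t y` come from a choice, so their measurability in `t` has to be proved.
  -- Single-valuedness of `B` gives this factorization, and continuity follows from that of the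
  -- semigroup orbit.
  have hshift : ∀ s t : ℝ≥0, 0 < s → s ≤ t → K t y = K s (T (t - s) y) := by
    intro s t hs hst
    refine huniq (T t y) _ _ (hKB t y (hs.trans_le hst)) ?_
    have := hKB s (T (t - s) y) hs
    rwa [← ContinuousLinearMap.comp_apply, ← hT.map_add, add_tsub_cancel_of_le hst] at this
  have hsub : ∀ (s : ℝ≥0) (v w : Z), 0 < s → K s v - K s w = K s (v - w) := by
    intro s v w hs
    refine huniq (T s (v - w)) _ _ ?_ (hKB s _ hs)
    simpa using B.sub_mem (hKB s v hs) (hKB s w hs)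
  have hcont : ContinuousOn (fun t : ℝ => K t.toNNReal y) (Set.Ioi 0) := by
    intro t₀ ht₀
    have ht₀' : (0 : ℝ) < t₀ := ht₀
    refine ContinuousAt.continuousWithinAt ?_
    set s : ℝ≥0 := (t₀ / 2).toNNReal with hs
    have hs0 : 0 < s := Real.toNNReal_pos.2 (half_pos ht₀')
    have hst₀ : s ≤ t₀.toNNReal := Real.toNNReal_le_toNNReal (by linarith)
    rw [ContinuousAt, tendsto_iff_norm_sub_tendsto_zero]
    have hc : Continuous fun t : ℝ => T (t.toNNReal - s) y :=
      (hT.strongly_continuous y).comp (continuous_real_toNNReal.sub continuous_const)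
    have h1 : Tendsto (fun t : ℝ => (M * (s : ℝ) ^ ((1 / 2 : ℝ) - 1) + M') *
        ‖T (t.toNNReal - s) y - T (t₀.toNNReal - s) y‖) (𝓝 t₀) (𝓝 0) := by
      simpa using (tendsto_iff_norm_sub_tendsto_zero.1 (hc.tendsto t₀)).const_mul
        (M * (s : ℝ) ^ ((1 / 2 : ℝ) - 1) + M')
    refine squeeze_zero' (Eventually.of_forall fun _ => norm_nonneg _) ?_ h1
    filter_upwards [lt_mem_nhds (half_lt_self ht₀')] with t ht
    have hst : s ≤ t.toNNReal := Real.toNNReal_le_toNNReal ht.le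
    rw [hshift s _ hs0 hst, hshift s _ hs0 hst₀, hsub _ _ _ hs0]
    exact hKn _ _ hs0
  set g : ℝ → ℝ := fun t => (M * (t ^ ((1 / 2 : ℝ) - 1) * Real.exp (-(l * t))) +
    M' * Real.exp (-(l * t))) * ‖y‖ with hg
  have hgint : IntegrableOn g (Set.Ioi 0) :=
    (((integrableOn_exp_neg_mul_rpow hl).const_mul M).add
      ((integrableOn_exp_neg_mul hl).const_mul M')).mul_const _
  have hbound : ∀ t ∈ Set.Ioi (0 : ℝ), ‖Real.exp (-(l * t)) • K t.toNNReal y‖ ≤ g t := by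
    intro t ht
    have ht' : (0 : ℝ) < t := ht
    have h1 := hKn t.toNNReal y (Real.toNNReal_pos.2 ht')
    rw [Real.coe_toNNReal _ ht'.le] at h1
    rw [norm_smul, Real.norm_of_nonneg (Real.exp_pos _).le]
    calc _ ≤ Real.exp (-(l * t)) * ((M * t ^ ((1 / 2 : ℝ) - 1) + M') * ‖y‖) := by gcongr
      _ = g t := by simp only [hg]; ring
  have hint : IntegrableOn (fun t : ℝ => Real.exp (-(l * t)) • K t.toNNReal y) (Set.Ioi 0) := by
    refine Integrable.mono' hgint ?_ ((ae_restrict_iff' measurableSet_Ioi).2 (ae_of_all _ hbound))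
    refine ContinuousOn.aestronglyMeasurable (ContinuousOn.smul ?_ hcont) measurableSet_Ioi
    fun_prop
  refine ⟨∫ t in Set.Ioi (0 : ℝ), Real.exp (-(l * t)) • K t.toNNReal y, ?_, ?_⟩
  · rw [laplace, ← integral_pair (hT.integrableOn_laplace hn hl y) hint]
    refine integral_mem_of_isClosed hB ((hT.integrableOn_laplace hn hl y).prodMk hint)
      ((ae_restrict_iff' measurableSet_Ioi).2 (ae_of_all _ fun t ht => ?_))
    exact B.smul_mem _ (hKB _ y (Real.toNNReal_pos.2 ht))
  · refine (norm_integral_le_of_norm_le hgint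
      ((ae_restrict_iff' measurableSet_Ioi).2 (ae_of_all _ hbound))).trans_eq ?_
    have e1 : ∫ t in Set.Ioi (0 : ℝ), Real.exp (-(l * t)) = l⁻¹ := by
      have := integral_exp_mul_Ioi (neg_lt_zero.2 hl) 0
      simpa [neg_mul, div_neg, neg_div] using this
    rw [hg, integral_mul_const, integral_add ((integrableOn_exp_neg_mul_rpow hl).const_mul M)
      ((integrableOn_exp_neg_mul hl).const_mul M'), integral_const_mul, integral_const_mul, e1,
      Real.integral_rpow_mul_exp_neg_mul_Ioi (by norm_num) hl]

/-- The sum of two linear relations, on the intersection of the domains. -/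
def sumGraph (A B : Set (Z × Z)) : Set (Z × Z) :=
  {p | ∃ a b, (p.1, a) ∈ A ∧ (p.1, b) ∈ B ∧ p.2 = a + b}

/-- Writing `R = (l - A)⁻¹`, one has `(l - A - B) R = 1 - B R`, and the bound on `B R` tends to zero
as `l → ∞`. The range of `R` lies in the domain of `B`, so the common domain is dense. -/
theorem sumGraph_hasResolvent {T : ℝ≥0 → Z →L[ℝ] Z} (hT : IsC0Semigroup T)
    (hn : ∀ t, ‖T t‖ ≤ 1) {B : Submodule ℝ (Z × Z)} (hB : IsClosed (B : Set (Z × Z)))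
    (hB0 : ∀ b, ((0 : Z), b) ∈ B → b = 0) {M M' : ℝ}
    (hK : ∀ (t : ℝ≥0) (v : Z), 0 < t →
      ∃ k, (T t v, k) ∈ B ∧ ‖k‖ ≤ (M * (t : ℝ) ^ ((1 / 2 : ℝ) - 1) + M') * ‖v‖) :
    Dense (Prod.fst '' sumGraph (generatorGraph fun t => ⇑(T t)) (B : Set (Z × Z))) ∧
    ∃ l₀ > 0, ∀ l > l₀,
      ∃ J, HasResolvent (sumGraph (generatorGraph fun t => ⇑(T t)) (B : Set (Z × Z))) l J := by
  have huniq : ∀ v b b', (v, b) ∈ B → (v, b') ∈ B → b = b' := by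
    intro v b b' h h'
    have := B.sub_mem h h'
    simp only [Prod.mk_sub_mk, sub_self] at this
    exact sub_eq_zero.1 (hB0 _ this)
  have hlim : Tendsto (fun l : ℝ => M * ((1 / l) ^ (1 / 2 : ℝ) * Real.Gamma (1 / 2)) + M' * l⁻¹)
      atTop (𝓝 0) := by
    have h1 : Tendsto (fun l : ℝ => (1 / l) ^ (1 / 2 : ℝ)) atTop (𝓝 0) := by
      have := (tendsto_inv_atTop_zero (𝕜 := ℝ)).rpow_const (p := 1 / 2) (Or.inr (by norm_num))
      simpa [one_div] using this
    simpa using ((h1.mul_const (Real.Gamma (1 / 2))).const_mul M).add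
      ((tendsto_inv_atTop_zero (𝕜 := ℝ)).const_mul M')
  obtain ⟨l₁, hl₁⟩ := eventually_atTop.1 (hlim.eventually_lt_const (zero_lt_one (α := ℝ)))
  have hNb := fun (l : ℝ) (hl : 0 < l) (y : Z) => exists_laplace_mem hT hn hB hB0 hK hl y
  refine ⟨(hT.dense_range_laplace hn one_pos).mono ?_, max l₁ 1, by positivity, fun l hl => ?_⟩
  · rintro _ ⟨y, rfl⟩
    obtain ⟨b, hb, -⟩ := hNb 1 one_pos y
    exact ⟨(_, _), ⟨_, b, hT.laplace_mem_generator hn one_pos y, hb, rfl⟩, rfl⟩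
  have hl0 : 0 < l := zero_lt_one.trans ((le_max_right _ _).trans_lt hl)
  obtain ⟨J, hJ⟩ := exists_clm_eq_laplace hT hn hl0
  have hres := hT.hasResolvent hn hl0 hJ
  choose N hNB hNn using hNb l hl0
  set c := M * ((1 / l) ^ (1 / 2 : ℝ) * Real.Gamma (1 / 2)) + M' * l⁻¹ with hc
  have hc1 : c < 1 := hl₁ l ((le_max_left _ _).trans hl.le)
  -- The operator `B (l - A)⁻¹`; linearity of the chosen values follows because `B` is linear and
  -- single-valued.
  let N' : Z →L[ℝ] Z := LinearMap.mkContinuous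
    { toFun := N
      map_add' := fun x y => huniq (laplace T l (x + y)) _ _ (hNB _) (by
        rw [← hJ, map_add, hJ, hJ]; exact B.add_mem (hNB x) (hNB y))
      map_smul' := fun r x => huniq (laplace T l (r • x)) _ _ (hNB _) (by
        rw [← hJ, map_smul, hJ]; exact B.smul_mem r (hNB x)) } c hNn
  have hN' : ∀ y, N' y = N y := fun _ => rfl
  have hN1 : ‖N'‖ < 1 := by
    -- No sign is imposed on `M` and `M'`, so `c` is replaced by `max c 0`.
    refine (ContinuousLinearMap.opNorm_le_bound N' (le_max_right c 0) fun y => ?_).trans_lt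
      (max_lt hc1 zero_lt_one)
    exact (hNn y).trans (mul_le_mul_of_nonneg_right (le_max_left _ _) (norm_nonneg _))
  refine HasResolvent.perturb (J := J) hN1 fun p => ?_
  constructor
  · rintro ⟨a, b, ha, hb, hab⟩
    have h1 := (hres _).1 ha
    simp only at h1
    refine ⟨l • p.1 - a, Prod.ext h1.symm ?_⟩
    have h2 : b = N (l • p.1 - a) := by
      refine huniq p.1 _ _ hb ?_
      have := hNB (l • p.1 - a)
      rwa [← hJ, h1] at this
    rw [hab, h2, h1, hN', sub_sub_cancel]
  · rintro ⟨y, rfl⟩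
    refine ⟨l • J y - y, N y, hres.mem y, ?_, rfl⟩
    rw [hJ]; exact hNB y

end RelativelyBounded

/-! ### The essential semi-norm and the essential growth rate -/

section Essential

variable {Z : Type*} [NormedAddCommGroup Z] [NormedSpace ℝ Z]

/-- The radii admitted in the definition of the essential semi-norm. -/
def essRadii (L : Z →L[ℝ] Z) : Set ℝ :=
  {r : ℝ | 0 < r ∧ ∃ F : Finset Z, L '' Metric.closedBall 0 1 ⊆ ⋃ c ∈ F, Metric.closedBall c r}

theorem bddBelow_essRadii (L : Z →L[ℝ] Z) : BddBelow (essRadii L) := ⟨0, fun _ hr => hr.1.le⟩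

theorem essSeminorm_nonneg (L : Z →L[ℝ] Z) : 0 ≤ essSeminorm L :=
  Real.sInf_nonneg fun _ hr => hr.1.le

/-- If `S` maps the unit ball to a totally bounded set, then `L + S` has essential semi-norm
at most `‖L‖`. -/
theorem add_mem_essRadii (L S : Z →L[ℝ] Z) (hS : TotallyBounded (S '' Metric.closedBall 0 1))
    {δ : ℝ} (hδ : 0 < δ) : ‖L‖ + δ ∈ essRadii (L + S) := by
  refine ⟨by positivity, ?_⟩
  obtain ⟨F, hF, hcov⟩ := Metric.totallyBounded_iff.1 hS δ hδ
  refine ⟨hF.toFinset, ?_⟩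
  rintro _ ⟨x, hx, rfl⟩
  obtain ⟨c, hc, hxc⟩ := Set.mem_iUnion₂.1 (hcov ⟨x, hx, rfl⟩)
  refine Set.mem_iUnion₂.2 ⟨c, hF.mem_toFinset.2 hc, ?_⟩
  rw [Metric.mem_ball, dist_eq_norm] at hxc
  rw [mem_closedBall_zero_iff] at hx
  rw [Metric.mem_closedBall, dist_eq_norm, add_apply, add_sub_assoc]
  refine (norm_add_le _ _).trans (add_le_add ?_ hxc.le)
  exact (L.le_opNorm x).trans (mul_le_of_le_one_right (norm_nonneg _) hx)

theorem essRadii_nonempty (L : Z →L[ℝ] Z) : (essRadii L).Nonempty := by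
  refine ⟨‖L‖ + 1, ?_⟩
  have := add_mem_essRadii L 0 (by
    refine (Set.finite_singleton (0 : Z)).totallyBounded.subset ?_
    rintro _ ⟨x, -, rfl⟩
    simp) one_pos
  rwa [add_zero] at this

theorem essSeminorm_add_le (L S : Z →L[ℝ] Z) (hS : TotallyBounded (S '' Metric.closedBall 0 1)) :
    essSeminorm (L + S) ≤ ‖L‖ :=
  le_of_forall_pos_le_add fun _ hδ => csInf_le (bddBelow_essRadii _) (add_mem_essRadii L S hS hδ)

theorem essSeminorm_le_norm (L : Z →L[ℝ] Z) : essSeminorm L ≤ ‖L‖ := by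
  have := essSeminorm_add_le L 0 (by
    refine (Set.finite_singleton (0 : Z)).totallyBounded.subset ?_
    rintro _ ⟨x, -, rfl⟩
    simp)
  rwa [add_zero] at this

/-- If `S x` is within `s` of `c`, then `S x - c` is `s` times a vector of the unit ball, whose
image under `L` is within `r` of some `d`. The centres `L c + s d` are finite in number. -/
theorem mul_mem_essRadii {L S : Z →L[ℝ] Z} {r s : ℝ} (hr : r ∈ essRadii L) (hs : s ∈ essRadii S) :
    r * s ∈ essRadii (L.comp S) := by
  classical
  obtain ⟨hr0, F, hF⟩ := hr
  obtain ⟨hs0, G, hG⟩ := hs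
  refine ⟨mul_pos hr0 hs0, Finset.image₂ (fun d c => L c + s • d) F G, ?_⟩
  rintro _ ⟨x, hx, rfl⟩
  obtain ⟨c, hc, hxc⟩ := Set.mem_iUnion₂.1 (hG ⟨x, hx, rfl⟩)
  rw [Metric.mem_closedBall, dist_eq_norm] at hxc
  have hz : s⁻¹ • (S x - c) ∈ Metric.closedBall (0 : Z) 1 := by
    rw [mem_closedBall_zero_iff, norm_smul, norm_inv, Real.norm_of_nonneg hs0.le,
      inv_mul_le_iff₀ hs0, mul_one]
    exact hxc
  obtain ⟨d, hd, hzd⟩ := Set.mem_iUnion₂.1 (hF ⟨_, hz, rfl⟩)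
  rw [Metric.mem_closedBall, dist_eq_norm] at hzd
  refine Set.mem_iUnion₂.2 ⟨_, Finset.mem_image₂_of_mem hd hc, ?_⟩
  rw [Metric.mem_closedBall, dist_eq_norm, ContinuousLinearMap.comp_apply]
  have e : L (S x) - (L c + s • d) = s • (L (s⁻¹ • (S x - c)) - d) := by
    rw [map_smul, smul_sub, smul_inv_smul₀ hs0.ne', map_sub]; abel
  rw [e, norm_smul, Real.norm_of_nonneg hs0.le, mul_comm r]
  gcongr

theorem essSeminorm_comp_le (L S : Z →L[ℝ] Z) :
    essSeminorm (L.comp S) ≤ essSeminorm L * essSeminorm S := by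
  have h1 : ∀ r ∈ essRadii L, ∀ s ∈ essRadii S, essSeminorm (L.comp S) ≤ r * s := fun r hr s hs =>
    csInf_le (bddBelow_essRadii _) (mul_mem_essRadii hr hs)
  have h2 : ∀ r ∈ essRadii L, essSeminorm (L.comp S) ≤ r * essSeminorm S := fun r hr => by
    rw [← div_le_iff₀' hr.1]
    exact le_csInf (essRadii_nonempty S) fun s hs => (div_le_iff₀' hr.1).2 (h1 r hr s hs)
  -- Passing to the infimum over the radii of `L` divides by the semi-norm of `S`, so the case where
  -- it vanishes is separate; any single radius of `L` settles it.
  rcases (essSeminorm_nonneg S).eq_or_lt with h0 | h0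
  · obtain ⟨r, hr⟩ := essRadii_nonempty L
    have := h2 r hr
    rw [← h0, mul_zero] at this ⊢
    exact this
  · rw [← div_le_iff₀ h0]
    exact le_csInf (essRadii_nonempty L) fun r hr => (div_le_iff₀ h0).2 (h2 r hr)

/-- Comparison with a real level removes the extended logarithm, and the value `log 0 = -∞` needs no
separate treatment. -/
theorem log_ofReal_div_lt_iff {N c : ℝ} {t : ℝ≥0} (ht : 0 < t) :
    ENNReal.log (ENNReal.ofReal N) / ((t : ℝ) : EReal) < (c : EReal) ↔ N < Real.exp (c * t) := by
  have ht' : (0 : ℝ) < t := ht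
  rw [EReal.div_lt_iff (by exact_mod_cast ht') (EReal.coe_ne_top _), ← EReal.coe_mul,
    ← Real.log_exp (c * t), ← ENNReal.log_ofReal_of_pos (Real.exp_pos _), ENNReal.log_lt_log_iff,
    ENNReal.ofReal_lt_ofReal_iff (Real.exp_pos _), Real.log_exp]

theorem eventually_mul_exp_lt (M : ℝ) {c' c : ℝ} (h : c' < c) :
    ∀ᶠ t : ℝ≥0 in atTop, M * Real.exp (c' * t) < Real.exp (c * t) := by
  have h1 : Tendsto (fun t : ℝ≥0 => Real.exp ((c - c') * t)) atTop atTop :=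
    Real.tendsto_exp_atTop.comp
      ((NNReal.tendsto_coe_atTop.2 tendsto_id).const_mul_atTop (sub_pos.2 h))
  filter_upwards [h1.eventually_gt_atTop M] with t ht
  calc M * Real.exp (c' * t) < Real.exp ((c - c') * t) * Real.exp (c' * t) := by gcongr
    _ = Real.exp (c * t) := by rw [← Real.exp_add]; ring_nf

/-- Fekete's lemma for submultiplicative functions of a continuous variable. -/
theorem exists_tendsto_log_div {N : ℝ≥0 → ℝ} (h0 : ∀ t, 0 ≤ N t)
    (hmul : ∀ s t, N (s + t) ≤ N s * N t) (hb : ∀ b, ∃ M, ∀ t ≤ b, N t ≤ M) :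
    ∃ ω : EReal, Tendsto
      (fun t : ℝ≥0 => ENNReal.log (ENNReal.ofReal (N t)) / ((t : ℝ) : EReal)) atTop (𝓝 ω) := by
  set f : ℝ≥0 → EReal := fun t => ENNReal.log (ENNReal.ofReal (N t)) / ((t : ℝ) : EReal) with hf
  refine ⟨⨅ t : {t : ℝ≥0 // 0 < t}, f t, tendsto_order.2 ⟨fun a ha => ?_, fun a ha => ?_⟩⟩
  · filter_upwards [eventually_gt_atTop 0] with t ht
    exact ha.trans_le (iInf_le (fun t : {t : ℝ≥0 // 0 < t} => f t) ⟨t, ht⟩)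
  obtain ⟨⟨t₀, ht₀⟩, h1⟩ := iInf_lt_iff.1 ha
  -- Two real levels `c' < c` are placed between the value at `t₀` and `a`. Growth is measured at
  -- rate `c'`, and the gap to `c` absorbs the constant from the remainder interval.
  obtain ⟨c, hc1, hc2⟩ := EReal.lt_iff_exists_real_btwn.1 h1
  obtain ⟨c', hc1', hc2'⟩ := EReal.lt_iff_exists_real_btwn.1 hc1
  have hcc : c' < c := by exact_mod_cast hc2'
  have hN₀ : N t₀ < Real.exp (c' * t₀) := (log_ofReal_div_lt_iff ht₀).1 hc1'
  obtain ⟨M, hM⟩ := hb t₀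
  have hpow : ∀ (n : ℕ) (r : ℝ≥0), N (n • t₀ + r) ≤ Real.exp (c' * t₀) ^ n * N r := by
    intro n r
    induction n with
    | zero => simp
    | succ n ih =>
      have e : (n + 1) • t₀ + r = t₀ + (n • t₀ + r) := by rw [succ_nsmul]; abel
      rw [e, pow_succ, mul_comm (_ ^ n), mul_assoc]
      exact (hmul _ _).trans (mul_le_mul hN₀.le ih (h0 _) (Real.exp_pos _).le)
  filter_upwards [eventually_gt_atTop 0, eventually_mul_exp_lt (Real.exp (|c'| * t₀) * |M|) hcc]
    with t ht hlt
  refine lt_trans ((log_ofReal_div_lt_iff ht).2 (lt_of_le_of_lt ?_ hlt)) hc2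
  have ht₀' : (0 : ℝ) < t₀ := ht₀
  set n : ℕ := ⌊t / t₀⌋₊ with hn
  have hn1 : n • t₀ ≤ t := by
    have := Nat.floor_le (zero_le (a := t / t₀))
    rw [nsmul_eq_mul]
    exact (le_div_iff₀ ht₀).1 this
  have hn2 : t - n • t₀ ≤ t₀ := by
    have := (Nat.lt_floor_add_one (t / t₀)).le
    rw [div_le_iff₀ ht₀] at this
    rw [tsub_le_iff_left, nsmul_eq_mul]
    calc t ≤ _ := this
      _ = _ := by rw [hn]; ring
  have h2 := hpow n (t - n • t₀)
  rw [add_tsub_cancel_of_le hn1] at h2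
  have h3 : ((t - n • t₀ : ℝ≥0) : ℝ) = t - n * t₀ := by
    rw [NNReal.coe_sub hn1, NNReal.coe_nsmul, nsmul_eq_mul]
  -- Replacing `n t₀` by `t` changes the exponent by at most `|c'| t₀`, whatever the sign of `c'`.
  have h4 : Real.exp (c' * t₀) ^ n ≤ Real.exp (|c'| * t₀) * Real.exp (c' * t) := by
    rw [← Real.exp_nat_mul, ← Real.exp_add]
    refine Real.exp_le_exp.2 ?_
    have h5 : (0 : ℝ) ≤ t - n * t₀ := h3 ▸ NNReal.coe_nonneg _
    have h6 : (t : ℝ) - n * t₀ ≤ t₀ := by rw [← h3]; exact_mod_cast hn2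
    nlinarith [neg_abs_le c', abs_nonneg c']
  calc N t ≤ Real.exp (c' * t₀) ^ n * N (t - n • t₀) := h2
    _ ≤ (Real.exp (|c'| * t₀) * Real.exp (c' * t)) * |M| :=
      mul_le_mul h4 ((hM _ hn2).trans (le_abs_self M)) (h0 _) (by positivity)
    _ = _ := by ring

theorem exists_isEssGrowthRate {T : ℝ≥0 → Z →L[ℝ] Z} (hT : ∀ s t, T (s + t) = (T s).comp (T t))
    (hb : ∀ b, ∃ M, ∀ t ≤ b, ‖T t‖ ≤ M) : ∃ ω : EReal, IsEssGrowthRate T ω :=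
  exists_tendsto_log_div (N := fun t => essSeminorm (T t)) (fun _ => essSeminorm_nonneg _)
    (fun s t => by rw [hT]; exact essSeminorm_comp_le _ _)
    fun b => (hb b).imp fun _ hM t ht => (essSeminorm_le_norm _).trans (hM t ht)

theorem IsEssGrowthRate.le_of_le_mul_exp {T : ℝ≥0 → Z →L[ℝ] Z} {ω : EReal}
    (hω : IsEssGrowthRate T ω) {M c : ℝ}
    (h : ∀ t : ℝ≥0, essSeminorm (T t) ≤ M * Real.exp (c * t)) : ω ≤ c := by
  refine le_of_forall_gt_imp_ge_of_dense fun a ha => ?_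
  obtain ⟨c', h1, h2⟩ := EReal.lt_iff_exists_real_btwn.1 ha
  refine le_trans (le_of_tendsto hω ?_) h2.le
  filter_upwards [eventually_gt_atTop 0, eventually_mul_exp_lt M (show c < c' by exact_mod_cast h1)]
    with t ht hlt
  exact ((log_ofReal_div_lt_iff ht).2 ((h t).trans_lt hlt)).le

end Essential

/-! ### Compact perturbations -/

section Duhamel

variable {Z : Type*} [NormedAddCommGroup Z] [NormedSpace ℝ Z]

theorem IsC0Semigroup.generator_orbit {T : ℝ≥0 → Z →L[ℝ] Z} (hT : IsC0Semigroup T) {p : Z × Z}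
    (hp : p ∈ generatorGraph fun t => ⇑(T t)) (s : ℝ≥0) :
    (T s p.1, T s p.2) ∈ generatorGraph fun t => ⇑(T t) := by
  refine (((T s).continuous.tendsto _).comp hp).congr fun t => ?_
  simp only [Function.comp_apply, map_smul, map_sub]
  rw [← ContinuousLinearMap.comp_apply, ← ContinuousLinearMap.comp_apply, ← hT.map_add,
    ← hT.map_add, add_comm]

variable [CompleteSpace Z]

theorem IsC0Semigroup.exists_norm_le {T : ℝ≥0 → Z →L[ℝ] Z} (hT : IsC0Semigroup T) (b : ℝ≥0) :
    ∃ M, ∀ t ≤ b, ‖T t‖ ≤ M := by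
  obtain ⟨M, hM⟩ := banach_steinhaus (g := fun t : Set.Icc 0 b => T t) fun x => by
    obtain ⟨C, hC⟩ := isCompact_Icc.exists_bound_of_continuousOn (s := Set.Icc 0 b)
      (hT.strongly_continuous x).continuousOn
    exact ⟨C, fun t => hC t t.2⟩
  exact ⟨M, fun t ht => hM ⟨t, zero_le, ht⟩⟩

/-- Strong continuity becomes joint continuity because the operators are uniformly bounded for `t`
near `t₀`. -/
theorem IsC0Semigroup.continuous_uncurry {T : ℝ≥0 → Z →L[ℝ] Z} (hT : IsC0Semigroup T) :
    Continuous fun p : ℝ≥0 × Z => T p.1 p.2 := by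
  refine continuous_iff_continuousAt.2 fun ⟨t₀, x₀⟩ => ?_
  obtain ⟨M, hM⟩ := hT.exists_norm_le (t₀ + 1)
  have h1 : Tendsto (fun p : ℝ≥0 × Z => T p.1 (p.2 - x₀)) (𝓝 (t₀, x₀)) (𝓝 0) := by
    have h2 : Tendsto (fun p : ℝ≥0 × Z => M * ‖p.2 - x₀‖) (𝓝 (t₀, x₀)) (𝓝 0) := by
      have : Continuous fun p : ℝ≥0 × Z => M * ‖p.2 - x₀‖ := by fun_prop
      simpa using this.tendsto (t₀, x₀)
    refine squeeze_zero_norm' ?_ h2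
    have h3 : ∀ᶠ p : ℝ≥0 × Z in 𝓝 (t₀, x₀), p.1 < t₀ + 1 :=
      (continuous_fst.tendsto (t₀, x₀)).eventually_lt_const (lt_add_one t₀)
    filter_upwards [h3] with p hp
    exact (T p.1).le_of_opNorm_le (hM _ hp.le) _
  have h4 : Tendsto (fun p : ℝ≥0 × Z => T p.1 x₀) (𝓝 (t₀, x₀)) (𝓝 (T t₀ x₀)) :=
    ((hT.strongly_continuous x₀).comp continuous_fst).tendsto (t₀, x₀)
  have h5 := h1.add h4
  rw [zero_add] at h5
  refine h5.congr fun p => ?_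
  rw [map_sub]; abel

/-- The variation of constants formula for a bounded perturbation `K`. -/
theorem IsC0Semigroup.duhamel {T U : ℝ≥0 → Z →L[ℝ] Z} (hT : IsC0Semigroup T)
    (hU : IsC0Semigroup U) (K : Z →L[ℝ] Z) {p : Z × Z}
    (hp : p ∈ generatorGraph fun t => ⇑(T t))
    (hgen : ∀ q ∈ generatorGraph (fun t => ⇑(T t)),
      (q.1, q.2 - K q.1) ∈ generatorGraph fun t => ⇑(U t)) (t : ℝ≥0) :
    T t p.1 - U t p.1 =
      ∫ s in (0 : ℝ)..t, U ((t : ℝ) - s).toNNReal (K (T s.toNNReal p.1)) := by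
  have hTc : Continuous fun s : ℝ => T s.toNNReal p.1 :=
    (hT.strongly_continuous p.1).comp continuous_real_toNNReal
  have hUc := hU.continuous_uncurry
  have hsub : Continuous fun s : ℝ => ((t : ℝ) - s).toNNReal :=
    continuous_real_toNNReal.comp (by fun_prop)
  have hf : Continuous fun s : ℝ => U ((t : ℝ) - s).toNNReal (T s.toNNReal p.1) :=
    hUc.comp (hsub.prodMk hTc)
  have hf' : Continuous fun s : ℝ => U ((t : ℝ) - s).toNNReal (K (T s.toNNReal p.1)) :=
    hUc.comp (hsub.prodMk (K.continuous.comp hTc))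
  -- Only the right derivative of `s ↦ U(t - s) T(s) x` is computed. From the right, its slope is
  -- `U(t - u)` applied to a difference of two forward quotients at `y = T(s) x`, and these converge
  -- to the two generators, whose difference is `K`.
  have := intervalIntegral.integral_eq_sub_of_hasDeriv_right_of_le (a := 0) (b := (t : ℝ))
    (f := fun s : ℝ => U ((t : ℝ) - s).toNNReal (T s.toNNReal p.1))
    (f' := fun s : ℝ => U ((t : ℝ) - s).toNNReal (K (T s.toNNReal p.1)))
    t.coe_nonneg hf.continuousOn ?_ (hf'.intervalIntegrable _ _)
  · rw [this]
    simp [hT.map_zero, hU.map_zero]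
  intro s hs
  rw [hasDerivWithinAt_iff_tendsto_slope' (by simp)]
  set y := T s.toNNReal p.1 with hy
  have hq := hT.generator_orbit hp s.toNNReal
  have hqU := hgen _ hq
  have h1 : Tendsto (fun h : ℝ≥0 => (h : ℝ)⁻¹ • (T h y - U h y)) (𝓝[>] 0) (𝓝 (K y)) := by
    have := Tendsto.sub hq hqU
    simp only [sub_sub_cancel] at this
    refine this.congr fun h => ?_
    rw [← smul_sub]
    congr 1
    abel
  have h2 : Tendsto (fun u : ℝ => (u - s).toNNReal) (𝓝[>] s) (𝓝[>] 0) := by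
    refine tendsto_nhdsWithin_iff.2 ⟨?_, ?_⟩
    · have : Continuous fun u : ℝ => (u - s).toNNReal :=
        continuous_real_toNNReal.comp (by fun_prop)
      have := this.tendsto s
      rw [sub_self, Real.toNNReal_zero] at this
      exact this.mono_left nhdsWithin_le_nhds
    · filter_upwards [self_mem_nhdsWithin] with u hu
      exact Real.toNNReal_pos.2 (sub_pos.2 hu)
  have h3 : Tendsto (fun u : ℝ => ((t : ℝ) - u).toNNReal) (𝓝[>] s) (𝓝 ((t : ℝ) - s).toNNReal) :=
    (hsub.tendsto s).mono_left nhdsWithin_le_nhds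
  refine ((hUc.tendsto _).comp (h3.prodMk_nhds (h1.comp h2))).congr' ?_
  filter_upwards [self_mem_nhdsWithin, mem_nhdsWithin_of_mem_nhds (Iio_mem_nhds hs.2)] with u hu hut
  have hu' : s < u := hu
  have hut' : u < t := hut
  simp only [Function.comp_apply]
  rw [Real.coe_toNNReal _ (sub_pos.2 hu').le, slope_def_module, map_smul, map_sub]
  congr 2
  · rw [hy, ← ContinuousLinearMap.comp_apply (T _) (T _), ← hT.map_add,
      ← Real.toNNReal_add (sub_pos.2 hu').le hs.1.le, sub_add_cancel]
  · rw [← ContinuousLinearMap.comp_apply, ← hU.map_add,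
      ← Real.toNNReal_add (sub_pos.2 hut').le (sub_pos.2 hu').le, sub_add_sub_cancel]

/-- A compact perturbation of the generator of `U` generates a semigroup whose essential semi-norm is
at most the norm of `U`. -/
theorem essSeminorm_le_of_compact_perturbation {T U : ℝ≥0 → Z →L[ℝ] Z} (hT : IsC0Semigroup T)
    (hU : IsC0Semigroup U) {K : Z →L[ℝ] Z} (hK : IsCompactOperator K)
    (hgen : ∀ q ∈ generatorGraph (fun t => ⇑(T t)),
      (q.1, q.2 - K q.1) ∈ generatorGraph fun t => ⇑(U t))
    (hD : Dense (Prod.fst '' generatorGraph fun t => ⇑(T t))) (t : ℝ≥0) :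
    essSeminorm (T t) ≤ ‖U t‖ := by
  have e : T t = U t + (T t - U t) := by abel
  rw [e]
  refine essSeminorm_add_le _ _ ?_
  rcases eq_or_ne t 0 with rfl | ht
  · refine (Set.finite_singleton (0 : Z)).totallyBounded.subset ?_
    rintro _ ⟨x, -, rfl⟩
    simp [hT.map_zero, hU.map_zero]
  have ht' : (0 : ℝ) < t := NNReal.coe_pos.2 (pos_iff_ne_zero.2 ht)
  obtain ⟨M, hM⟩ := hT.exists_norm_le t
  -- A compact set containing all values of the Duhamel integrand for initial data in the unit ball.
  -- The integral is `t` times an average, hence lies in `t` times the closed convex hull of `Q`.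
  set Q : Set Z := (fun q : ℝ≥0 × Z => U q.1 q.2) ''
    (Set.Icc 0 t ×ˢ closure (K '' Metric.closedBall 0 M)) with hQ
  have hQc : IsCompact Q :=
    (isCompact_Icc.prod (hK.isCompact_closure_image_closedBall M)).image hU.continuous_uncurry
  set R : Set Z := closure (convexHull ℝ Q) with hR
  have hRt : TotallyBounded R := hQc.totallyBounded.convexHull.closure
  set S : Set Z := (fun z => (t : ℝ) • z) '' R with hS
  have hSt : TotallyBounded S := hRt.image (uniformContinuous_const_smul (t : ℝ))
  have hSc : IsClosed S := isClosed_closure.smul_of_ne_zero ht'.ne'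
  have hmem : ∀ p ∈ generatorGraph (fun t => ⇑(T t)), ‖p.1‖ ≤ 1 → (T t - U t) p.1 ∈ S := by
    intro p hp hp1
    have hTc : Continuous fun s : ℝ => T s.toNNReal p.1 :=
      (hT.strongly_continuous p.1).comp continuous_real_toNNReal
    have hsub : Continuous fun s : ℝ => ((t : ℝ) - s).toNNReal :=
      continuous_real_toNNReal.comp (by fun_prop)
    have hf' : Continuous fun s : ℝ => U ((t : ℝ) - s).toNNReal (K (T s.toNNReal p.1)) :=
      hU.continuous_uncurry.comp (hsub.prodMk (K.continuous.comp hTc))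
    refine ⟨⨍ s in (0 : ℝ)..t, U ((t : ℝ) - s).toNNReal (K (T s.toNNReal p.1)), ?_, ?_⟩
    · rw [Set.uIoc_of_le ht'.le]
      refine (convex_convexHull ℝ Q).set_average_mem_closure ?_ ?_ ?_ ?_
      · simpa using ht
      · simp
      · refine (ae_restrict_iff' measurableSet_Ioc).2 (ae_of_all _ fun s hs => ?_)
        refine subset_convexHull ℝ Q ⟨(_, _), ⟨⟨zero_le, ?_⟩, subset_closure ⟨_, ?_, rfl⟩⟩, rfl⟩
        · exact Real.toNNReal_le_iff_le_coe.2 (by linarith [hs.1])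
        · rw [mem_closedBall_zero_iff]
          refine ((T s.toNNReal).le_of_opNorm_le (hM _
            (Real.toNNReal_le_iff_le_coe.2 hs.2)) p.1).trans ?_
          exact mul_le_of_le_one_right ((norm_nonneg _).trans (hM 0 zero_le)) hp1
      · exact hf'.integrableOn_Ioc
    · simp only
      rw [interval_average_eq, sub_zero, smul_inv_smul₀ ht'.ne', sub_apply]
      exact (hT.duhamel hU K hp hgen t).symm
  refine hSt.subset ?_
  rintro _ ⟨x, hx, rfl⟩
  -- Duhamel's formula is available only on the domain of the generator. The open ball is used to
  -- approximate by domain elements of norm below one, and `S` is closed.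
  have hx' : x ∈ closure (Metric.ball (0 : Z) 1 ∩ Prod.fst '' generatorGraph fun t => ⇑(T t)) := by
    rw [← closure_ball _ one_ne_zero] at hx
    exact closure_minimal (hD.open_subset_closure_inter Metric.isOpen_ball) isClosed_closure hx
  have hcl : IsClosed ((T t - U t) ⁻¹' S) := hSc.preimage (T t - U t).continuous
  refine closure_minimal ?_ hcl hx'
  rintro _ ⟨hz, p, hp, rfl⟩
  exact hmem p hp (mem_ball_zero_iff.1 hz).le

end Duhamel

/-! ### Convolution operators on `L¹(ℝ²)` -/

section Convolution

/-- For a contraction semigroup, `‖T(t) z - T(s) z‖ ≤ ‖T(|t - s|) z - z‖`, so continuity at zero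
suffices. The punctured neighbourhood fits a convolution formula valid only for `t > 0`. -/
theorem isC0Semigroup_of_contraction {Z : Type*} [NormedAddCommGroup Z] [NormedSpace ℝ Z]
    {T : ℝ≥0 → Z →L[ℝ] Z} (h0 : T 0 = ContinuousLinearMap.id ℝ Z)
    (hadd : ∀ s t, T (s + t) = (T s).comp (T t)) (hn : ∀ t, ‖T t‖ ≤ 1)
    (hc : ∀ z, Tendsto (fun t => T t z) (𝓝[≠] 0) (𝓝 z)) : IsC0Semigroup T where
  map_zero := h0
  map_add := hadd
  strongly_continuous z := by
    have hle : ∀ s t : ℝ≥0, s ≤ t → ‖T t z - T s z‖ ≤ ‖T (nndist t s) z - z‖ := by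
      intro s t hst
      obtain ⟨r, rfl⟩ := exists_add_of_le hst
      have e : nndist (s + r) s = r := by
        rw [← NNReal.coe_inj, coe_nndist, NNReal.dist_eq, NNReal.coe_add, add_sub_cancel_left,
          abs_of_nonneg r.coe_nonneg]
      rw [hadd, ContinuousLinearMap.comp_apply, ← map_sub, e]
      simpa using (T s).le_of_opNorm_le (hn s) (T r z - z)
    have hc' : Tendsto (fun t => T t z) (𝓝 0) (𝓝 z) := by
      rw [← nhdsNE_sup_pure (0 : ℝ≥0)]
      refine (hc z).sup ?_
      have : T 0 z = z := by rw [h0]; rfl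
      rw [tendsto_pure_left]
      intro s hs
      rw [this]
      exact mem_of_mem_nhds hs
    refine continuous_iff_continuousAt.2 fun t₀ => ?_
    rw [ContinuousAt, tendsto_iff_norm_sub_tendsto_zero]
    have h1 : Tendsto (fun t : ℝ≥0 => nndist t t₀) (𝓝 t₀) (𝓝 0) := by
      have : Continuous fun t : ℝ≥0 => nndist t t₀ := by fun_prop
      simpa using this.tendsto t₀
    refine squeeze_zero (fun _ => norm_nonneg _) (fun t => ?_)
      (tendsto_iff_norm_sub_tendsto_zero.1 (hc'.comp h1))
    rcases le_total t₀ t with h | h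
    · exact hle t₀ t h
    · rw [norm_sub_rev, Function.comp_apply, nndist_comm]; exact hle t t₀ h

theorem norm_toL1_eq_integral {f : Plane → ℝ} (hf : Integrable f) :
    ‖hf.toL1 f‖ = ∫ x, ‖f x‖ := by
  rw [L1.norm_eq_integral_norm]
  refine integral_congr_ae ?_
  filter_upwards [hf.coeFn_toL1] with x hx
  rw [hx]

/-- A bounded continuous integrable convolution kernel. -/
structure IsKernel (κ : Plane → ℝ) : Prop where
  continuous : Continuous κ
  integrable : Integrable κ
  bounded : ∃ c, ∀ x, ‖κ x‖ ≤ c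

variable {κ : Plane → ℝ}

/-- Boundedness of the kernel gives integrability at every `x`, not merely almost every `x`, so
convolution integrals can be manipulated pointwise. -/
theorem IsKernel.integrable_mul (hκ : IsKernel κ) {v : Plane → ℝ} (hv : Integrable v) (x : Plane) :
    Integrable fun z => κ (x - z) * v z := by
  obtain ⟨c, hc⟩ := hκ.bounded
  refine hv.bdd_mul (c := c) ?_ (ae_of_all _ fun z => hc _)
  exact (hκ.continuous.comp (continuous_const.sub continuous_id)).aestronglyMeasurable

theorem integrable_conv (hκ : Integrable κ) {v : Plane → ℝ} (hv : Integrable v) :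
    Integrable fun x => ∫ z, κ (x - z) * v z := by
  refine (hv.integrable_convolution (ContinuousLinearMap.mul ℝ ℝ) hκ).congr
    (ae_of_all _ fun x => ?_)
  simp [convolution, mul_comm]

theorem integral_conv (hκ : Integrable κ) {v : Plane → ℝ} (hv : Integrable v) :
    ∫ x, ∫ z, κ (x - z) * v z = (∫ x, κ x) * ∫ z, v z := by
  have := integral_convolution (μ := (volume : Measure Plane)) (ν := (volume : Measure Plane))
    (ContinuousLinearMap.mul ℝ ℝ) hv hκ
  simp only [convolution, ContinuousLinearMap.mul_apply'] at this
  rw [mul_comm, ← this]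
  simp only [mul_comm]

theorem integral_norm_conv_le (hκ : Integrable κ) {v : Plane → ℝ} (hv : Integrable v) :
    ∫ x, ‖∫ z, κ (x - z) * v z‖ ≤ (∫ x, ‖κ x‖) * ∫ z, ‖v z‖ := by
  rw [← integral_conv hκ.norm hv.norm]
  refine integral_mono_of_nonneg (ae_of_all _ fun _ => norm_nonneg _)
    (integrable_conv hκ.norm hv.norm) (ae_of_all _ fun x => ?_)
  refine (norm_integral_le_integral_norm _).trans_eq ?_
  simp only [norm_mul]

/-- Convolution with `κ` as a bounded operator on `L¹(ℝ²)`. -/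
def convL1 (κ : Plane → ℝ) (hκ : IsKernel κ) : PlaneL1 →L[ℝ] PlaneL1 :=
  LinearMap.mkContinuous
    { toFun := fun v => (integrable_conv hκ.integrable (L1.integrable_coeFn v)).toL1 _
      map_add' := fun v w => by
        rw [← Integrable.toL1_add]
        refine (Integrable.toL1_eq_toL1_iff _ _ _ _).2 (ae_of_all _ fun x => ?_)
        simp only [Pi.add_apply]
        rw [← integral_add (hκ.integrable_mul (L1.integrable_coeFn v) x)
          (hκ.integrable_mul (L1.integrable_coeFn w) x)]
        refine integral_congr_ae ?_
        filter_upwards [Lp.coeFn_add v w] with z hz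
        rw [hz, Pi.add_apply, mul_add]
      map_smul' := fun c v => by
        rw [RingHom.id_apply, ← Integrable.toL1_smul]
        refine (Integrable.toL1_eq_toL1_iff _ _ _ _).2 (ae_of_all _ fun x => ?_)
        simp only [smul_eq_mul]
        rw [← integral_const_mul]
        refine integral_congr_ae ?_
        filter_upwards [Lp.coeFn_smul c v] with z hz
        rw [hz, Pi.smul_apply, smul_eq_mul]
        ring }
    (∫ x, ‖κ x‖) fun v => by
      rw [LinearMap.coe_mk, AddHom.coe_mk, norm_toL1_eq_integral, L1.norm_eq_integral_norm]
      exact integral_norm_conv_le hκ.integrable (L1.integrable_coeFn v)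

theorem convL1_ae (hκ : IsKernel κ) (v : PlaneL1) :
    convL1 κ hκ v =ᵐ[volume] fun x => ∫ z, κ (x - z) * v z :=
  Integrable.coeFn_toL1 (integrable_conv hκ.integrable (L1.integrable_coeFn v))

theorem norm_convL1_le (hκ : IsKernel κ) : ‖convL1 κ hκ‖ ≤ ∫ x, ‖κ x‖ :=
  LinearMap.mkContinuous_norm_le _ (integral_nonneg fun _ => norm_nonneg _) _

/-- Fubini's theorem and a translation of the inner variable. The double integrand is the bounded
kernel `κ₁` times the integrable integrand of `κ₂ * v`. -/
theorem convL1_comp {κ₁ κ₂ κ₃ : Plane → ℝ} (h₁ : IsKernel κ₁) (h₂ : IsKernel κ₂)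
    (h₃ : IsKernel κ₃) (h : ∀ x, ∫ w, κ₁ (x - w) * κ₂ w = κ₃ x) :
    (convL1 κ₁ h₁).comp (convL1 κ₂ h₂) = convL1 κ₃ h₃ := by
  ext1 v
  refine Lp.ext ?_
  rw [ContinuousLinearMap.comp_apply]
  filter_upwards [convL1_ae h₁ (convL1 κ₂ h₂ v), convL1_ae h₃ v] with x h4 h5
  rw [h4, h5]
  have hv := L1.integrable_coeFn v
  obtain ⟨c, hc⟩ := h₁.bounded
  have e1 : ∫ w, κ₁ (x - w) * (convL1 κ₂ h₂ v) w
      = ∫ w, ∫ z, κ₁ (x - w) * (κ₂ (w - z) * v z) := by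
    refine integral_congr_ae ?_
    filter_upwards [convL1_ae h₂ v] with w hw
    rw [hw, integral_const_mul]
  rw [e1, integral_integral_swap]
  · refine integral_congr_ae (ae_of_all _ fun z => ?_)
    simp only
    rw [← h (x - z), ← integral_mul_const,
      ← integral_sub_right_eq_self (fun w => κ₁ (x - z - w) * κ₂ w * v z) z]
    refine integral_congr_ae (ae_of_all _ fun w => ?_)
    simp only [sub_sub_sub_cancel_right]
    ring
  · have h6 := hv.convolution_integrand (μ := (volume : Measure Plane))
      (ContinuousLinearMap.mul ℝ ℝ) h₂.integrable
    have h7 : Integrable (fun p : Plane × Plane => κ₁ (x - p.1) * (v p.2 * κ₂ (p.1 - p.2)))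
        (volume.prod volume) := by
      refine Integrable.bdd_mul (c := c) h6 ?_ (ae_of_all _ fun p => hc _)
      exact (h₁.continuous.comp (continuous_const.sub continuous_fst)).aestronglyMeasurable
    refine h7.congr (ae_of_all _ fun p => ?_)
    simp only [Function.uncurry]
    ring

/-- The modulus of continuity of translations in `L¹(ℝ²)`. -/
theorem continuous_integral_norm_translate_sub (v : PlaneL1) :
    Continuous fun z : Plane => ∫ x, ‖v (x - z) - v x‖ := by
  have h1 : Continuous fun z : Plane => Lp.compMeasurePreserving (fun x : Plane => x - z)
      (measurePreserving_sub_right volume z) v := by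
    let g : Plane → C(Plane, Plane) := fun z => ⟨fun x => x - z, by fun_prop⟩
    have hg : Continuous g := by
      refine ContinuousMap.continuous_of_continuous_uncurry _ ?_
      exact continuous_snd.sub continuous_fst
    exact (continuous_const (y := v)).compMeasurePreservingLp hg
      (fun z => measurePreserving_sub_right volume z) ENNReal.one_ne_top
  refine (h1.sub (continuous_const (y := v))).norm.congr fun z => ?_
  rw [L1.norm_eq_integral_norm]
  refine integral_congr_ae ?_
  filter_upwards [Lp.coeFn_sub (Lp.compMeasurePreserving (fun x : Plane => x - z)
      (measurePreserving_sub_right volume z) v) v,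
    Lp.coeFn_compMeasurePreserving v (measurePreserving_sub_right volume z)] with x hx hx'
  refine (congrArg norm hx).trans ?_
  rw [Pi.sub_apply, hx', Function.comp_apply]

theorem integral_norm_translate_sub_le (v : PlaneL1) (z : Plane) :
    ∫ x, ‖v (x - z) - v x‖ ≤ 2 * ‖v‖ := by
  have hv := L1.integrable_coeFn v
  have h1 : Integrable fun x => v (x - z) := hv.comp_sub_right z
  calc ∫ x, ‖v (x - z) - v x‖ ≤ ∫ x, (‖v (x - z)‖ + ‖v x‖) :=
        integral_mono (h1.sub hv).norm (h1.norm.add hv.norm) fun x => norm_sub_le _ _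
    _ = (∫ x, ‖v (x - z)‖) + ∫ x, ‖v x‖ := integral_add h1.norm hv.norm
    _ = 2 * ‖v‖ := by
        rw [integral_sub_right_eq_self (fun x => ‖v x‖) z, ← L1.norm_eq_integral_norm]; ring

/-- As `κ` has mass one, `κ * v - v` is the `κ`-average of `v(· - z) - v`. Strong continuity of the
heat semigroup is thus reduced to an approximate identity acting on the modulus of translation. -/
theorem norm_convL1_sub_le (hκ : IsKernel κ) (h0 : ∀ x, 0 ≤ κ x) (h1 : ∫ x, κ x = 1)
    (v : PlaneL1) :
    ‖convL1 κ hκ v - v‖ ≤ ∫ z, κ z * ∫ x, ‖v (x - z) - v x‖ := by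
  have hv := L1.integrable_coeFn v
  have i1 : Integrable (fun p : Plane × Plane => κ p.2 * (v (p.1 - p.2) - v p.1))
      (volume.prod volume) := by
    have a1 := hκ.integrable.convolution_integrand (μ := (volume : Measure Plane))
      (ContinuousLinearMap.mul ℝ ℝ) hv
    have a2 := hv.mul_prod hκ.integrable
    refine (a1.sub a2).congr (ae_of_all _ fun p => ?_)
    simp only [Pi.sub_apply, ContinuousLinearMap.mul_apply']
    ring
  have e1 : ∀ᵐ x, ‖(convL1 κ hκ v - v) x‖ ≤ ∫ z, ‖κ z * (v (x - z) - v x)‖ := by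
    filter_upwards [Lp.coeFn_sub (convL1 κ hκ v) v, convL1_ae hκ v] with x hx hx'
    rw [hx, Pi.sub_apply, hx']
    refine le_trans (le_of_eq ?_) (norm_integral_le_integral_norm _)
    congr 1
    have b1 : Integrable fun z => κ z * v (x - z) := by
      have := (hκ.integrable_mul hv x).comp_sub_left x
      simpa using this
    have b2 : ∫ z, κ z * v (x - z) = ∫ z, κ (x - z) * v z := by
      rw [← integral_sub_left_eq_self (fun z => κ (x - z) * v z) volume x]
      simp
    rw [← b2]
    simp only [mul_sub]
    rw [integral_sub b1 (hκ.integrable.mul_const _), integral_mul_const, h1, one_mul]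
  rw [L1.norm_eq_integral_norm]
  refine (integral_mono_ae (L1.integrable_coeFn _).norm i1.norm.integral_prod_left e1).trans ?_
  rw [integral_integral_swap i1.norm]
  refine le_of_eq (integral_congr_ae (ae_of_all _ fun z => ?_))
  simp only [norm_mul, Real.norm_of_nonneg (h0 z)]
  rw [integral_const_mul]

end Convolution

/-! ### Gaussian kernels -/

section Gaussian

/-- The Gaussian probability density `exp(-|x|² / s) / (π s)` on the plane. -/
def gaussKernel (s : ℝ) (x : Plane) : ℝ := (Real.pi * s)⁻¹ * Real.exp (-‖x‖ ^ 2 / s)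

theorem heatKernel_eq_gaussKernel (ε : ℝ) (t : ℝ≥0) :
    heatKernel ε t = gaussKernel (4 * ε ^ 2 * t) := by
  funext x
  rw [heatKernel, gaussKernel, one_div]
  congr 2
  ring

variable {s t : ℝ}

theorem gaussKernel_pos (hs : 0 < s) (x : Plane) : 0 < gaussKernel s x := by
  have := Real.pi_pos
  unfold gaussKernel
  positivity

theorem gaussKernel_le (hs : 0 < s) (x : Plane) : gaussKernel s x ≤ (Real.pi * s)⁻¹ := by
  have := Real.pi_pos
  refine mul_le_of_le_one_right (by positivity) (Real.exp_le_one_iff.2 ?_)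
  rw [neg_div]
  exact neg_nonpos.2 (by positivity)

theorem continuous_gaussKernel (s : ℝ) : Continuous (gaussKernel s) := by
  unfold gaussKernel
  fun_prop

theorem isKernel_gaussKernel (hs : 0 < s) : IsKernel (gaussKernel s) where
  continuous := continuous_gaussKernel s
  integrable := integrable_gaussian_plane _ s hs
  bounded := ⟨(Real.pi * s)⁻¹, fun x => by
    rw [Real.norm_of_nonneg (gaussKernel_pos hs x).le]
    exact gaussKernel_le hs x⟩

theorem integral_gaussKernel (hs : 0 < s) : ∫ x, gaussKernel s x = 1 := by
  have h := GaussianFourier.integral_rexp_neg_mul_sq_norm (V := Plane) (inv_pos.2 hs)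
  have e : ∀ x : Plane, gaussKernel s x = (Real.pi * s)⁻¹ * Real.exp (-s⁻¹ * ‖x‖ ^ 2) := by
    intro x
    rw [gaussKernel]
    congr 2
    field_simp
  simp only [e]
  rw [integral_const_mul, h]
  have := Real.pi_pos
  simp only [finrank_euclideanSpace, Fintype.card_fin, Nat.cast_ofNat, div_inv_eq_mul]
  rw [div_self two_ne_zero, Real.rpow_one, inv_mul_cancel₀ (by positivity)]

theorem integral_norm_gaussKernel (hs : 0 < s) : ∫ x, ‖gaussKernel s x‖ = 1 := by
  rw [← integral_gaussKernel hs]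
  simp only [Real.norm_of_nonneg (gaussKernel_pos hs _).le]

/-- Chapman-Kolmogorov for Gaussian kernels. -/
theorem gaussKernel_conv (hs : 0 < s) (ht : 0 < t) (x : Plane) :
    ∫ w, gaussKernel s (x - w) * gaussKernel t w = gaussKernel (s + t) x := by
  have hpi := Real.pi_pos
  have hst : 0 < s * t / (s + t) := by positivity
  -- Completing the square in `w` around `t x / (s + t)`.
  have key : ∀ w : Plane, gaussKernel s (x - w) * gaussKernel t w
      = gaussKernel (s + t) x * gaussKernel (s * t / (s + t)) (w - (t / (s + t)) • x) := by
    intro w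
    simp only [gaussKernel]
    have e1 : ∀ a b c d : ℝ, a * Real.exp b * (c * Real.exp d) = (a * c) * Real.exp (b + d) := by
      intro a b c d; rw [Real.exp_add]; ring
    rw [e1, e1]
    congr 1
    · field_simp
    · congr 1
      rw [norm_sub_sq_real, norm_sub_sq_real, norm_smul, inner_smul_right, real_inner_comm,
        Real.norm_of_nonneg (by positivity : 0 ≤ t / (s + t))]
      field_simp
      ring
  simp only [key]
  rw [integral_const_mul, integral_sub_right_eq_self (gaussKernel (s * t / (s + t))),
    integral_gaussKernel hst, mul_one]

theorem gaussKernel_smul (hs : 0 < s) (x : Plane) :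
    s * gaussKernel s (√s • x) = gaussKernel 1 x := by
  simp only [gaussKernel, norm_smul, mul_pow, Real.norm_of_nonneg (Real.sqrt_nonneg s),
    Real.sq_sqrt hs.le]
  have : -(s * ‖x‖ ^ 2) / s = -‖x‖ ^ 2 / 1 := by field_simp
  rw [this]
  have := Real.pi_pos
  field_simp

/-- The substitution `z = √s x`, with Jacobian `s` in dimension two, moves the parameter from the
kernel to `φ`, where dominated convergence applies. -/
theorem integral_gaussKernel_mul (hs : 0 < s) (φ : Plane → ℝ) :
    ∫ z, gaussKernel s z * φ z = ∫ x, gaussKernel 1 x * φ (√s • x) := by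
  have h := Measure.integral_comp_smul (volume : Measure Plane)
    (fun z => gaussKernel s z * φ z) √s
  simp only [finrank_euclideanSpace, Fintype.card_fin, Real.sq_sqrt hs.le, smul_eq_mul,
    abs_of_pos (inv_pos.2 hs)] at h
  rw [eq_inv_mul_iff_mul_eq₀ hs.ne'] at h
  rw [← h, ← integral_const_mul]
  refine integral_congr_ae (ae_of_all _ fun x => ?_)
  simp only
  rw [← gaussKernel_smul hs x]
  ring

/-- Gaussian kernels are an approximate identity. -/
theorem tendsto_integral_gaussKernel_mul {φ : Plane → ℝ} (hφ : Continuous φ) {M : ℝ}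
    (hM : ∀ x, ‖φ x‖ ≤ M) :
    Tendsto (fun s : ℝ => ∫ z, gaussKernel s z * φ z) (𝓝[>] 0) (𝓝 (φ 0)) := by
  have h1 : Tendsto (fun s : ℝ => ∫ x, gaussKernel 1 x * φ (√s • x)) (𝓝[>] 0)
      (𝓝 (∫ x, gaussKernel 1 x * φ 0)) := by
    refine tendsto_integral_filter_of_dominated_convergence (fun x => gaussKernel 1 x * M)
      (Eventually.of_forall fun s => ?_) (Eventually.of_forall fun s => ae_of_all _ fun x => ?_)
      ((isKernel_gaussKernel one_pos).integrable.mul_const M) (ae_of_all _ fun x => ?_)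
    · exact ((continuous_gaussKernel 1).mul (hφ.comp (by fun_prop))).aestronglyMeasurable
    · rw [norm_mul, Real.norm_of_nonneg (gaussKernel_pos one_pos x).le]
      exact mul_le_mul_of_nonneg_left (hM _) (gaussKernel_pos one_pos x).le
    · refine Tendsto.const_mul _ ?_
      have : Continuous fun s : ℝ => φ (√s • x) := by fun_prop
      simpa using (this.tendsto 0).mono_left nhdsWithin_le_nhds
  rw [integral_mul_const, integral_gaussKernel one_pos, one_mul] at h1
  refine h1.congr' ?_
  filter_upwards [self_mem_nhdsWithin] with s hs
  exact (integral_gaussKernel_mul hs φ).symm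

theorem hasFDerivAt_gaussKernel (s : ℝ) (x : Plane) :
    HasFDerivAt (gaussKernel s) ((gaussKernel s x * (-2 / s)) • innerSL ℝ x) x := by
  have h1 := (((hasStrictFDerivAt_norm_sq x).hasFDerivAt.const_mul (-s⁻¹)).exp).const_mul
    (Real.pi * s)⁻¹
  have e : (fun y : Plane => (Real.pi * s)⁻¹ * Real.exp (-s⁻¹ * ‖y‖ ^ 2)) = gaussKernel s := by
    funext y
    rw [gaussKernel]
    congr 2
    rw [div_eq_mul_inv]; ring
  rw [e] at h1
  refine h1.congr_fderiv ?_
  rw [← e]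
  ext y
  simp
  ring

/-- Half of the exponent pays for the factor `|x|`, through `|x| exp(-|x|²/(2s)) ≤ √s`; the other
half is a Gaussian of doubled parameter. After integration this is the `t^{-1/2}` smoothing rate. -/
theorem norm_gaussKernel_deriv_le (hs : 0 < s) (x : Plane) :
    ‖(gaussKernel s x * (-2 / s)) • innerSL ℝ x‖ ≤ 4 / √s * gaussKernel (2 * s) x := by
  have hpi := Real.pi_pos
  have hsq : 0 < √s := Real.sqrt_pos.2 hs
  have hss : √s * √s = s := Real.mul_self_sqrt hs.le
  rw [norm_smul, innerSL_apply_norm, norm_mul, Real.norm_of_nonneg (gaussKernel_pos hs x).le,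
    norm_div, norm_neg, Real.norm_of_nonneg hs.le, Real.norm_ofNat]
  simp only [gaussKernel]
  have e1 : Real.exp (-‖x‖ ^ 2 / s)
      = Real.exp (-‖x‖ ^ 2 / (2 * s)) * Real.exp (-‖x‖ ^ 2 / (2 * s)) := by
    rw [← Real.exp_add]; congr 1; field_simp; ring
  have e2 : ‖x‖ * Real.exp (-‖x‖ ^ 2 / (2 * s)) ≤ √s := by
    rw [neg_div, Real.exp_neg, mul_inv_le_iff₀ (Real.exp_pos _)]
    have h1 := Real.add_one_le_exp (‖x‖ ^ 2 / (2 * s))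
    have h2 : ‖x‖ ≤ √s * (‖x‖ ^ 2 / (2 * s) + 1) := by
      have h3 : √s * (‖x‖ ^ 2 / (2 * s) + 1) - ‖x‖
          = ((‖x‖ - √s) ^ 2 + √s ^ 2) / (2 * √s) := by
        have : s = √s ^ 2 := by rw [pow_two, hss]
        rw [this, Real.sqrt_sq hsq.le]
        field_simp
        ring
      have : 0 ≤ ((‖x‖ - √s) ^ 2 + √s ^ 2) / (2 * √s) := by positivity
      linarith
    exact h2.trans (mul_le_mul_of_nonneg_left h1 hsq.le)
  have e3 : 0 < Real.exp (-‖x‖ ^ 2 / (2 * s)) := Real.exp_pos _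
  calc (Real.pi * s)⁻¹ * Real.exp (-‖x‖ ^ 2 / s) * (2 / s) * ‖x‖
      = (Real.pi * s)⁻¹ * (2 / s) * Real.exp (-‖x‖ ^ 2 / (2 * s)) *
        (‖x‖ * Real.exp (-‖x‖ ^ 2 / (2 * s))) := by rw [e1]; ring
    _ ≤ (Real.pi * s)⁻¹ * (2 / s) * Real.exp (-‖x‖ ^ 2 / (2 * s)) * √s := by gcongr
    _ = 4 / √s * ((Real.pi * (2 * s))⁻¹ * Real.exp (-‖x‖ ^ 2 / (2 * s))) := by
        have : s = √s ^ 2 := by rw [pow_two, hss]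
        generalize Real.exp (-‖x‖ ^ 2 / (2 * s)) = E
        rw [this, Real.sqrt_sq hsq.le]
        field_simp
        ring

/-- The `i`-th partial derivative of a Gaussian kernel. -/
def gaussPartial (s : ℝ) (i : Fin 2) (x : Plane) : ℝ := partialD i (gaussKernel s) x

theorem gaussPartial_eq (s : ℝ) (i : Fin 2) (x : Plane) :
    gaussPartial s i x = (gaussKernel s x * (-2 / s)) * x i := by
  rw [gaussPartial, partialD, (hasFDerivAt_gaussKernel s x).fderiv]
  simp [innerSL_apply_apply, EuclideanSpace.inner_single_right]

theorem norm_gaussPartial_le (hs : 0 < s) (i : Fin 2) (x : Plane) :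
    ‖gaussPartial s i x‖ ≤ 4 / √s * gaussKernel (2 * s) x := by
  rw [gaussPartial, partialD, (hasFDerivAt_gaussKernel s x).fderiv]
  refine (ContinuousLinearMap.le_opNorm _ _).trans ?_
  simpa using norm_gaussKernel_deriv_le hs x

theorem isKernel_gaussPartial (hs : 0 < s) (i : Fin 2) : IsKernel (gaussPartial s i) := by
  have hc : Continuous (gaussPartial s i) := by
    have : gaussPartial s i = fun x => (gaussKernel s x * (-2 / s)) * x i :=
      funext fun x => gaussPartial_eq s i x
    rw [this]
    have := continuous_gaussKernel s
    fun_prop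
  have hs2 : 0 < 2 * s := by positivity
  refine ⟨hc, ?_, 4 / √s * (Real.pi * (2 * s))⁻¹, fun x => ?_⟩
  · exact ((isKernel_gaussKernel hs2).integrable.const_mul (4 / √s)).mono' hc.aestronglyMeasurable
      (ae_of_all _ (norm_gaussPartial_le hs i))
  · refine (norm_gaussPartial_le hs i x).trans ?_
    gcongr
    exact gaussKernel_le hs2 x

theorem integral_norm_gaussPartial_le (hs : 0 < s) (i : Fin 2) :
    ∫ x, ‖gaussPartial s i x‖ ≤ 4 / √s := by
  have hs2 : 0 < 2 * s := by positivity
  calc ∫ x, ‖gaussPartial s i x‖ ≤ ∫ x, 4 / √s * gaussKernel (2 * s) x :=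
        integral_mono (isKernel_gaussPartial hs i).integrable.norm
          ((isKernel_gaussKernel hs2).integrable.const_mul _) (norm_gaussPartial_le hs i)
    _ = 4 / √s := by rw [integral_const_mul, integral_gaussKernel hs2, mul_one]

/-- Convolution of an integrable function with a Gaussian kernel is continuously differentiable,
and the derivatives fall on the kernel. -/
theorem contDiff_gaussKernel_conv (hs : 0 < s) {v : Plane → ℝ} (hv : Integrable v) :
    ContDiff ℝ 1 (fun x => ∫ z, gaussKernel s (x - z) * v z) ∧
    ∀ i x, partialD i (fun x => ∫ z, gaussKernel s (x - z) * v z) x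
      = ∫ z, gaussPartial s i (x - z) * v z := by
  set F' : Plane → Plane → Plane →L[ℝ] ℝ :=
    fun x z => v z • ((gaussKernel s (x - z) * (-2 / s)) • innerSL ℝ (x - z)) with hF'
  have hs2 : 0 < 2 * s := by positivity
  have hmeas : ∀ x, AEStronglyMeasurable (F' x) volume := by
    intro x
    refine hv.aestronglyMeasurable.smul (Continuous.aestronglyMeasurable ?_)
    have := continuous_gaussKernel s
    fun_prop
  have hbound : ∀ x z, ‖F' x z‖ ≤ ‖v z‖ * (4 / √s * (Real.pi * (2 * s))⁻¹) := by
    intro x z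
    rw [hF', norm_smul]
    refine mul_le_mul_of_nonneg_left ?_ (norm_nonneg _)
    refine (norm_gaussKernel_deriv_le hs (x - z)).trans ?_
    gcongr
    exact gaussKernel_le hs2 _
  have hbint : Integrable fun z => ‖v z‖ * (4 / √s * (Real.pi * (2 * s))⁻¹) :=
    hv.norm.mul_const _
  have hder : ∀ x, HasFDerivAt (fun x => ∫ z, gaussKernel s (x - z) * v z) (∫ z, F' x z) x := by
    intro x
    refine hasFDerivAt_integral_of_dominated_of_fderiv_le (F' := F') univ_mem
      (Eventually.of_forall fun x =>
        ((isKernel_gaussKernel hs).integrable_mul hv x).aestronglyMeasurable)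
      ((isKernel_gaussKernel hs).integrable_mul hv x) (hmeas x)
      (ae_of_all _ fun z x _ => hbound x z) hbint (ae_of_all _ fun z x _ => ?_)
    have h1 : HasFDerivAt (fun x => gaussKernel s (x - z))
        ((gaussKernel s (x - z) * (-2 / s)) • innerSL ℝ (x - z)) x := by
      have := (hasFDerivAt_gaussKernel s (x - z)).comp x ((hasFDerivAt_id x).sub_const z)
      rwa [ContinuousLinearMap.comp_id] at this
    exact h1.mul_const (v z)
  refine ⟨contDiff_one_iff_hasFDerivAt.2 ⟨_, ?_, hder⟩, fun i x => ?_⟩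
  · refine continuous_of_dominated hmeas (fun x => ae_of_all _ (hbound x)) hbint
      (ae_of_all _ fun z => ?_)
    have := continuous_gaussKernel s
    fun_prop
  · rw [partialD, (hder x).fderiv,
      ContinuousLinearMap.integral_apply (hbint.mono' (hmeas x) (ae_of_all _ (hbound x)))]
    refine integral_congr_ae (ae_of_all _ fun z => ?_)
    simp only [hF']
    rw [gaussPartial_eq]
    simp [innerSL_apply_apply, EuclideanSpace.inner_single_right]
    ring

end Gaussian

/-! ### The heat semigroup -/

section Heat

variable {ε : ℝ}

theorem heat_variance_pos (hε : 0 < ε) {t : ℝ≥0} (ht : 0 < t) : 0 < 4 * ε ^ 2 * (t : ℝ) := by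
  have : (0 : ℝ) < t := ht
  positivity

/-- The heat semigroup as a family of bounded operators. -/
def heatCLM (ε : ℝ) (t : ℝ≥0) : PlaneL1 →L[ℝ] PlaneL1 :=
  if h : 0 < 4 * ε ^ 2 * (t : ℝ) then convL1 _ (isKernel_gaussKernel h)
  else ContinuousLinearMap.id ℝ _

theorem heatCLM_zero : heatCLM ε 0 = ContinuousLinearMap.id ℝ _ := by
  simp [heatCLM]

theorem heatCLM_of_pos (hε : 0 < ε) {t : ℝ≥0} (ht : 0 < t) :
    heatCLM ε t = convL1 _ (isKernel_gaussKernel (heat_variance_pos hε ht)) := by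
  rw [heatCLM, dif_pos (heat_variance_pos hε ht)]

theorem coe_heatCLM (hε : 0 < ε) (t : ℝ≥0) : ⇑(heatCLM ε t) = heatSemigroup ε t := by
  funext v
  rcases eq_or_ne t 0 with rfl | ht
  · simp [heatCLM_zero, heatSemigroup]
  · rw [heatCLM_of_pos hε (pos_iff_ne_zero.2 ht), heatSemigroup, if_neg ht]
    refine Lp.ext ((convL1_ae _ v).trans ((integrable_heatConv ε t v).coeFn_toL1.trans ?_).symm)
    rw [heatKernel_eq_gaussKernel]

theorem norm_heatCLM_le (hε : 0 < ε) (t : ℝ≥0) : ‖heatCLM ε t‖ ≤ 1 := by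
  rcases eq_or_ne t 0 with rfl | ht
  · rw [heatCLM_zero]; exact ContinuousLinearMap.norm_id_le
  · rw [heatCLM_of_pos hε (pos_iff_ne_zero.2 ht)]
    exact (norm_convL1_le _).trans_eq
      (integral_norm_gaussKernel (heat_variance_pos hε (pos_iff_ne_zero.2 ht)))

theorem isC0Semigroup_heatCLM (hε : 0 < ε) : IsC0Semigroup (heatCLM ε) := by
  refine isC0Semigroup_of_contraction heatCLM_zero (fun s t => ?_) (norm_heatCLM_le hε)
    fun v => ?_
  · rcases eq_or_ne s 0 with rfl | hs
    · rw [zero_add, heatCLM_zero, ContinuousLinearMap.id_comp]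
    rcases eq_or_ne t 0 with rfl | ht
    · rw [add_zero, heatCLM_zero, ContinuousLinearMap.comp_id]
    have hs' := pos_iff_ne_zero.2 hs
    have ht' := pos_iff_ne_zero.2 ht
    rw [heatCLM_of_pos hε hs', heatCLM_of_pos hε ht', heatCLM_of_pos hε (add_pos hs' ht')]
    refine (convL1_comp _ _ _ fun x => ?_).symm
    rw [gaussKernel_conv (heat_variance_pos hε hs') (heat_variance_pos hε ht'), NNReal.coe_add,
      mul_add]
  · rw [tendsto_iff_norm_sub_tendsto_zero]
    have h1 := tendsto_integral_gaussKernel_mul (continuous_integral_norm_translate_sub v)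
      (M := 2 * ‖v‖) (fun z => by
        rw [Real.norm_of_nonneg (integral_nonneg fun _ => norm_nonneg _)]
        exact integral_norm_translate_sub_le v z)
    simp only [sub_zero, sub_self, norm_zero, integral_zero] at h1
    have h2 : Tendsto (fun t : ℝ≥0 => 4 * ε ^ 2 * (t : ℝ)) (𝓝[≠] 0) (𝓝[>] 0) := by
      refine tendsto_nhdsWithin_iff.2 ⟨?_, ?_⟩
      · have : Continuous fun t : ℝ≥0 => 4 * ε ^ 2 * (t : ℝ) := by fun_prop
        simpa using (this.tendsto 0).mono_left nhdsWithin_le_nhds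
      · filter_upwards [self_mem_nhdsWithin] with t ht
        exact heat_variance_pos hε (pos_iff_ne_zero.2 ht)
    refine squeeze_zero' (Eventually.of_forall fun _ => norm_nonneg _) ?_ (h1.comp h2)
    filter_upwards [self_mem_nhdsWithin] with t ht
    have ht' : 0 < t := pos_iff_ne_zero.2 ht
    rw [heatCLM_of_pos hε ht']
    exact norm_convL1_sub_le _ (fun x => (gaussKernel_pos (heat_variance_pos hε ht') x).le)
      (integral_gaussKernel (heat_variance_pos hε ht')) v

theorem diffusionGraph_eq (hε : 0 < ε) :
    diffusionGraph ε = generatorGraph fun t => ⇑(heatCLM ε t) := by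
  simp only [diffusionGraph, coe_heatCLM hε]

/-- The smoothing effect of the heat semigroup: `T(t) v` is represented by a `C¹` function with
integrable partial derivatives of size `t^{-1/2}`. -/
theorem exists_contDiff_heatCLM (hε : 0 < ε) {t : ℝ≥0} (ht : 0 < t) (v : PlaneL1) :
    ∃ f : Plane → ℝ, ContDiff ℝ 1 f ∧ heatCLM ε t v =ᵐ[volume] f ∧ Integrable f ∧
      (∫ x, ‖f x‖ ≤ ‖v‖) ∧ ∀ i, Integrable (partialD i f) ∧
        ∫ x, ‖partialD i f x‖ ≤ 2 / ε * (t : ℝ) ^ ((1 / 2 : ℝ) - 1) * ‖v‖ := by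
  have hs := heat_variance_pos hε ht
  have hv := L1.integrable_coeFn v
  obtain ⟨h1, h2⟩ := contDiff_gaussKernel_conv hs hv
  have h2' : ∀ i, partialD i (fun x => ∫ z, gaussKernel (4 * ε ^ 2 * t) (x - z) * v z)
      = fun x => ∫ z, gaussPartial (4 * ε ^ 2 * t) i (x - z) * v z := fun i => funext (h2 i)
  refine ⟨_, h1, ?_, integrable_conv (isKernel_gaussKernel hs).integrable hv, ?_, fun i => ?_⟩
  · rw [heatCLM_of_pos hε ht]
    exact convL1_ae _ v
  · refine (integral_norm_conv_le (isKernel_gaussKernel hs).integrable hv).trans_eq ?_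
    rw [integral_norm_gaussKernel hs, one_mul, L1.norm_eq_integral_norm]
  · rw [h2']
    refine ⟨integrable_conv (isKernel_gaussPartial hs i).integrable hv, ?_⟩
    refine (integral_norm_conv_le (isKernel_gaussPartial hs i).integrable hv).trans ?_
    rw [← L1.norm_eq_integral_norm]
    refine mul_le_mul_of_nonneg_right ?_ (norm_nonneg _)
    refine (integral_norm_gaussPartial_le hs i).trans_eq ?_
    have ht' : (0 : ℝ) < t := ht
    have e1 : √(4 * ε ^ 2 * (t : ℝ)) = 2 * ε * √t := by
      rw [show 4 * ε ^ 2 * (t : ℝ) = (2 * ε) ^ 2 * t by ring, Real.sqrt_mul (by positivity),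
        Real.sqrt_sq (by positivity)]
    have e2 : (t : ℝ) ^ ((1 / 2 : ℝ) - 1) = (√t)⁻¹ := by
      rw [Real.sqrt_eq_rpow, ← Real.rpow_neg ht'.le]
      norm_num
    rw [e1, e2]
    have := Real.sqrt_pos.2 ht'
    field_simp
    ring

end Heat

/-! ### The convection operator on smooth functions -/

section Divergence

theorem partialD_smul {V : Type*} [NormedAddCommGroup V] [NormedSpace ℝ V] {f : Plane → ℝ}
    {F : Plane → V} {x : Plane} (hf : DifferentiableAt ℝ f x) (hF : DifferentiableAt ℝ F x)
    (i : Fin 2) :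
    partialD i (fun z => f z • F z) x = f x • partialD i F x + partialD i f x • F x := by
  simp only [partialD]
  rw [fderiv_fun_smul hf hF]
  simp

theorem divergence_smul {f : Plane → ℝ} {F : Plane → Plane} {x : Plane}
    (hf : DifferentiableAt ℝ f x) (hF : DifferentiableAt ℝ F x) :
    divergence (fun z => f z • F z) x = f x * divergence F x + ∑ i, partialD i f x * F x i := by
  simp only [divergence, partialD_smul hf hF, PiLp.add_apply, PiLp.smul_apply, smul_eq_mul,
    Finset.sum_add_distrib, Finset.mul_sum]

theorem divergence_add {F G : Plane → Plane} {x : Plane} (hF : DifferentiableAt ℝ F x)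
    (hG : DifferentiableAt ℝ G x) :
    divergence (fun z => F z + G z) x = divergence F x + divergence G x := by
  simp only [divergence, partialD]
  rw [fderiv_fun_add hF hG, ← Finset.sum_add_distrib]
  simp

theorem divergence_const_smul {F : Plane → Plane} {x : Plane} (c : ℝ)
    (hF : DifferentiableAt ℝ F x) :
    divergence (fun z => c • F z) x = c * divergence F x := by
  simp only [divergence, partialD]
  rw [fderiv_fun_const_smul hF, Finset.mul_sum]
  simp

theorem partialD_apply {F : Plane → Plane} {x : Plane} (hF : DifferentiableAt ℝ F x) (i : Fin 2) :
    partialD i F x i = partialD i (fun z => F z i) x := by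
  have h := ((EuclideanSpace.proj (𝕜 := ℝ) i : Plane →L[ℝ] ℝ).hasFDerivAt).comp x hF.hasFDerivAt
  have h' : HasFDerivAt (fun z => F z i)
    ((EuclideanSpace.proj (𝕜 := ℝ) i : Plane →L[ℝ] ℝ).comp (fderiv ℝ F x)) x := h
  rw [partialD, partialD, h'.fderiv]
  rfl

theorem continuous_partialD {V : Type*} [NormedAddCommGroup V] [NormedSpace ℝ V] {F : Plane → V}
    (hF : ContDiff ℝ 1 F) (i : Fin 2) : Continuous (partialD i F) :=
  (hF.continuous_fderiv one_ne_zero).clm_apply continuous_const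

theorem continuous_divergence {F : Plane → Plane} (hF : ContDiff ℝ 1 F) :
    Continuous (divergence F) := by
  have := continuous_partialD hF
  unfold divergence
  fun_prop

theorem hasCompactSupport_partialD {V : Type*} [NormedAddCommGroup V] [NormedSpace ℝ V]
    {F : Plane → V} (hF : HasCompactSupport F) (i : Fin 2) : HasCompactSupport (partialD i F) :=
  hF.fderiv_apply ℝ _

theorem hasCompactSupport_divergence {F : Plane → Plane} (hF : HasCompactSupport F) :
    HasCompactSupport (divergence F) := by
  refine (hF.fderiv ℝ).comp_left (g := fun L : Plane →L[ℝ] Plane =>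
    ∑ i : Fin 2, L (EuclideanSpace.single i 1) i) ?_
  simp

theorem integral_partialD_eq_zero {g : Plane → ℝ} (hg : ContDiff ℝ 1 g) (hs : HasCompactSupport g)
    (i : Fin 2) : ∫ x, partialD i g x = 0 := by
  have h1 : Integrable (partialD i g) :=
    (continuous_partialD hg i).integrable_of_hasCompactSupport (hasCompactSupport_partialD hs i)
  have h2 : Integrable g := hg.continuous.integrable_of_hasCompactSupport hs
  have := integral_mul_fderiv_eq_neg_fderiv_mul_of_integrable (μ := (volume : Measure Plane))
    (f := fun _ : Plane => (1 : ℝ)) (g := g) (v := EuclideanSpace.single i 1)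
    (by simp) (by simpa only [one_mul] using! h1) (by simpa using h2)
    (fun _ _ => differentiableAt_const _) fun x _ => hg.differentiable one_ne_zero x
  simpa [partialD] using this

theorem integral_divergence_eq_zero {F : Plane → Plane} (hF : ContDiff ℝ 1 F)
    (hs : HasCompactSupport F) : ∫ x, divergence F x = 0 := by
  simp only [divergence]
  have hFi : ∀ i : Fin 2, ContDiff ℝ 1 fun z => F z i := fun i =>
    (EuclideanSpace.proj (𝕜 := ℝ) i : Plane →L[ℝ] ℝ).contDiff.comp hF
  have hsi : ∀ i : Fin 2, HasCompactSupport fun z => F z i := fun i =>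
    hs.comp_left (g := fun y : Plane => y i) rfl
  simp only [partialD_apply (hF.differentiable one_ne_zero _)]
  rw [integral_finsetSum _ fun i _ =>
    (continuous_partialD (hFi i) i).integrable_of_hasCompactSupport
    (hasCompactSupport_partialD (hsi i) i)]
  exact Finset.sum_eq_zero fun i _ => integral_partialD_eq_zero (hFi i) (hsi i) i

end Divergence

/-! ### The convection operator as a closed linear relation. -/

section Convection

variable {C : Plane → Plane}

theorem IsAdmissibleVelocity.exists_bounds (hC : IsAdmissibleVelocity C) :
    ∃ M : ℝ, 0 ≤ M ∧ (∀ x i, ‖C x i‖ ≤ M) ∧ ∀ x, ‖divergence C x‖ ≤ M := by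
  obtain ⟨M, hM⟩ := hC.bounded
  choose N hN using hC.partial_bounded
  have hM0 : 0 ≤ M := (norm_nonneg _).trans (hM 0)
  have hN0 : ∀ i, 0 ≤ N i := fun i => (norm_nonneg _).trans (hN i 0)
  refine ⟨M + ∑ i, N i, add_nonneg hM0 (Finset.sum_nonneg fun i _ => hN0 i), fun x i => ?_,
    fun x => ?_⟩
  · have := (PiLp.norm_apply_le (C x) i).trans (hM x)
    have := Finset.sum_nonneg fun i (_ : i ∈ Finset.univ) => hN0 i
    linarith
  · have : ‖divergence C x‖ ≤ ∑ i, N i :=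
      norm_sum_le_of_le _ fun i _ => (PiLp.norm_apply_le _ i).trans (hN i x)
    linarith

/-- The graph of `φ ↦ -∇·(φ C)` on the compactly supported `C¹` functions. -/
def convectionCore (C : Plane → Plane) (hC : ContDiff ℝ 1 C) :
    Submodule ℝ (PlaneL1 × PlaneL1) where
  carrier := {p | ∃ φ : Plane → ℝ, ContDiff ℝ 1 φ ∧ HasCompactSupport φ ∧
    p.1 =ᵐ[volume] φ ∧ p.2 =ᵐ[volume] fun x => -divergence (fun z => φ z • C z) x}
  add_mem' := by
    rintro p q ⟨φ, h1, h2, h3, h4⟩ ⟨ψ, k1, k2, k3, k4⟩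
    refine ⟨φ + ψ, h1.add k1, h2.add k2, (Lp.coeFn_add _ _).trans (h3.add k3),
      (Lp.coeFn_add _ _).trans ((h4.add k4).trans (ae_of_all _ fun x => ?_))⟩
    have e1 := h1.differentiable one_ne_zero x
    have e2 := k1.differentiable one_ne_zero x
    have e3 := hC.differentiable one_ne_zero x
    simp only [Pi.add_apply, add_smul]
    rw [divergence_add (e1.fun_smul e3) (e2.fun_smul e3), neg_add]
  zero_mem' := by
    refine ⟨0, contDiff_const, HasCompactSupport.zero, Lp.coeFn_zero _ _ _, ?_⟩
    refine (Lp.coeFn_zero _ _ _).trans (ae_of_all _ fun x => ?_)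
    simp [divergence, partialD]
  smul_mem' := by
    rintro c p ⟨φ, h1, h2, h3, h4⟩
    refine ⟨c • φ, h1.const_smul c, h2.smul_left (f := fun _ => c), (Lp.coeFn_smul _ _).trans
      (h3.const_smul c), (Lp.coeFn_smul _ _).trans ((h4.const_smul c).trans
      (ae_of_all _ fun x => ?_))⟩
    have e1 := h1.differentiable one_ne_zero x
    have e3 := hC.differentiable one_ne_zero x
    simp only [Pi.smul_apply, smul_assoc c]
    rw [divergence_const_smul c (e1.fun_smul e3), smul_neg, smul_eq_mul]

/-- The convection operator as a closed linear relation. -/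
def convectionSubmodule (C : Plane → Plane) (hC : ContDiff ℝ 1 C) :
    Submodule ℝ (PlaneL1 × PlaneL1) :=
  (convectionCore C hC).topologicalClosure

theorem coe_convectionSubmodule (hC : ContDiff ℝ 1 C) :
    (convectionSubmodule C hC : Set (PlaneL1 × PlaneL1)) = convectionGraph C :=
  Submodule.topologicalClosure_coe _

/-! ### Dissipativity of the convection operator -/

/-- Multiply `l φ + ∇·(φ C)` by the regularized sign `φ / q`, where `q = √(φ² + δ²)`. With `j = q -
δ` one has `∇j = (φ / q) ∇φ`, so `(φ / q) ∇·(φ C)` differs from `∇·(j C)` by `(j - φ²/q) ∇·C`, which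
is of size `δ |∇·C|`. The divergence of `j C` integrates to zero, and `δ → 0`. -/
theorem mul_integral_norm_le_of_hasCompactSupport (hC : IsAdmissibleVelocity C) {φ : Plane → ℝ}
    (hφ : ContDiff ℝ 1 φ) (hs : HasCompactSupport φ) {l : ℝ} (hl : 0 < l) :
    l * ∫ x, ‖φ x‖ ≤ ∫ x, ‖l * φ x + divergence (fun z => φ z • C z) x‖ := by
  obtain ⟨M, hM0, -, hM⟩ := hC.exists_bounds
  set V : ℝ := (volume : Measure Plane).real (tsupport φ) with hV
  have hdφ : ContDiff ℝ 1 fun z => φ z • C z := hφ.smul hC.contDiff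
  have hsφ : HasCompactSupport fun z => φ z • C z := hs.smul_right
  have hint : Integrable fun x => l * φ x + divergence (fun z => φ z • C z) x :=
    ((hφ.continuous.integrable_of_hasCompactSupport hs).const_mul l).add
      ((continuous_divergence hdφ).integrable_of_hasCompactSupport
        (hasCompactSupport_divergence hsφ))
  suffices H : ∀ δ > (0 : ℝ), l * ∫ x, ‖φ x‖ ≤
      (∫ x, ‖l * φ x + divergence (fun z => φ z • C z) x‖) + δ * ((l + M) * V) by
    have h1 : Tendsto (fun δ : ℝ => (∫ x, ‖l * φ x + divergence (fun z => φ z • C z) x‖) +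
        δ * ((l + M) * V)) (𝓝[>] 0)
        (𝓝 ((∫ x, ‖l * φ x + divergence (fun z => φ z • C z) x‖) + 0 * ((l + M) * V))) := by
      have : Continuous fun δ : ℝ => (∫ x, ‖l * φ x + divergence (fun z => φ z • C z) x‖) +
        δ * ((l + M) * V) := by fun_prop
      exact (this.tendsto 0).mono_left nhdsWithin_le_nhds
    rw [zero_mul, add_zero] at h1
    refine ge_of_tendsto h1 ?_
    filter_upwards [self_mem_nhdsWithin] with δ hδ
    exact H δ hδ
  intro δ hδ
  set q : Plane → ℝ := fun x => √(φ x ^ 2 + δ ^ 2) with hq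
  have hq0 : ∀ x, 0 < q x := fun x => Real.sqrt_pos.2 (by positivity)
  have hqq : ∀ x, q x * q x = φ x ^ 2 + δ ^ 2 := fun x => Real.mul_self_sqrt (by positivity)
  have hqφ : ∀ x, |φ x| ≤ q x := fun x => Real.abs_le_sqrt (by nlinarith)
  have hqδ : ∀ x, δ ≤ q x := fun x => Real.le_sqrt_of_sq_le (by nlinarith [sq_nonneg (φ x)])
  -- Subtracting `δ` makes `j` vanish where `φ` does, hence compactly supported.
  set j : Plane → ℝ := fun x => q x - δ with hj
  have hjd : ContDiff ℝ 1 j :=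
    (((hφ.pow 2).add contDiff_const).sqrt fun x => by positivity).sub contDiff_const
  have hjs : HasCompactSupport j := by
    refine hs.comp_left (g := fun r => √(r ^ 2 + δ ^ 2) - δ) ?_
    simp [Real.sqrt_sq hδ.le]
  have hjp : ∀ i x, partialD i j x = φ x / q x * partialD i φ x := by
    intro i x
    have h1 := (hφ.differentiable one_ne_zero x).hasFDerivAt
    have h2 := (((h1.pow 2).add_const (δ ^ 2)).sqrt (by positivity)).sub_const δ
    have h3 : HasFDerivAt j _ x := h2
    rw [partialD, h3.fderiv, partialD]
    simp only [smul_apply, smul_eq_mul]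
    have := (hq0 x).ne'
    simp only [hq] at this ⊢
    field_simp
    simp
  have hdj : ContDiff ℝ 1 fun z => j z • C z := hjd.smul hC.contDiff
  have hsj : HasCompactSupport fun z => j z • C z := hjs.smul_right
  have hjint : Integrable (divergence fun z => j z • C z) :=
    (continuous_divergence hdj).integrable_of_hasCompactSupport (hasCompactSupport_divergence hsj)
  have hKc : IsCompact (tsupport φ) := hs
  have hKm : MeasurableSet (tsupport φ) := (isClosed_tsupport φ).measurableSet
  -- The error has two parts, both confined to the support of `φ`: `δ M` from the term with `∇·C`,
  -- and `l δ` from replacing `|φ|` by `φ² / q`.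
  set k : Plane → ℝ := (tsupport φ).indicator fun _ => δ * (l + M) with hk
  have hkint : Integrable k :=
    (integrable_indicator_iff hKm).2 (integrableOn_const hKc.measure_lt_top.ne)
  have hkI : ∫ x, k x = δ * ((l + M) * V) := by
    rw [hk, integral_indicator hKm, setIntegral_const, smul_eq_mul, ← hV]; ring
  have key : ∀ x, l * ‖φ x‖ + divergence (fun z => j z • C z) x ≤
      ‖l * φ x + divergence (fun z => φ z • C z) x‖ + k x := by
    intro x
    have eC := hC.contDiff.differentiable one_ne_zero x
    have e1 := divergence_smul (hφ.differentiable one_ne_zero x) eC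
    have e2 := divergence_smul (hjd.differentiable one_ne_zero x) eC
    have e3 : ∑ i, partialD i j x * C x i = φ x / q x * ∑ i, partialD i φ x * C x i := by
      rw [Finset.mul_sum]
      exact Finset.sum_congr rfl fun i _ => by rw [hjp]; ring
    set D := divergence (fun z => φ z • C z) x with hD
    rw [e2, e3]
    have e4 : φ x / q x * ∑ i, partialD i φ x * C x i
        = φ x / q x * D - φ x / q x * φ x * divergence C x := by rw [e1]; ring
    rw [e4]
    have hq' := hq0 x
    have e5 : φ x / q x * φ x = q x - δ ^ 2 / q x := by
      rw [div_mul_eq_mul_div, eq_sub_iff_add_eq, ← add_div, div_eq_iff hq'.ne', hqq]; ring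
    have e6 : φ x / q x * (l * φ x + D) ≤ ‖l * φ x + D‖ := by
      refine (le_abs_self _).trans ?_
      rw [abs_mul, Real.norm_eq_abs]
      refine mul_le_of_le_one_left (abs_nonneg _) ?_
      rw [abs_div, abs_of_pos hq', div_le_one hq']
      exact hqφ x
    by_cases hx : x ∈ tsupport φ
    · have hkx : k x = δ * (l + M) := Set.indicator_of_mem hx _
      have e7 : 0 ≤ δ ^ 2 / q x := by positivity
      have e8 : δ ^ 2 / q x ≤ δ := by
        rw [div_le_iff₀ hq']; nlinarith [hqδ x]
      have e9 := hM x
      rw [Real.norm_eq_abs] at e9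
      have e10 : (j x - φ x / q x * φ x) * divergence C x ≤ δ * M := by
        refine (le_abs_self _).trans ?_
        rw [abs_mul]
        refine mul_le_mul ?_ e9 (abs_nonneg _) hδ.le
        rw [e5, abs_le]
        simp only [hj]
        constructor <;> linarith
      have e11 : l * ‖φ x‖ ≤ l * (φ x / q x * φ x) + l * δ := by
        rw [← mul_add]
        refine mul_le_mul_of_nonneg_left ?_ hl.le
        rw [e5, Real.norm_eq_abs]
        linarith [hqφ x]
      rw [hkx]
      nlinarith
    · have hkx : k x = 0 := Set.indicator_of_notMem hx _
      have hφ0 : φ x = 0 := image_eq_zero_of_notMem_tsupport hx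
      have hj0 : j x = 0 := by simp [hj, hq, hφ0, Real.sqrt_sq hδ.le]
      rw [hkx, hj0, hφ0]
      simp
  have hφn : Integrable fun x => ‖φ x‖ := (hφ.continuous.integrable_of_hasCompactSupport hs).norm
  calc l * ∫ x, ‖φ x‖
      = ∫ x, (l * ‖φ x‖ + divergence (fun z => j z • C z) x) := by
        rw [integral_add (hφn.const_mul l) hjint, integral_divergence_eq_zero hdj hsj,
          integral_const_mul, add_zero]
    _ ≤ ∫ x, (‖l * φ x + divergence (fun z => φ z • C z) x‖ + k x) :=
        integral_mono ((hφn.const_mul l).add hjint) (hint.norm.add hkint) key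
    _ = _ := by rw [integral_add hint.norm hkint, hkI]

theorem dissipative_convection (hC : IsAdmissibleVelocity C) {p : PlaneL1 × PlaneL1}
    (hp : p ∈ convectionSubmodule C hC.contDiff) {l : ℝ} (hl : 0 < l) :
    l * ‖p.1‖ ≤ ‖l • p.1 - p.2‖ := by
  have hcl : IsClosed {p : PlaneL1 × PlaneL1 | l * ‖p.1‖ ≤ ‖l • p.1 - p.2‖} :=
    isClosed_le (by fun_prop) (by fun_prop)
  have hp' : p ∈ closure (convectionCore C hC.contDiff : Set (PlaneL1 × PlaneL1)) := hp
  refine closure_minimal ?_ hcl hp'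
  rintro ⟨v, w⟩ ⟨φ, h1, h2, h3, h4⟩
  have := mul_integral_norm_le_of_hasCompactSupport hC h1 h2 hl
  rw [Set.mem_ofPred_eq, L1.norm_eq_integral_norm, L1.norm_eq_integral_norm]
  refine le_trans (le_of_eq ?_) (this.trans (le_of_eq ?_))
  · congr 1
    refine integral_congr_ae ?_
    filter_upwards [h3] with x hx
    rw [hx]
  · refine integral_congr_ae ?_
    filter_upwards [h3, h4, Lp.coeFn_sub (l • v) w, Lp.coeFn_smul l v] with x e1 e2 e3 e4
    rw [e3, Pi.sub_apply, e4, Pi.smul_apply, e1, e2, smul_eq_mul, sub_neg_eq_add]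

end Convection

/-! ### The convection operator on integrable `C¹` functions -/

section Cutoff

theorem tendsto_toL1_of_dominated {F : ℕ → Plane → ℝ} {f g : Plane → ℝ}
    (hF : ∀ n, Integrable (F n)) (hf : Integrable f) (hg : Integrable g)
    (hb : ∀ n x, ‖F n x‖ ≤ g x) (h : ∀ x, Tendsto (fun n => F n x) atTop (𝓝 (f x))) :
    Tendsto (fun n => (hF n).toL1 (F n)) atTop (𝓝 (hf.toL1 f)) := by
  rw [tendsto_iff_norm_sub_tendsto_zero]
  have e : ∀ n, ‖(hF n).toL1 (F n) - hf.toL1 f‖ = ∫ x, ‖F n x - f x‖ := fun n => by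
    rw [← Integrable.toL1_sub, norm_toL1_eq_integral]
    rfl
  simp only [e]
  have := tendsto_integral_of_dominated_convergence (μ := volume)
    (F := fun n x => ‖F n x - f x‖) (f := fun _ => 0)
    (fun x => g x + ‖f x‖) (fun n => ((hF n).sub hf).norm.aestronglyMeasurable) (hg.add hf.norm)
    (fun n => ae_of_all _ fun x => ?_) (ae_of_all _ fun x => ?_)
  · simpa using this
  · rw [norm_norm]
    exact (norm_sub_le _ _).trans (by gcongr; exact hb n x)
  · simpa using ((h x).sub_const (f x)).norm

/-- A smooth cutoff function with values in `[0, 1]`, equal to one on the unit ball. -/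
def cutoff : ContDiffBump (0 : Plane) := ⟨1, 2, one_pos, one_lt_two⟩

/-- The dilated cutoff functions. -/
def cutoffSeq (n : ℕ) (x : Plane) : ℝ := cutoff ((n + 1 : ℝ)⁻¹ • x)

theorem contDiff_cutoffSeq (n : ℕ) : ContDiff ℝ 1 (cutoffSeq n) :=
  cutoff.contDiff.comp (contDiff_const_smul _)

theorem hasCompactSupport_cutoffSeq (n : ℕ) : HasCompactSupport (cutoffSeq n) :=
  cutoff.hasCompactSupport.comp_smul (by positivity)

theorem norm_cutoffSeq_le (n : ℕ) (x : Plane) : ‖cutoffSeq n x‖ ≤ 1 := by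
  rw [cutoffSeq, Real.norm_of_nonneg cutoff.nonneg]
  exact cutoff.le_one

theorem tendsto_inv_natCast_add_one : Tendsto (fun n : ℕ => (n + 1 : ℝ)⁻¹) atTop (𝓝 0) := by
  simpa [one_div] using tendsto_one_div_add_atTop_nhds_zero_nat (𝕜 := ℝ)

theorem tendsto_cutoffSeq (x : Plane) : Tendsto (fun n => cutoffSeq n x) atTop (𝓝 1) := by
  have h1 : Tendsto (fun n : ℕ => (n + 1 : ℝ)⁻¹ • x) atTop (𝓝 0) := by
    simpa using tendsto_inv_natCast_add_one.smul_const x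
  have h2 := (cutoff.continuous.tendsto 0).comp h1
  have h3 : cutoff (0 : Plane) = 1 := cutoff.one_of_mem_closedBall (by simp [cutoff])
  rw [h3] at h2
  exact h2

theorem partialD_cutoffSeq (n : ℕ) (i : Fin 2) (x : Plane) :
    partialD i (cutoffSeq n) x = (n + 1 : ℝ)⁻¹ * partialD i cutoff ((n + 1 : ℝ)⁻¹ • x) := by
  have h1 : DifferentiableAt ℝ cutoff ((n + 1 : ℝ)⁻¹ • x) :=
    (cutoff.contDiff (n := 1)).differentiable one_ne_zero _
  have h2 := h1.hasFDerivAt.comp x ((hasFDerivAt_id x).const_smul (n + 1 : ℝ)⁻¹)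
  have h3 : HasFDerivAt (cutoffSeq n) _ x := h2
  rw [partialD, h3.fderiv, partialD]
  simp

theorem exists_norm_partialD_cutoff_le : ∃ c : ℝ, ∀ i x, ‖partialD i cutoff x‖ ≤ c := by
  have h (i : Fin 2) :=
    (continuous_partialD (cutoff.contDiff (n := 1)) i).bounded_above_of_compact_support
      (hasCompactSupport_partialD cutoff.hasCompactSupport i)
  choose c hc using h
  refine ⟨max (c 0) (c 1), fun i x => (hc i x).trans ?_⟩
  fin_cases i
  · exact le_max_left _ _
  · exact le_max_right _ _

variable {C : Plane → Plane}

theorem integrable_divergence_smul (hC : IsAdmissibleVelocity C) {f : Plane → ℝ}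
    (hf : ContDiff ℝ 1 f) (hfi : Integrable f) (hfd : ∀ i, Integrable (partialD i f)) :
    Integrable (divergence fun z => f z • C z) := by
  obtain ⟨M, hM0, hM1, hM2⟩ := hC.exists_bounds
  have e : (divergence fun z => f z • C z)
      = fun x => divergence C x * f x + ∑ i, C x i * partialD i f x := by
    funext x
    rw [divergence_smul (hf.differentiable one_ne_zero x)
      (hC.contDiff.differentiable one_ne_zero x), mul_comm]
    simp only [mul_comm]
  rw [e]
  refine (hfi.bdd_mul (continuous_divergence hC.contDiff).aestronglyMeasurable
    (ae_of_all _ hM2)).add (integrable_finsetSum _ fun i _ => (hfd i).bdd_mul (c := M) ?_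
      (ae_of_all _ fun x => hM1 x i))
  have := hC.contDiff.continuous
  exact Continuous.aestronglyMeasurable (by fun_prop)

theorem integral_norm_divergence_smul_le {f : Plane → ℝ} {M : ℝ}
    (hM1 : ∀ x i, ‖C x i‖ ≤ M) (hM2 : ∀ x, ‖divergence C x‖ ≤ M) (hC : ContDiff ℝ 1 C)
    (hf : ContDiff ℝ 1 f) (hfi : Integrable f) (hfd : ∀ i, Integrable (partialD i f)) :
    ∫ x, ‖divergence (fun z => f z • C z) x‖
      ≤ M * ((∫ x, ‖f x‖) + ∑ i, ∫ x, ‖partialD i f x‖) := by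
  have hi : Integrable fun x => ‖f x‖ + ∑ i, ‖partialD i f x‖ :=
    hfi.norm.add (integrable_finsetSum _ fun i _ => (hfd i).norm)
  calc ∫ x, ‖divergence (fun z => f z • C z) x‖
      ≤ ∫ x, M * (‖f x‖ + ∑ i, ‖partialD i f x‖) := by
        refine integral_mono_of_nonneg (ae_of_all _ fun _ => norm_nonneg _) (hi.const_mul M)
          (ae_of_all _ fun x => ?_)
        simp only
        rw [divergence_smul (hf.differentiable one_ne_zero x) (hC.differentiable one_ne_zero x),
          mul_add, Finset.mul_sum]
        refine (norm_add_le _ _).trans (add_le_add ?_ (norm_sum_le_of_le _ fun i _ => ?_))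
        · rw [norm_mul, mul_comm]
          exact mul_le_mul_of_nonneg_right (hM2 x) (norm_nonneg _)
        · rw [norm_mul, mul_comm]
          exact mul_le_mul_of_nonneg_right (hM1 x i) (norm_nonneg _)
    _ = _ := by
        have hs : Integrable fun x => ∑ i, ‖partialD i f x‖ :=
          integrable_finsetSum _ fun i _ => (hfd i).norm
        rw [integral_const_mul, integral_add hfi.norm hs,
          integral_finsetSum Finset.univ (f := fun i x => ‖partialD i f x‖)
            (μ := (volume : Measure Plane)) fun i _ => (hfd i).norm]

/-- The convection operator acts as expected on integrable `C¹` functions with integrable partial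
derivatives. -/
theorem toL1_mem_convection (hC : IsAdmissibleVelocity C) {f : Plane → ℝ} (hf : ContDiff ℝ 1 f)
    (hfi : Integrable f volume) (hfd : ∀ i, Integrable (partialD i f)) :
    (hfi.toL1 f, (integrable_divergence_smul hC hf hfi hfd).neg.toL1 _) ∈
      convectionSubmodule C hC.contDiff := by
  obtain ⟨M, hM0, hM1, hM2⟩ := hC.exists_bounds
  obtain ⟨c, hc⟩ := exists_norm_partialD_cutoff_le
  have hCd := hC.contDiff.differentiable one_ne_zero
  have hdiv := integrable_divergence_smul hC hf hfi hfd
  set φ : ℕ → Plane → ℝ := fun n x => cutoffSeq n x * f x with hφ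
  have hφd : ∀ n, ContDiff ℝ 1 (φ n) := fun n => (contDiff_cutoffSeq n).mul hf
  have hφs : ∀ n, HasCompactSupport (φ n) := fun n => (hasCompactSupport_cutoffSeq n).mul_right
  have hφi : ∀ n, Integrable (φ n) := fun n =>
    (hφd n).continuous.integrable_of_hasCompactSupport (hφs n)
  have hψi : ∀ n, Integrable (divergence fun z => φ n z • C z) := fun n =>
    (continuous_divergence ((hφd n).smul hC.contDiff)).integrable_of_hasCompactSupport
      (hasCompactSupport_divergence (hφs n).smul_right)
  -- When the derivative falls on the cutoff it produces a factor `1 / (n + 1)`, so this term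
  -- vanishes in the limit.
  have hψ : ∀ n x, divergence (fun z => φ n z • C z) x
      = cutoffSeq n x * divergence (fun z => f z • C z) x
        + ∑ i, (n + 1 : ℝ)⁻¹ * partialD i cutoff ((n + 1 : ℝ)⁻¹ • x) * (f x * C x i) := by
    intro n x
    have e1 : (fun z => φ n z • C z) = fun z => cutoffSeq n z • (f z • C z) := by
      funext z; rw [hφ, smul_smul]
    rw [e1, divergence_smul ((contDiff_cutoffSeq n).differentiable one_ne_zero x)
      ((hf.differentiable one_ne_zero x).fun_smul (hCd x))]
    simp only [partialD_cutoffSeq, PiLp.smul_apply, smul_eq_mul]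
  have hterm : ∀ (n : ℕ) x i,
      ‖(n + 1 : ℝ)⁻¹ * partialD i cutoff ((n + 1 : ℝ)⁻¹ • x) * (f x * C x i)‖
      ≤ (n + 1 : ℝ)⁻¹ * (c * (‖f x‖ * M)) := by
    intro n x i
    have hn : (0 : ℝ) < n + 1 := by positivity
    have hc0 : 0 ≤ c := (norm_nonneg _).trans (hc 0 0)
    rw [norm_mul, norm_mul, norm_mul, norm_inv, Real.norm_of_nonneg hn.le, mul_assoc]
    exact mul_le_mul_of_nonneg_left (mul_le_mul (hc i _)
      (mul_le_mul_of_nonneg_left (hM1 x i) (norm_nonneg _))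
      (mul_nonneg (norm_nonneg _) (norm_nonneg _)) hc0) (inv_nonneg.2 hn.le)
  have hlim : Tendsto (fun n => ((hφi n).toL1 (φ n), (hψi n).neg.toL1 _)) atTop
      (𝓝 (hfi.toL1 f, hdiv.neg.toL1 _)) := by
    refine Tendsto.prodMk_nhds ?_ ?_
    · refine tendsto_toL1_of_dominated hφi hfi hfi.norm (fun n x => ?_) fun x => ?_
      · rw [hφ, norm_mul]
        exact mul_le_of_le_one_left (norm_nonneg _) (norm_cutoffSeq_le n x)
      · simpa using (tendsto_cutoffSeq x).mul_const (f x)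
    · refine tendsto_toL1_of_dominated (fun n => (hψi n).neg) hdiv.neg
        (hdiv.norm.add ((hfi.norm.mul_const M).const_mul (2 * c))) (fun n x => ?_) fun x => ?_
      · simp only [Pi.neg_apply, Pi.add_apply]
        rw [norm_neg, hψ, two_mul, add_mul]
        refine (norm_add_le _ _).trans (add_le_add ?_ ?_)
        · rw [norm_mul]
          exact mul_le_of_le_one_left (norm_nonneg _) (norm_cutoffSeq_le n x)
        · rw [Fin.sum_univ_two]
          have hn : (n + 1 : ℝ)⁻¹ ≤ 1 := inv_le_one_of_one_le₀ (by
            have : (0 : ℝ) ≤ n := n.cast_nonneg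
            linarith)
          have hc0 : 0 ≤ c := (norm_nonneg _).trans (hc 0 0)
          have hle : (n + 1 : ℝ)⁻¹ * (c * (‖f x‖ * M)) ≤ c * (‖f x‖ * M) :=
            mul_le_of_le_one_left (by positivity) hn
          exact (norm_add_le _ _).trans
            (add_le_add ((hterm n x 0).trans hle) ((hterm n x 1).trans hle))
      · simp only [Pi.neg_apply]
        refine Tendsto.neg ?_
        simp only [hψ]
        have h1 := (tendsto_cutoffSeq x).mul_const (divergence (fun z => f z • C z) x)
        have h2 : Tendsto (fun n : ℕ => ∑ i, (n + 1 : ℝ)⁻¹ *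
            partialD i cutoff ((n + 1 : ℝ)⁻¹ • x) * (f x * C x i)) atTop (𝓝 (∑ _i : Fin 2, 0)) := by
          refine tendsto_finsetSum _ fun i _ => ?_
          refine squeeze_zero_norm (fun n => hterm n x i) ?_
          simpa using tendsto_inv_natCast_add_one.mul_const (c * (‖f x‖ * M))
        simpa using h1.add h2
  refine mem_closure_of_tendsto (s := (convectionCore C hC.contDiff : Set (PlaneL1 × PlaneL1)))
    hlim (Eventually.of_forall fun n => ?_)
  exact ⟨φ n, hφd n, hφs n, (hφi n).coeFn_toL1, (hψi n).neg.coeFn_toL1⟩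

/-- The convection operator composed with the heat semigroup. -/
theorem exists_convection_heatCLM {ε : ℝ} (hε : 0 < ε) (hC : IsAdmissibleVelocity C) :
    ∃ M M' : ℝ, ∀ (t : ℝ≥0) (v : PlaneL1), 0 < t →
      ∃ k, (heatCLM ε t v, k) ∈ convectionSubmodule C hC.contDiff ∧
        ‖k‖ ≤ (M * (t : ℝ) ^ ((1 / 2 : ℝ) - 1) + M') * ‖v‖ := by
  obtain ⟨M, hM0, hM1, hM2⟩ := hC.exists_bounds
  refine ⟨M * (2 * (2 / ε)), M, fun t v ht => ?_⟩
  obtain ⟨f, hf, hfv, hfi, hfn, hfd⟩ := exists_contDiff_heatCLM hε ht v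
  have hmem := toL1_mem_convection hC hf hfi fun i => (hfd i).1
  rw [← (show heatCLM ε t v = hfi.toL1 f from
    Lp.ext (hfv.trans hfi.coeFn_toL1.symm))] at hmem
  refine ⟨_, hmem, ?_⟩
  rw [norm_toL1_eq_integral]
  simp only [Pi.neg_apply, norm_neg]
  refine (integral_norm_divergence_smul_le hM1 hM2 hC.contDiff hf hfi
    fun i => (hfd i).1).trans ?_
  rw [Fin.sum_univ_two]
  calc _ ≤ M * (‖v‖ + (2 / ε * (t : ℝ) ^ ((1 / 2 : ℝ) - 1) * ‖v‖
        + 2 / ε * (t : ℝ) ^ ((1 / 2 : ℝ) - 1) * ‖v‖)) := by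
        gcongr
        · exact (hfd 0).2
        · exact (hfd 1).2
    _ = _ := by ring

/-- A densely defined dissipative relation is single-valued. Density comes from the heat semigroup:
`T(t) v` lies in the domain for `t > 0` and tends to `v`. -/
theorem convection_single_valued {ε : ℝ} (hε : 0 < ε) (hC : IsAdmissibleVelocity C) {b : PlaneL1}
    (hb : (0, b) ∈ convectionSubmodule C hC.contDiff) : b = 0 := by
  refine eq_zero_of_dissipative_of_dense (fun p hp l hl => dissipative_convection hC hp hl) ?_ hb
  obtain ⟨M, M', hK⟩ := exists_convection_heatCLM hε hC
  intro v
  have h1 := ((isC0Semigroup_heatCLM hε).strongly_continuous v).tendsto 0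
  rw [heatCLM_zero] at h1
  refine mem_closure_of_tendsto (h1.mono_left (nhdsWithin_le_nhds (s := Set.Ioi 0))) ?_
  filter_upwards [self_mem_nhdsWithin] with t ht
  obtain ⟨k, hk, -⟩ := hK t v ht
  exact ⟨_, hk, rfl⟩

end Cutoff

/-! ### The state space -/

namespace StateSpace

@[ext]
theorem ext {x x' : StateSpace} (h₁ : x.home = x'.home) (h₂ : x.travel = x'.travel)
    (h₃ : x.work = x'.work) : x = x' :=
  WithLp.ofLp_injective 1 (Prod.ext h₁ (WithLp.ofLp_injective 1 (Prod.ext h₂ h₃)))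

variable (x x' : StateSpace) (c u : ℝ) (v w : PlaneL1)

@[simp] theorem home_mk : (mk u v w).home = u := rfl
@[simp] theorem travel_mk : (mk u v w).travel = v := rfl
@[simp] theorem work_mk : (mk u v w).work = w := rfl
@[simp] theorem home_add : (x + x').home = x.home + x'.home := rfl
@[simp] theorem travel_add : (x + x').travel = x.travel + x'.travel := rfl
@[simp] theorem work_add : (x + x').work = x.work + x'.work := rfl
@[simp] theorem home_sub : (x - x').home = x.home - x'.home := rfl
@[simp] theorem travel_sub : (x - x').travel = x.travel - x'.travel := rfl
@[simp] theorem work_sub : (x - x').work = x.work - x'.work := rfl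
@[simp] theorem home_smul : (c • x).home = c * x.home := rfl
@[simp] theorem travel_smul : (c • x).travel = c • x.travel := rfl
@[simp] theorem work_smul : (c • x).work = c • x.work := rfl

theorem norm_eq : ‖x‖ = ‖x.home‖ + (‖x.travel‖ + ‖x.work‖) := by
  rw [WithLp.prod_norm_eq_of_L1, WithLp.prod_norm_eq_of_L1]
  rfl

/-- The first component as a continuous linear map. -/
def homeL : StateSpace →L[ℝ] ℝ := WithLp.fstL 1 ℝ ℝ (WithLp 1 (PlaneL1 × PlaneL1))

/-- The second component as a continuous linear map. -/
def travelL : StateSpace →L[ℝ] PlaneL1 :=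
  (WithLp.fstL 1 ℝ PlaneL1 PlaneL1).comp (WithLp.sndL 1 ℝ ℝ (WithLp 1 (PlaneL1 × PlaneL1)))

/-- The third component as a continuous linear map. -/
def workL : StateSpace →L[ℝ] PlaneL1 :=
  (WithLp.sndL 1 ℝ PlaneL1 PlaneL1).comp (WithLp.sndL 1 ℝ ℝ (WithLp 1 (PlaneL1 × PlaneL1)))

/-- The continuous linear map with the given components. -/
def mkL (f : StateSpace →L[ℝ] ℝ) (g h : StateSpace →L[ℝ] PlaneL1) : StateSpace →L[ℝ] StateSpace :=
  (WithLp.prodContinuousLinearEquiv 1 ℝ ℝ (WithLp 1 (PlaneL1 × PlaneL1))).symm.toContinuousLinearMap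
    |>.comp (f.prod ((WithLp.prodContinuousLinearEquiv 1 ℝ PlaneL1 PlaneL1).symm
      |>.toContinuousLinearMap.comp (g.prod h)))

@[simp] theorem homeL_apply : homeL x = x.home := rfl
@[simp] theorem travelL_apply : travelL x = x.travel := rfl
@[simp] theorem workL_apply : workL x = x.work := rfl
@[simp] theorem mkL_apply (f : StateSpace →L[ℝ] ℝ) (g h : StateSpace →L[ℝ] PlaneL1) :
    mkL f g h x = mk (f x) (g x) (h x) := rfl

theorem travelL_surjective : Function.Surjective travelL := fun v => ⟨mk 0 v 0, rfl⟩

/-- The linear relation `G` acting on the second component only. -/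
def liftGraph (G : Set (PlaneL1 × PlaneL1)) : Set (StateSpace × StateSpace) :=
  {p | ∃ c, (p.1.travel, c) ∈ G ∧ p.2 = mk 0 c 0}

variable {G : Set (PlaneL1 × PlaneL1)}

theorem mem_liftGraph {p : StateSpace × StateSpace} :
    p ∈ liftGraph G ↔ p.2.home = 0 ∧ p.2.work = 0 ∧ (p.1.travel, p.2.travel) ∈ G := by
  constructor
  · rintro ⟨c, h1, h2⟩
    rw [h2]
    exact ⟨rfl, rfl, h1⟩
  · rintro ⟨h1, h2, h3⟩
    exact ⟨_, h3, ext h1 rfl h2⟩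

theorem hasResolvent_liftGraph {l : ℝ} (hl : 0 < l) {J : PlaneL1 →L[ℝ] PlaneL1}
    (hJ : HasResolvent G l J) :
    HasResolvent (liftGraph G) l (mkL (l⁻¹ • homeL) (J.comp travelL) (l⁻¹ • workL)) := by
  intro p
  have h1 : l⁻¹ * (l * p.1.home - p.2.home) = p.1.home ↔ p.2.home = 0 := by
    rw [inv_mul_eq_iff_eq_mul₀ hl.ne', sub_eq_self]
  have h2 : l⁻¹ • (l • p.1.work - p.2.work) = p.1.work ↔ p.2.work = 0 := by
    rw [inv_smul_eq_iff₀ hl.ne', sub_eq_self]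
  have h3 := hJ (p.1.travel, p.2.travel)
  rw [mem_liftGraph, StateSpace.ext_iff, h3]
  simp only [mkL_apply, home_mk, travel_mk, work_mk, smul_apply, homeL_apply, workL_apply,
    ContinuousLinearMap.comp_apply, travelL_apply, home_sub, travel_sub, work_sub, home_smul,
    travel_smul, work_smul, smul_eq_mul, h1, h2]
  tauto

theorem dissipative_liftGraph (hG : ∀ p ∈ G, ∀ l > (0 : ℝ), l * ‖p.1‖ ≤ ‖l • p.1 - p.2‖)
    {p : StateSpace × StateSpace} (hp : p ∈ liftGraph G) {l : ℝ} (hl : 0 < l) :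
    l * ‖p.1‖ ≤ ‖l • p.1 - p.2‖ := by
  obtain ⟨h1, h2, h3⟩ := mem_liftGraph.1 hp
  have h4 := hG _ h3 l hl
  rw [norm_eq, norm_eq]
  simp only [home_sub, travel_sub, work_sub, home_smul, travel_smul, work_smul, h1, h2, sub_zero,
    norm_mul, norm_smul, Real.norm_of_nonneg hl.le, mul_add]
  gcongr

/-- The domain contains the preimage of a dense set under an open map, namely the surjective
projection to the second component. -/
theorem dense_liftGraph (hG : Dense (Prod.fst '' G)) : Dense (Prod.fst '' liftGraph G) := by
  refine (hG.preimage (travelL.isOpenMap travelL_surjective)).mono ?_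
  rintro x ⟨⟨v, c⟩, h1, h2⟩
  refine ⟨(x, mk 0 c 0), ⟨c, ?_, rfl⟩, rfl⟩
  rw [← travelL_apply, ← h2]
  exact h1

end StateSpace

/-! ### The transport operator on the state space -/

section Transport

open StateSpace

variable {ε : ℝ} {C : Plane → Plane}

/-- The graph of `(u, v, w) ↦ (0, (A + B) v, 0)`. -/
def transportGraph (ε : ℝ) (C : Plane → Plane) : Set (StateSpace × StateSpace) :=
  liftGraph (sumGraph (diffusionGraph ε) (convectionGraph C))

theorem sumGraph_diffusion_convection (hε : 0 < ε) (hC : IsAdmissibleVelocity C) :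
    sumGraph (diffusionGraph ε) (convectionGraph C) =
      sumGraph (generatorGraph fun t => ⇑(heatCLM ε t))
        (convectionSubmodule C hC.contDiff : Set (PlaneL1 × PlaneL1)) := by
  rw [diffusionGraph_eq hε, coe_convectionSubmodule]

theorem dissipative_sumGraph (hε : 0 < ε) (hC : IsAdmissibleVelocity C) {p : PlaneL1 × PlaneL1}
    (hp : p ∈ sumGraph (diffusionGraph ε) (convectionGraph C)) {l : ℝ} (hl : 0 < l) :
    l * ‖p.1‖ ≤ ‖l • p.1 - p.2‖ := by
  rw [sumGraph_diffusion_convection hε hC] at hp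
  obtain ⟨a, b, ha, hb, hab⟩ := hp
  rw [hab, ← sub_sub]
  exact dissipative_add (norm_heatCLM_le hε) ha
    (fun l hl => dissipative_convection hC hb hl) hl

theorem sumGraph_diffusion_convection_hasResolvent (hε : 0 < ε) (hC : IsAdmissibleVelocity C) :
    Dense (Prod.fst '' sumGraph (diffusionGraph ε) (convectionGraph C)) ∧ ∃ l₀ > 0, ∀ l > l₀,
      ∃ J, HasResolvent (sumGraph (diffusionGraph ε) (convectionGraph C)) l J := by
  obtain ⟨M, M', hK⟩ := exists_convection_heatCLM hε hC
  rw [sumGraph_diffusion_convection hε hC]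
  exact sumGraph_hasResolvent (isC0Semigroup_heatCLM hε) (norm_heatCLM_le hε)
    (Submodule.isClosed_topologicalClosure _) (fun b hb => convection_single_valued hε hC hb) hK

theorem dense_transportGraph (hε : 0 < ε) (hC : IsAdmissibleVelocity C) :
    Dense (Prod.fst '' transportGraph ε C) :=
  dense_liftGraph (sumGraph_diffusion_convection_hasResolvent hε hC).1

/-- Bounded perturbations of the transport operator generate semigroups. -/
theorem exists_semigroup_transport (hε : 0 < ε) (hC : IsAdmissibleVelocity C)
    (R : StateSpace →L[ℝ] StateSpace) {ω h : ℝ} (hh : 0 < h)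
    (hR : ∀ x, ‖x + h • R x‖ ≤ (1 + h * ω) * ‖x‖) :
    ∃ T : ℝ≥0 → StateSpace →L[ℝ] StateSpace, IsC0Semigroup T ∧
      generatorGraph (fun t => ⇑(T t)) = {p | (p.1, p.2 - R p.1) ∈ transportGraph ε C} ∧
      ∀ t : ℝ≥0, ‖T t‖ ≤ Real.exp (ω * t) := by
  obtain ⟨-, l₀, hl₀, hJ⟩ := sumGraph_diffusion_convection_hasResolvent hε hC
  exact exists_semigroup_add_bounded
    (fun l hl => (hJ l hl).imp' _ fun J => hasResolvent_liftGraph (hl₀.trans hl))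
    (fun p hp l hl =>
      dissipative_liftGraph (fun q hq l hl => dissipative_sumGraph hε hC hq hl) hp hl)
    (dense_transportGraph hε hC) R hh hR

end Transport

/-! ### The reaction and coupling operators -/

section Reaction

open StateSpace

variable {ε σ γ α χ : ℝ} {C : Plane → Plane} {y : Plane}

/-- The operator `(u, v, w) ↦ (-γ u, -α v, β v - χ w)`. -/
def reaction (γ α β χ : ℝ) : StateSpace →L[ℝ] StateSpace :=
  mkL (-γ • homeL) (-α • travelL) (β • travelL - χ • workL)

theorem reaction_apply (γ α β χ : ℝ) (x : StateSpace) :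
    reaction γ α β χ x = mk (-γ * x.home) (-α • x.travel) (β • x.travel - χ • x.work) := rfl

theorem mem_uncoupledGraph {p : StateSpace × StateSpace} :
    p ∈ uncoupledGraph ε γ α χ C ↔ (p.1, p.2 - reaction γ α α χ p.1) ∈ transportGraph ε C := by
  constructor
  · rintro ⟨a, b, ha, hb, hp⟩
    refine ⟨a + b, ⟨a, b, ha, hb, rfl⟩, ?_⟩
    simp only [hp, reaction_apply]
    ext1 <;> simp
  · rintro ⟨c, ⟨a, b, ha, hb, hc⟩, hp⟩
    refine ⟨a, b, ha, hb, ?_⟩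
    rw [sub_eq_iff_eq_add.1 hp, reaction_apply]
    simp only at hc
    rw [hc]
    ext1 <;> simp [sub_eq_add_neg]

/-- The coupling operator as a continuous linear map. -/
def couplingL (σ γ χ : ℝ) (y : Plane) : StateSpace →L[ℝ] StateSpace :=
  (χ • (L1.integralCLM (μ := (volume : Measure Plane)) (E := ℝ)).comp workL).smulRight (mk 1 0 0)
    + homeL.smulRight (mk 0 (γ • homeDensityL1 σ y) 0)

theorem couplingL_apply (x : StateSpace) : couplingL σ γ χ y x = coupling σ γ χ y x := by
  have h : ∫ z, x.work z = L1.integralCLM (μ := (volume : Measure Plane)) (E := ℝ) x.work := by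
    rw [← L1.integral_eq_integral, L1.integral_eq]
  rw [coupling, h]
  ext1 <;> simp [couplingL, smul_smul, mul_comm]

theorem IsCompactOperator.smulRight {E F : Type*} [NormedAddCommGroup E] [NormedSpace ℝ E]
    [NormedAddCommGroup F] [NormedSpace ℝ F] (f : E →L[ℝ] ℝ) (z : F) :
    IsCompactOperator (f.smulRight z) :=
  (isCompactOperator_of_locallyCompactSpace_dom f).clm_comp
    (ContinuousLinearMap.toSpanSingleton ℝ z)

/-- Both summands have rank at most one: they factor through the scalars `∫ w` and `u`. -/
theorem isCompactOperator_couplingL : IsCompactOperator (couplingL σ γ χ y) :=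
  (IsCompactOperator.smulRight _ _).add (IsCompactOperator.smulRight _ _)

theorem mem_returnHomeGraph {p : StateSpace × StateSpace} :
    p ∈ returnHomeGraph ε σ γ α χ C y ↔
      (p.1, p.2 - couplingL σ γ χ y p.1) ∈ uncoupledGraph ε γ α χ C := by
  constructor
  · rintro ⟨z, hz, hp⟩
    rwa [hp, couplingL_apply, add_sub_cancel_right]
  · intro h
    exact ⟨_, h, by rw [couplingL_apply, sub_add_cancel]⟩

theorem exists_isReturnHomeSemigroup (hε : 0 < ε) (hC : IsAdmissibleVelocity C) :
    ∃ T : ℝ≥0 → StateSpace →L[ℝ] StateSpace, IsReturnHomeSemigroup ε σ γ α χ C y T := by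
  set R := reaction γ α α χ + couplingL σ γ χ y with hR
  -- Only generation matters here, so the crude rate `‖R‖` with step `h = 1` is enough.
  obtain ⟨T, hT, hgen, -⟩ := exists_semigroup_transport hε hC R (ω := ‖R‖) one_pos fun x => by
    rw [one_smul, one_mul, add_mul, one_mul]
    exact (norm_add_le _ _).trans (by gcongr; exact R.le_opNorm x)
  refine ⟨T, hT, hgen.trans (Set.ext fun p => ?_)⟩
  rw [mem_returnHomeGraph, mem_uncoupledGraph, Set.mem_ofPred_eq, hR, add_apply, sub_sub, add_comm]

/-- The smallness of `h` keeps the diagonal factors `1 - h γ`, `1 - h α`, `1 - h χ` nonnegative, so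
each is at most `1 - h min(γ, α, χ)`. The off-diagonal term `β v` adds at most `h β ‖v‖`. The
parameter `β` is kept separate from `α` so that it can be made small by rescaling. -/
theorem norm_add_smul_reaction_le (hγ : 0 < γ) (hα : 0 < α) (hχ : 0 < χ) {β : ℝ} (hβ : 0 ≤ β)
    {h : ℝ} (hh : 0 < h) (hh1 : h * (γ + α + χ) ≤ 1) (x : StateSpace) :
    ‖x + h • reaction γ α β χ x‖ ≤ (1 + h * (-min γ (min α χ) + β)) * ‖x‖ := by
  set m := min γ (min α χ) with hm
  have key : ∀ δ, m ≤ δ → δ ≤ γ + α + χ → |1 - h * δ| ≤ 1 - h * m := by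
    intro δ h1 h2
    have h3 := mul_le_mul_of_nonneg_left h2 hh.le
    have h4 := mul_le_mul_of_nonneg_left h1 hh.le
    rw [abs_of_nonneg (by linarith)]
    linarith
  have k1 := key γ (min_le_left _ _) (by linarith)
  have k2 := key α ((min_le_right _ _).trans (min_le_left _ _)) (by linarith)
  have k3 := key χ ((min_le_right _ _).trans (min_le_right _ _)) (by linarith)
  have e1 : x.home + h * (-γ * x.home) = (1 - h * γ) * x.home := by ring
  have e2 : x.travel + h • -α • x.travel = (1 - h * α) • x.travel := by module
  have e3 : x.work + h • (β • x.travel - χ • x.work)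
      = (1 - h * χ) • x.work + (h * β) • x.travel := by module
  rw [norm_eq, norm_eq x, reaction_apply]
  simp only [home_add, travel_add, work_add, home_smul, travel_smul, work_smul, home_mk, travel_mk,
    work_mk, e1, e2, e3]
  have n1 : ‖(1 - h * γ) * x.home‖ ≤ (1 - h * m) * ‖x.home‖ := by
    rw [norm_mul]; exact mul_le_mul_of_nonneg_right k1 (norm_nonneg _)
  have n2 : ‖(1 - h * α) • x.travel‖ ≤ (1 - h * m) * ‖x.travel‖ := by
    rw [norm_smul]; exact mul_le_mul_of_nonneg_right k2 (norm_nonneg _)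
  have n3 : ‖(1 - h * χ) • x.work + (h * β) • x.travel‖
      ≤ (1 - h * m) * ‖x.work‖ + h * β * ‖x.travel‖ := by
    refine (norm_add_le _ _).trans (add_le_add ?_ ?_)
    · rw [norm_smul]; exact mul_le_mul_of_nonneg_right k3 (norm_nonneg _)
    · rw [norm_smul, Real.norm_of_nonneg (by positivity)]
  have n4 : 0 ≤ h * β * ‖x.home‖ := by positivity
  have n5 : 0 ≤ h * β * ‖x.work‖ := by positivity
  linarith

end Reaction

/-! ### The essential growth rate -/

section Conjugation

variable {Z : Type*} [NormedAddCommGroup Z] [NormedSpace ℝ Z]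

theorem IsC0Semigroup.conj {T : ℝ≥0 → Z →L[ℝ] Z} (hT : IsC0Semigroup T) {S S' : Z →L[ℝ] Z}
    (h : ∀ z, S (S' z) = z) (h' : ∀ z, S' (S z) = z) :
    IsC0Semigroup fun t => (S'.comp (T t)).comp S where
  map_zero := by ext z; simp [hT.map_zero, h']
  map_add s t := by ext z; simp [hT.map_add, h]
  strongly_continuous z := S'.continuous.comp (hT.strongly_continuous (S z))

theorem mem_generatorGraph_conj {T : ℝ≥0 → Z →L[ℝ] Z} {S S' : Z →L[ℝ] Z}
    (h' : ∀ z, S' (S z) = z) {p : Z × Z}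
    (hp : (S p.1, S p.2) ∈ generatorGraph fun t => ⇑(T t)) :
    p ∈ generatorGraph fun t => ⇑((S'.comp (T t)).comp S) := by
  have h1 := (S'.continuous.tendsto _).comp hp
  simp only [h'] at h1
  refine h1.congr fun t => ?_
  simp [h']

end Conjugation

/-! ### Decay of the uncoupled semigroup and the final estimate. -/

section Growth

open StateSpace

variable {ε σ γ α χ : ℝ} {C : Plane → Plane} {y : Plane}

/-- The rescaling `(u, v, w) ↦ (u, v, κ w)`. -/
def scaleWork (κ : ℝ) : StateSpace →L[ℝ] StateSpace := mkL homeL travelL (κ • workL)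

theorem scaleWork_apply (κ : ℝ) (x : StateSpace) :
    scaleWork κ x = mk x.home x.travel (κ • x.work) := rfl

theorem scaleWork_scaleWork {κ κ' : ℝ} (h : κ * κ' = 1) (x : StateSpace) :
    scaleWork κ (scaleWork κ' x) = x := by
  simp only [scaleWork_apply, home_mk, travel_mk, work_mk, smul_smul, h, one_smul]
  rfl

/-- The uncoupled operator generates a semigroup whose growth rate exceeds `-min γ α χ` by as little
as desired: for small `κ` the production of `w` from `v` is small in the norm
`|u| + ‖v‖ + κ ‖w‖`. -/
theorem exists_uncoupled_semigroup (hε : 0 < ε) (hγ : 0 < γ) (hα : 0 < α) (hχ : 0 < χ)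
    (hC : IsAdmissibleVelocity C) {κ : ℝ} (hκ : 0 < κ) :
    ∃ (U : ℝ≥0 → StateSpace →L[ℝ] StateSpace) (M : ℝ), IsC0Semigroup U ∧
      uncoupledGraph ε γ α χ C ⊆ generatorGraph (fun t => ⇑(U t)) ∧
      ∀ t : ℝ≥0, ‖U t‖ ≤ M * Real.exp ((-min γ (min α χ) + κ * α) * t) := by
  have hs : 0 < γ + α + χ := by positivity
  -- Rescaling the third component by `κ` changes the production term from `α v` to `κ α v`. The
  -- step `h = 1 / (γ + α + χ)` is the largest that the logarithmic norm estimate admits.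
  obtain ⟨V, hV, hgen, hn⟩ := exists_semigroup_transport hε hC (reaction γ α (κ * α) χ)
    (inv_pos.2 hs) (norm_add_smul_reaction_le hγ hα hχ (by positivity) (inv_pos.2 hs)
      (inv_mul_cancel₀ hs.ne').le)
  have h1 := scaleWork_scaleWork (inv_mul_cancel₀ hκ.ne')
  have h2 := scaleWork_scaleWork (mul_inv_cancel₀ hκ.ne')
  refine ⟨fun t => ((scaleWork κ⁻¹).comp (V t)).comp (scaleWork κ),
    ‖scaleWork κ⁻¹‖ * ‖scaleWork κ‖, hV.conj h2 h1, fun p hp => ?_, fun t => ?_⟩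
  · refine mem_generatorGraph_conj h1 ?_
    rw [hgen, Set.mem_ofPred_eq]
    obtain ⟨q1, q2, q3⟩ := mem_liftGraph.1 (mem_uncoupledGraph.1 hp)
    refine mem_liftGraph.2 ⟨q1, ?_, q3⟩
    have : κ • p.2.work - (κ * α) • p.1.travel + χ • κ • p.1.work
      = κ • (p.2.work - (α • p.1.travel - χ • p.1.work)) := by module
    simp only [scaleWork_apply, reaction_apply, work_sub, work_mk, travel_mk] at q2 ⊢
    rw [q2, smul_zero] at this
    rw [← this]
    abel
  · refine (ContinuousLinearMap.opNorm_comp_le _ _).trans ?_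
    calc _ ≤ ‖scaleWork κ⁻¹‖ * ‖V t‖ * ‖scaleWork κ‖ := by
          gcongr; exact ContinuousLinearMap.opNorm_comp_le _ _
      _ ≤ ‖scaleWork κ⁻¹‖ * Real.exp ((-min γ (min α χ) + κ * α) * t) * ‖scaleWork κ‖ := by
          gcongr; exact hn t
      _ = _ := by ring

theorem dense_returnHomeGraph (hε : 0 < ε) (hC : IsAdmissibleVelocity C) :
    Dense (Prod.fst '' returnHomeGraph ε σ γ α χ C y) := by
  refine (dense_transportGraph hε hC).mono ?_
  rintro _ ⟨⟨x, z⟩, h, rfl⟩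
  refine ⟨(x, z + reaction γ α α χ x + couplingL σ γ χ y x), ?_, rfl⟩
  rw [mem_returnHomeGraph, mem_uncoupledGraph]
  simpa using h

theorem IsReturnHomeSemigroup.growthRate_le (hε : 0 < ε) (hγ : 0 < γ) (hα : 0 < α) (hχ : 0 < χ)
    (hC : IsAdmissibleVelocity C) {T : ℝ≥0 → StateSpace →L[ℝ] StateSpace}
    (hT : IsReturnHomeSemigroup ε σ γ α χ C y T) {ω : EReal} (hω : IsEssGrowthRate T ω) :
    ω ≤ ((-(min γ (min α χ)) : ℝ) : EReal) := by
  refine le_of_forall_gt_imp_ge_of_dense fun a ha => ?_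
  obtain ⟨c, h1, h2⟩ := EReal.lt_iff_exists_real_btwn.1 ha
  refine le_trans ?_ h2.le
  -- This `κ` makes the rate `-min(γ, α, χ) + κ α` equal to `c`; it is positive because `c` exceeds
  -- `-min(γ, α, χ)`.
  set κ : ℝ := (c + min γ (min α χ)) / α with hκ
  have hκ0 : 0 < κ := div_pos (by linarith [EReal.coe_lt_coe_iff.1 h1]) hα
  obtain ⟨U, M, hU, hgen, hn⟩ := exists_uncoupled_semigroup hε hγ hα hχ hC hκ0
  have e : -min γ (min α χ) + κ * α = c := by rw [hκ, div_mul_cancel₀ _ hα.ne']; ring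
  rw [e] at hn
  refine hω.le_of_le_mul_exp (M := M) fun t => le_trans ?_ (hn t)
  refine essSeminorm_le_of_compact_perturbation hT.1 hU
    (isCompactOperator_couplingL (σ := σ) (γ := γ) (χ := χ) (y := y)) ?_ ?_ t
  · intro q hq
    rw [hT.2] at hq
    exact hgen (mem_returnHomeGraph.1 hq)
  · rw [hT.2]
    exact dense_returnHomeGraph hε hC

end Growth

end

theorem lemma4p5 (ε σ γ α χ : ℝ) (hε : 0 < ε) (hσ : 0 < σ) (hγ : 0 < γ) (hα : 0 < α) (hχ : 0 < χ)
    (y : Plane) (C : Plane → Plane) (hC : IsAdmissibleVelocity C) :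
    (∃ T : ℝ≥0 → StateSpace →L[ℝ] StateSpace, IsReturnHomeSemigroup ε σ γ α χ C y T) ∧
    ∀ T : ℝ≥0 → StateSpace →L[ℝ] StateSpace, IsReturnHomeSemigroup ε σ γ α χ C y T →
      ∃ ω : EReal, IsEssGrowthRate T ω ∧ ω ≤ ((-(min γ (min α χ)) : ℝ) : EReal) := by
  refine ⟨exists_isReturnHomeSemigroup hε hC, fun T hT => ?_⟩
  obtain ⟨ω, hω⟩ := exists_isEssGrowthRate hT.1.map_add hT.1.exists_norm_le
  exact ⟨ω, hω, hT.growthRate_le hε hγ hα hχ hC hω⟩
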